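/- Let $p,q\in\mathbb C$ with $|p|<1$ and $0<|q|<1$, and put $$\theta(z)=\prod_{j=0}^\infty(1-p^jz)\Bigl(1-\frac{p^{j+1}}z\Bigr),\qquad (z)_k=\prod_{j=0}^{k-1}\theta(zq^j),\qquad (z_1,\dots,z_m)_k=(z_1)_k\cdots(z_m)_k .$$ Let $n,N\ge 0$ be integers and let $a,b,c,d,e,f,g$ be non-zero complex numbers with $bcdefg=q^{4+N-2n}a^3$; put $\lambda=a^2q^{2-n}/bcd$. Assume that none of the denominators appearing below vanishes, that is, $\theta(a)$, $\theta(\lambda)$, $(q,aq/b,aq/c,aq/d,aq/e,aq/f,aq/g,aq^{N+1})_N$, $(\lambda q/e,\lambda q/f,\lambda q/g,\lambda q^{N+1},\lambda q)_N$ and, if $n\ge1$, $(\lambda b/a,\lambda c/a,\lambda d/a)_{n-1}$ are all non-zero. Then $$\begin{aligned} &\sum_{0\le x_1<x_2<\dots<x_n\le N}\ \prod_{1\le j<k\le n}\bigl(q^{x_j}\theta(q^{x_k-x_j})\theta(aq^{x_j+x_k})\bigr)^2\\ &\qquad\times\prod_{j=1}^n\left(\frac{\theta(aq^{2x_j})}{\theta(a)}\,\frac{(a,b,c,d,e,f,g,q^{-N})_{x_j}}{(q,aq/b,aq/c,aq/d,aq/e,aq/f,aq/g,aq^{N+1})_{x_j}}\,q^{x_j}\right)\\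 &=\left(\frac a\lambda\right)^{(N+1-n)n}\frac{(aq)_N^n}{(\lambda q)_N^n}\prod_{j=1}^n\frac{(b,c,d)_{j-1}\,(\lambda q/e,\lambda q/f,\lambda q/g)_{N+1-j}}{(\lambda b/a,\lambda c/a,\lambda d/a)_{j-1}\,(aq/e,aq/f,aq/g)_{N+1-j}}\\ &\qquad\times\sum_{0\le x_1<x_2<\dots<x_n\le N}\ \prod_{1\le j<k\le n}\bigl(q^{x_j}\theta(q^{x_k-x_j})\theta(\lambda q^{x_j+x_k})\bigr)^2\\ &\qquad\times\prod_{j=1}^n\left(\frac{\theta(\lambda q^{2x_j})}{\theta(\lambda)}\,\frac{(\lambda,\lambda b/a,\lambda c/a,\lambda d/a,e,f,g,q^{-N})_{x_j}}{(q,aq/b,aq/c,aq/d,\lambda q/e,\lambda q/f,\lambda q/g,\lambda q^{N+1})_{x_j}}\,q^{x_j}\right). \end{aligned}$$ (If $n>N+1$, both sums are empty and both sides are understood to be $0$.) -/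

import Mathlib

open scoped BigOperators

noncomputable section

/-- The multiplicative theta function `θ(z) = ∏_{j ≥ 0} (1 - p ^ j z) (1 - p ^ (j + 1) / z)`
of nome `p` (for `|p| < 1` and `z ≠ 0`). -/
def ellTheta (p z : ℂ) : ℂ :=
  ∏' j : ℕ, (1 - p ^ j * z) * (1 - p ^ (j + 1) / z)

/-- The product defining `ellTheta` converges for `|p| < 1`. -/
theorem ellTheta_multipliable (p z : ℂ) (hp : ‖p‖ < 1) :
    Multipliable (fun j : ℕ => (1 - p ^ j * z) * (1 - p ^ (j + 1) / z)) := by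
  have hs : Summable (fun j : ℕ => ‖p‖ ^ j) :=
    summable_geometric_of_lt_one (norm_nonneg p) hp
  have h1 : Multipliable (fun j : ℕ => 1 + (-(p ^ j * z))) := by
    apply multipliable_one_add_of_summable
    simpa [norm_mul, norm_pow] using hs.mul_right ‖z‖
  have h2 : Multipliable (fun j : ℕ => 1 + (-(p ^ (j + 1) / z))) := by
    apply multipliable_one_add_of_summable
    simpa [norm_div, norm_pow, pow_succ, mul_div_assoc] using hs.mul_right (‖p‖ / ‖z‖)
  simpa [sub_eq_add_neg] using h1.mul h2

/-- The elliptic shifted factorial `(z)_k = ∏_{j=0}^{k-1} θ(z q ^ j)`. -/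
def ellFac (p q z : ℂ) (k : ℕ) : ℂ :=
  ∏ j ∈ Finset.range k, ellTheta p (z * q ^ j)

/-- The usual short-hand `(z₁, …, z_m)_k = (z₁)_k ⋯ (z_m)_k`. -/
def ellFacs (p q : ℂ) (zs : List ℂ) (k : ℕ) : ℂ :=
  (zs.map fun z => ellFac p q z k).prod

/-- The one-variable very-well-poised elliptic weight
`θ(a q^{2x})/θ(a) * (a,b,c,d,e,f,g,q^{-N})_x
  / (q,aq/b,aq/c,aq/d,aq/e,aq/f,aq/g,aq^{N+1})_x * q^x`. -/
def ellWeight (p q : ℂ) (N : ℕ) (a b c d e f g : ℂ) (x : ℕ) : ℂ :=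
  ellTheta p (a * q ^ (2 * x)) / ellTheta p a *
    (ellFacs p q [a, b, c, d, e, f, g, q ^ (-(N : ℤ))] x /
      ellFacs p q [q, a * q / b, a * q / c, a * q / d, a * q / e, a * q / f, a * q / g,
        a * q ^ (N + 1)] x) * q ^ x

open Classical in
/-- The discrete elliptic Selberg sum (case `t = q`), over all `0 ≤ x₁ < x₂ < ⋯ < x_n ≤ N`. -/
def ellSelbergSum (p q : ℂ) (n N : ℕ) (a b c d e f g : ℂ) : ℂ :=
  ∑ x : Fin n → Fin (N + 1) with StrictMono x,
    (∏ j : Fin n, ∏ k ∈ Finset.Ioi j,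
      (q ^ (x j : ℕ) * ellTheta p (q ^ (((x k : ℕ) : ℤ) - ((x j : ℕ) : ℤ))) *
        ellTheta p (a * q ^ ((x j : ℕ) + (x k : ℕ)))) ^ 2) *
    ∏ j : Fin n, ellWeight p q N a b c d e f g (x j : ℕ)

end

open Filter Topology

/-! The pairwise factors of the Selberg sum are, up to powers of q, squares of brackets
θ(aux)θ(u/x)/u with u = q^{x_k}, x = q^{x_j}. The Jacobi triple product shows that the bracket has
rank two, f(u)g(x) - g(u)f(x) (`ellBracket_rank_two`). Hence the product of brackets over pairs is a
projective Vandermonde determinant, and a determinant whose entries are products of n-1 brackets is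
a constant times it (`det_bracketProd`).

Write one of the two Vandermonde factors as such a determinant with nodes built from b, c, and the
other with nodes built from e, f. Cauchy–Binet then makes the n-fold sum a determinant of
one-variable sums. The brackets are absorbed into the weight and shift (b, c, e, f) to (bq^k,
cq^{n-1-k}, eq^l, fq^{n-1-l}) (`ellSelbergSum_eq_det`). Since bc and ef change by q^{n-1} whatever k
and l are, every entry obeys the elliptic Bailey transformation with the same λ and a prefactor
depending only on the column. The determinant therefore turns into the one for the λ-sum
(`det_bailey`), and it remains to compare constants factor by factor (`selberg_factor_transform`).

The Bailey transformation comes from the Frenkel–Turaev summation: expand (b, c, d)_x by it,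
interchange the sums, and apply it again to the inner sum. The Frenkel–Turaev sum is proved by
induction on N from the three-term theta relation, which is itself the Plücker relation for rank-two
brackets.

The determinants require division by quantities that may vanish under the stated hypotheses. The
parameters are therefore moved along a real curve on which both balancing relations persist and
genericity fails only countably often; continuity at the original point finishes the proof. -/

/-! ### Euler products, and the zeros, inversion and continuity of θ. -/

/-- The infinite shifted factorial `∏_{j ≥ 0} (1 - p ^ j z)`. -/
noncomputable def eulerProd (p z : ℂ) : ℂ := ∏' j : ℕ, (1 - p ^ j * z)

theorem summable_norm_pow_mul {p : ℂ} (hp : ‖p‖ < 1) (z : ℂ) :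
    Summable (fun j : ℕ => ‖-(p ^ j * z)‖) := by
  simpa [norm_mul, norm_pow] using (summable_geometric_of_lt_one (norm_nonneg p) hp).mul_right ‖z‖

theorem eulerProd_multipliable {p : ℂ} (hp : ‖p‖ < 1) (z : ℂ) :
    Multipliable (fun j : ℕ => 1 - p ^ j * z) := by
  simpa [sub_eq_add_neg] using multipliable_one_add_of_summable (summable_norm_pow_mul hp z)

theorem eulerProd_eq_mul {p : ℂ} (hp : ‖p‖ < 1) (z : ℂ) :
    eulerProd p z = (1 - z) * eulerProd p (p * z) := by
  have h : Multipliable (fun j : ℕ => 1 - p ^ (j + 1) * z) := by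
    simpa [pow_succ, mul_assoc] using eulerProd_multipliable hp (p * z)
  have := tprod_eq_zero_mul' (f := fun j : ℕ => 1 - p ^ j * z) h
  simpa [eulerProd, pow_succ, mul_assoc] using this

theorem eulerProd_ne_zero {p : ℂ} (hp : ‖p‖ < 1) {z : ℂ} (hz : ∀ j : ℕ, p ^ j * z ≠ 1) :
    eulerProd p z ≠ 0 := by
  have := tprod_one_add_ne_zero_of_summable (f := fun j : ℕ => -(p ^ j * z))
    (fun j h => hz j (by linear_combination -h)) (summable_norm_pow_mul hp z)
  simpa [eulerProd, sub_eq_add_neg] using this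

/-- Near z the j-th factor differs from 1 by at most ‖p‖^j (‖z‖ + 1), which is summable, so the
partial products converge locally uniformly on a ball. -/
theorem eulerProd_continuous {p : ℂ} (hp : ‖p‖ < 1) : Continuous (eulerProd p) := by
  rw [continuous_iff_continuousAt]
  intro z
  have hu : Summable (fun j : ℕ => ‖p‖ ^ j * (‖z‖ + 1)) :=
    (summable_geometric_of_lt_one (norm_nonneg p) hp).mul_right _
  have := (Summable.hasProdLocallyUniformlyOn_nat_one_add
    (f := fun (j : ℕ) (w : ℂ) => -(p ^ j * w))
    (Metric.isOpen_ball (x := z) (ε := 1)) hu (Eventually.of_forall fun j w hw => ?_)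
    (fun j => by fun_prop)).tendstoLocallyUniformlyOn_finsetRange.continuousOn ?_
  · have h2 := this.continuousAt (Metric.isOpen_ball.mem_nhds (Metric.mem_ball_self one_pos))
    have h3 : eulerProd p = fun x => ∏' i : ℕ, (1 + -(p ^ i * x)) := by
      funext x; simp [eulerProd, sub_eq_add_neg]
    rwa [h3]
  · rw [norm_neg, norm_mul, norm_pow]
    gcongr
    rw [mem_ball_iff_norm] at hw
    calc ‖w‖ = ‖z + (w - z)‖ := by congr 1; ring
      _ ≤ ‖z‖ + 1 := (norm_add_le _ _).trans (by gcongr)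
  · exact (Eventually.of_forall fun n => by fun_prop).frequently

theorem ellTheta_eq_eulerProd {p : ℂ} (hp : ‖p‖ < 1) (z : ℂ) :
    ellTheta p z = eulerProd p z * eulerProd p (p / z) := by
  have := (eulerProd_multipliable hp z).tprod_mul (eulerProd_multipliable hp (p / z))
  rw [ellTheta, eulerProd, eulerProd, ← this]
  refine tprod_congr fun j => ?_
  rw [pow_succ, mul_div_assoc]

/-- Once 1 - z is split off, the cofactor is symmetric under z ↔ 1/z. Both θ(1) = 0 and the
inversion formula follow from this, without any case distinction on p. -/
theorem ellTheta_eq_one_sub_mul {p : ℂ} (hp : ‖p‖ < 1) (z : ℂ) :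
    ellTheta p z = (1 - z) * (eulerProd p (p * z) * eulerProd p (p / z)) := by
  rw [ellTheta_eq_eulerProd hp, eulerProd_eq_mul hp z, mul_assoc]

theorem ellTheta_one {p : ℂ} (hp : ‖p‖ < 1) : ellTheta p 1 = 0 := by
  simp [ellTheta_eq_one_sub_mul hp]

theorem ellTheta_inv {p : ℂ} (hp : ‖p‖ < 1) {z : ℂ} (hz : z ≠ 0) :
    ellTheta p z⁻¹ = -z⁻¹ * ellTheta p z := by
  rw [ellTheta_eq_one_sub_mul hp, ellTheta_eq_one_sub_mul hp, div_inv_eq_mul, ← div_eq_mul_inv]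
  field_simp
  ring

theorem ellTheta_continuousAt {p : ℂ} (hp : ‖p‖ < 1) {z : ℂ} (hz : z ≠ 0) :
    ContinuousAt (ellTheta p) z := by
  have h : ellTheta p = fun w => eulerProd p w * eulerProd p (p / w) :=
    funext (ellTheta_eq_eulerProd hp)
  rw [h]
  exact (eulerProd_continuous hp).continuousAt.mul
    ((eulerProd_continuous hp).continuousAt.comp (continuousAt_const.div continuousAt_id hz))

theorem ellTheta_zeros_countable {p : ℂ} (hp : ‖p‖ < 1) : {z : ℂ | ellTheta p z = 0}.Countable := by
  refine ((Set.countable_range fun j : ℕ => (p ^ j)⁻¹).union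
    (Set.countable_range fun j : ℕ => p ^ j * p)).mono fun z hz => ?_
  by_contra hcon
  simp only [Set.mem_union, Set.mem_range, not_or, not_exists] at hcon
  refine mul_ne_zero (eulerProd_ne_zero hp fun j hj => hcon.1 j ?_)
    (eulerProd_ne_zero hp fun j hj => hcon.2 j ?_) ((ellTheta_eq_eulerProd hp z).symm.trans hz)
  · exact inv_eq_of_mul_eq_one_right hj
  · have hz0 : z ≠ 0 := by rintro rfl; simp at hj
    field_simp at hj
    exact hj

/-! ### The Jacobi triple product -/

/-- The finite shifted factorial `(p; p)_n`. -/
noncomputable def pochP (p : ℂ) (n : ℕ) : ℂ := ∏ j ∈ Finset.range n, (1 - p ^ (j + 1))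

theorem pow_succ_ne_one {p : ℂ} (hp : ‖p‖ < 1) (j : ℕ) : p ^ (j + 1) ≠ 1 := fun h => by
  have := pow_lt_one₀ (norm_nonneg p) hp (Nat.succ_ne_zero j)
  rw [← norm_pow, h] at this
  simp at this

theorem pochP_ne_zero {p : ℂ} (hp : ‖p‖ < 1) (n : ℕ) : pochP p n ≠ 0 :=
  Finset.prod_ne_zero_iff.2 fun j _ => sub_ne_zero.2 (pow_succ_ne_one hp j).symm

theorem pochP_succ (p : ℂ) (n : ℕ) : pochP p (n + 1) = pochP p n * (1 - p ^ (n + 1)) :=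
  Finset.prod_range_succ _ _

theorem pochP_tendsto {p : ℂ} (hp : ‖p‖ < 1) :
    Tendsto (pochP p) atTop (𝓝 (eulerProd p p)) := by
  have := (eulerProd_multipliable hp p).hasProd.tendsto_prod_nat
  have h : pochP p = fun n => ∏ i ∈ Finset.range n, (1 - p ^ i * p) := by
    funext n; simp [pochP, pow_succ]
  rwa [h]

theorem eulerProd_self_ne_zero {p : ℂ} (hp : ‖p‖ < 1) : eulerProd p p ≠ 0 :=
  eulerProd_ne_zero hp fun j => by simpa [pow_succ] using pow_succ_ne_one hp j

/-- The `p`-binomial coefficient. -/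
noncomputable def binomP (p : ℂ) (m i : ℕ) : ℂ := pochP p m / (pochP p i * pochP p (m - i))

theorem prod_one_add_pow_mul {p : ℂ} (hp : ‖p‖ < 1) (y : ℂ) (m : ℕ) :
    ∏ j ∈ Finset.range m, (1 + p ^ j * y) =
      ∑ i ∈ Finset.range (m + 1), p ^ (i.choose 2) * binomP p m i * y ^ i := by
  induction m with
  | zero => simp [binomP, pochP]
  | succ m ih =>
    have h0 : ∀ i, pochP p i ≠ 0 := pochP_ne_zero hp
    rw [Finset.prod_range_succ, ih, mul_add, mul_one, Finset.sum_mul,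
      Finset.sum_range_succ' (fun i => p ^ (i.choose 2) * binomP p (m + 1) i * y ^ i) (m + 1),
      Finset.sum_range_succ' (fun i => p ^ (i.choose 2) * binomP p m i * y ^ i) m,
      Finset.sum_range_succ _ m, Finset.sum_range_succ _ m]
    -- The p-Pascal rule, multiplied by the powers of p and y.
    have e1 : ∀ i ∈ Finset.range m,
        p ^ ((i + 1).choose 2) * binomP p (m + 1) (i + 1) * y ^ (i + 1) =
        p ^ ((i + 1).choose 2) * binomP p m (i + 1) * y ^ (i + 1) +
          p ^ (i.choose 2) * binomP p m i * y ^ i * (p ^ m * y) := by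
      intro i hi
      obtain ⟨r, rfl⟩ := Nat.exists_eq_add_of_lt (Finset.mem_range.1 hi)
      have a1 : i + r + 1 + 1 - (i + 1) = r + 1 := by omega
      have a2 : i + r + 1 - (i + 1) = r := by omega
      have a3 : i + r + 1 - i = r + 1 := by omega
      have a4 : (i + 1).choose 2 = i + i.choose 2 := by
        rw [Nat.choose_succ_succ' i 1]; simp
      rw [binomP, binomP, binomP, a1, a2, a3, a4, pochP_succ p r, pochP_succ p i,
        pochP_succ p (i + r + 1)]
      have b1 := sub_ne_zero.2 (pow_succ_ne_one hp r).symm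
      have b2 := sub_ne_zero.2 (pow_succ_ne_one hp i).symm
      field_simp [h0]
      ring
    rw [Finset.sum_congr rfl e1, Finset.sum_add_distrib]
    -- The top index is kept apart: because of truncated subtraction `binomP p m (m + 1)` is not
    -- zero, so the Pascal rule does not extend to it.
    have e2 : p ^ ((m + 1).choose 2) * binomP p (m + 1) (m + 1) * y ^ (m + 1) =
        p ^ (m.choose 2) * binomP p m m * y ^ m * (p ^ m * y) := by
      have a4 : (m + 1).choose 2 = m + m.choose 2 := by
        rw [Nat.choose_succ_succ' m 1]; simp
      have b2 := sub_ne_zero.2 (pow_succ_ne_one hp m).symm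
      simp only [binomP, a4, Nat.sub_self]
      field_simp [h0]
      ring
    have e3 : p ^ (Nat.choose 0 2) * binomP p (m + 1) 0 * y ^ 0 =
        p ^ (Nat.choose 0 2) * binomP p m 0 * y ^ 0 := by
      simp only [binomP, Nat.sub_zero]
      field_simp [h0]
    rw [e2, e3]
    ring

/-- The general term `p ^ (k (k - 1) / 2) y ^ k` of the bilateral theta series. -/
noncomputable def thetaTerm (p y : ℂ) (k : ℤ) : ℂ := p ^ (k * (k - 1) / 2) * y ^ k

theorem Int.triangle_add_one (k : ℤ) : (k + 1) * (k + 1 - 1) / 2 = k * (k - 1) / 2 + k := by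
  rw [show (k + 1) * (k + 1 - 1) = k * (k - 1) + k * 2 by ring,
    Int.add_mul_ediv_right _ _ two_ne_zero]

theorem thetaTerm_add_one {p y : ℂ} (hp0 : p ≠ 0) (hy : y ≠ 0) (k : ℤ) :
    thetaTerm p y (k + 1) = thetaTerm p y k * (p ^ k * y) := by
  rw [thetaTerm, thetaTerm, Int.triangle_add_one, zpow_add₀ hp0, zpow_add_one₀ hy]
  ring

theorem thetaTerm_ne_zero {p y : ℂ} (hp0 : p ≠ 0) (hy : y ≠ 0) (k : ℤ) : thetaTerm p y k ≠ 0 :=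
  mul_ne_zero (zpow_ne_zero _ hp0) (zpow_ne_zero _ hy)

theorem tendsto_norm_pow_mul {p : ℂ} (hp : ‖p‖ < 1) (c : ℝ) :
    Tendsto (fun n : ℕ => ‖p‖ ^ n * c) atTop (𝓝 0) := by
  simpa using (tendsto_pow_atTop_nhds_zero_of_lt_one (norm_nonneg p) hp).mul_const c

theorem thetaTerm_summable {p y : ℂ} (hp : ‖p‖ < 1) (hp0 : p ≠ 0) (hy : y ≠ 0) :
    Summable (fun k => ‖thetaTerm p y k‖) := by
  have h0 := thetaTerm_ne_zero hp0 hy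
  refine (Summable.of_nat_of_neg (f := thetaTerm p y) ?_ ?_).norm
  · refine summable_of_ratio_test_tendsto_lt_one zero_lt_one (Eventually.of_forall fun n => h0 n) ?_
    refine (tendsto_norm_pow_mul hp ‖y‖).congr fun n => ?_
    rw [Nat.cast_add, Nat.cast_one, thetaTerm_add_one hp0 hy, norm_mul, norm_mul,
      mul_div_cancel_left₀ _ (norm_ne_zero_iff.2 (h0 n)), zpow_natCast, norm_pow]
  · refine summable_of_ratio_test_tendsto_lt_one zero_lt_one
      (Eventually.of_forall fun n => h0 (-n)) ?_
    refine (tendsto_norm_pow_mul hp (‖p‖ * ‖y‖⁻¹)).congr fun n => ?_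
    have h := thetaTerm_add_one hp0 hy (-((n + 1 : ℕ) : ℤ))
    rw [show -((n + 1 : ℕ) : ℤ) + 1 = -(n : ℤ) by push_cast; ring] at h
    rw [h, norm_mul, norm_mul, zpow_neg, zpow_natCast, norm_inv, norm_pow]
    have h1 := norm_ne_zero_iff.2 (h0 (-((n + 1 : ℕ) : ℤ)))
    have h2 := norm_ne_zero_iff.2 hp0
    have h3 := norm_ne_zero_iff.2 hy
    field_simp
    ring

/-- Recentring: the constant product turns the bilateral term at i - n into the i-th monomial of the
p-binomial theorem at y = -z/p^n. -/
theorem thetaTerm_shift_mul {p z : ℂ} (hp0 : p ≠ 0) (hz : z ≠ 0) (n i : ℕ) :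
    thetaTerm p (-z) ((i : ℤ) - n) * ∏ l ∈ Finset.range n, (-(z / p ^ (l + 1))) =
      p ^ (i.choose 2) * (-(z / p ^ n)) ^ i := by
  have hz' := neg_ne_zero.2 hz
  induction i with
  | zero =>
    induction n with
    | zero => simp [thetaTerm]
    | succ n ih =>
      have h := thetaTerm_add_one hp0 hz' (((0 : ℕ) : ℤ) - (n + 1 : ℕ))
      rw [show (((0 : ℕ) : ℤ) - (n + 1 : ℕ)) + 1 = ((0 : ℕ) : ℤ) - n by push_cast; ring] at h
      rw [h, show (((0 : ℕ) : ℤ) - (n + 1 : ℕ)) = -((n + 1 : ℕ) : ℤ) by simp, zpow_neg,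
        zpow_natCast] at ih
      rw [Finset.prod_range_succ, show (((0 : ℕ) : ℤ) - (n + 1 : ℕ)) = -((n + 1 : ℕ) : ℤ) by simp]
      simp only [pow_zero, Nat.choose_zero_succ, mul_one] at ih ⊢
      rw [← ih]
      ring
  | succ i ih =>
    rw [show ((i + 1 : ℕ) : ℤ) - n = ((i : ℤ) - n) + 1 by push_cast; ring,
      thetaTerm_add_one hp0 hz', mul_right_comm, ih, Nat.choose_succ_succ' i 1, pow_add, pow_succ,
      zpow_sub₀ hp0]
    simp only [Nat.choose_one_right, zpow_natCast]
    field_simp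

/-- This is the p-binomial theorem with 2n factors at y = -z/p^n. The first n factors, in reverse
order, are 1 - z/p^{l+1} = -(z/p^{l+1})(1 - p^{l+1}/z); the last n are 1 - p^j z. -/
theorem finite_jacobi {p z : ℂ} (hp : ‖p‖ < 1) (hp0 : p ≠ 0) (hz : z ≠ 0) (n : ℕ) :
    ∏ j ∈ Finset.range n, ((1 - p ^ j * z) * (1 - p ^ (j + 1) / z)) =
      ∑ i ∈ Finset.range (2 * n + 1), binomP p (2 * n) i * thetaTerm p (-z) ((i : ℤ) - n) := by
  have hκ : ∏ l ∈ Finset.range n, (-(z / p ^ (l + 1))) ≠ 0 :=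
    Finset.prod_ne_zero_iff.2 fun l _ => neg_ne_zero.2 (div_ne_zero hz (pow_ne_zero _ hp0))
  refine mul_right_cancel₀ hκ ?_
  rw [Finset.sum_mul]
  have h1 : ∀ i ∈ Finset.range (2 * n + 1),
      binomP p (2 * n) i * thetaTerm p (-z) ((i : ℤ) - n) *
        ∏ l ∈ Finset.range n, (-(z / p ^ (l + 1))) =
      p ^ (i.choose 2) * binomP p (2 * n) i * (-(z / p ^ n)) ^ i := by
    intro i _
    rw [mul_assoc, thetaTerm_shift_mul hp0 hz]
    ring
  rw [Finset.sum_congr rfl h1, ← prod_one_add_pow_mul hp, two_mul, Finset.prod_range_add,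
    Finset.prod_mul_distrib, mul_right_comm, mul_assoc, ← Finset.prod_mul_distrib, mul_comm]
  congr 1
  · rw [← Finset.prod_range_reflect]
    refine Finset.prod_congr rfl fun j hj => ?_
    obtain ⟨r, rfl⟩ := Nat.exists_eq_add_of_lt (Finset.mem_range.1 hj)
    rw [show j + r + 1 - 1 - j = r by omega]
    field_simp
    ring
  · refine Finset.prod_congr rfl fun j hj => ?_
    rw [pow_add]
    field_simp
    ring

/-- (p; p)_n has a non-zero limit, so it and its inverse are bounded. Uniformity in both indices
supplies the dominating series in the triple product. -/
theorem binomP_bounded {p : ℂ} (hp : ‖p‖ < 1) : ∃ C : ℝ, ∀ m i, ‖binomP p m i‖ ≤ C := by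
  have h0 := pochP_ne_zero hp
  obtain ⟨A, hA⟩ := (pochP_tendsto hp).norm.bddAbove_range
  obtain ⟨B, hB⟩ := ((pochP_tendsto hp).inv₀ (eulerProd_self_ne_zero hp)).norm.bddAbove_range
  have hA' : ∀ n, ‖pochP p n‖ ≤ A := fun n => hA ⟨n, rfl⟩
  have hB' : ∀ n, ‖(pochP p n)⁻¹‖ ≤ B := fun n => hB ⟨n, rfl⟩
  have hA0 : 0 ≤ A := (norm_nonneg _).trans (hA' 0)
  have hB0 : 0 ≤ B := (norm_nonneg _).trans (hB' 0)
  refine ⟨A * (B * B), fun m i => ?_⟩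
  rw [binomP, div_eq_mul_inv, mul_inv, norm_mul, norm_mul]
  gcongr
  · exact hA' _
  · exact hB' _
  · exact hB' _

/-- Let n → ∞ in `finite_jacobi`: each central binomial coefficient tends to 1/(p; p)_∞, and
dominated convergence allows the limit to be taken termwise. -/
theorem jacobi_triple_product {p z : ℂ} (hp : ‖p‖ < 1) (hp0 : p ≠ 0) (hz : z ≠ 0) :
    ellTheta p z = (eulerProd p p)⁻¹ * ∑' k, thetaTerm p (-z) k := by
  have hQ := eulerProd_self_ne_zero hp
  -- Padding by zero puts the finite sums on the fixed index set ℤ.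
  set F : ℕ → ℤ → ℂ := fun n k => if k ∈ Finset.Icc (-(n : ℤ)) n then
    binomP p (2 * n) (k + n).toNat * thetaTerm p (-z) k else 0 with hF
  have hsum : ∀ n, ∏ j ∈ Finset.range n, ((1 - p ^ j * z) * (1 - p ^ (j + 1) / z)) =
      ∑' k, F n k := by
    intro n
    rw [finite_jacobi hp hp0 hz, tsum_eq_sum (s := Finset.Icc (-(n : ℤ)) n)
      (fun k hk => by rw [hF]; exact if_neg hk)]
    refine Finset.sum_bij' (fun i _ => (i : ℤ) - n) (fun k _ => (k + n).toNat) ?_ ?_ ?_ ?_ ?_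
    · intro i hi
      simp only [Finset.mem_range, Finset.mem_Icc] at hi ⊢
      omega
    · intro i hi
      simp only [Finset.mem_range, Finset.mem_Icc] at hi ⊢
      omega
    · intro i hi
      simp
    · intro i hi
      simp only [Finset.mem_Icc] at hi
      omega
    · intro i hi
      have : (i : ℤ) - n ∈ Finset.Icc (-(n : ℤ)) n := by
        simp only [Finset.mem_range, Finset.mem_Icc] at hi ⊢
        omega
      simp only [hF, if_pos this]
      congr 2
      omega
  obtain ⟨C, hC⟩ := binomP_bounded hp
  have hC0 : 0 ≤ C := (norm_nonneg _).trans (hC 0 0)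
  have hlim : Tendsto (fun n => ∑' k, F n k) atTop
      (𝓝 (∑' k, (eulerProd p p)⁻¹ * thetaTerm p (-z) k)) := by
    refine tendsto_tsum_of_dominated_convergence (bound := fun k => C * ‖thetaTerm p (-z) k‖)
      ((thetaTerm_summable hp hp0 (neg_ne_zero.2 hz)).mul_left C) (fun k => ?_)
      (Eventually.of_forall fun n k => ?_)
    · have hb : Tendsto (fun n : ℕ => binomP p (2 * n) (k + n).toNat) atTop
          (𝓝 ((eulerProd p p) / (eulerProd p p * eulerProd p p))) := by
        refine Tendsto.div ?_ (Tendsto.mul ?_ ?_) (mul_ne_zero hQ hQ)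
        · exact (pochP_tendsto hp).comp (tendsto_id.const_mul_atTop' two_pos)
        · refine (pochP_tendsto hp).comp (tendsto_atTop.2 fun b => ?_)
          filter_upwards [eventually_ge_atTop (b + k.natAbs)] with n hn
          omega
        · refine (pochP_tendsto hp).comp (tendsto_atTop.2 fun b => ?_)
          filter_upwards [eventually_ge_atTop (b + k.natAbs)] with n hn
          omega
      rw [show (eulerProd p p)⁻¹ = (eulerProd p p) / (eulerProd p p * eulerProd p p) by field_simp]
      refine (hb.mul_const (thetaTerm p (-z) k)).congr' ?_
      filter_upwards [eventually_ge_atTop k.natAbs] with n hn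
      have : k ∈ Finset.Icc (-(n : ℤ)) n := by
        simp only [Finset.mem_Icc]
        omega
      simp only [hF, if_pos this]
    · simp only [hF]
      split_ifs
      · rw [norm_mul]
        gcongr
        exact hC _ _
      · rw [norm_zero]
        positivity
  rw [← tsum_mul_left]
  refine tendsto_nhds_unique ?_ hlim
  simp only [← hsum]
  exact (ellTheta_multipliable p z hp).hasProd.tendsto_prod_nat

/-! ### Products θ(xy)θ(x/y), rank two, and the three-term relation. -/

theorem Int.two_mul_triangle (k : ℤ) : 2 * (k * (k - 1) / 2) = k * (k - 1) := by
  have h : (2 : ℤ) ∣ k * (k - 1) := by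
    rcases Int.even_or_odd' k with ⟨m, rfl | rfl⟩
    · exact ⟨m * (2 * m - 1), by ring⟩
    · exact ⟨(2 * m + 1) * m, by ring⟩
  exact Int.mul_ediv_cancel' h

/-- For indices k = s + d and l = s - d the exponents k(k-1)/2 + l(l-1)/2 = (s² - s) + d² decouple,
which separates x from y. Pairs with k + l odd are handled in the same way by `thetaTerm_mul_odd`.
-/
theorem thetaTerm_mul_even {p x y : ℂ} (hp0 : p ≠ 0) (hx : x ≠ 0) (hy : y ≠ 0) (s d : ℤ) :
    thetaTerm p (-(x * y)) (s + d) * thetaTerm p (-(x / y)) (s - d) =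
      (p ^ (s ^ 2 - s) * x ^ (2 * s)) * (p ^ (d ^ 2) * y ^ (2 * d)) := by
  have e : (s + d) * (s + d - 1) / 2 + (s - d) * (s - d - 1) / 2 = (s ^ 2 - s) + d ^ 2 := by
    have h1 := Int.two_mul_triangle (s + d)
    have h2 := Int.two_mul_triangle (s - d)
    nlinarith
  have e2 : (-(x * y)) ^ (s + d) * (-(x / y)) ^ (s - d) = x ^ (2 * s) * y ^ (2 * d) := by
    rw [neg_eq_neg_one_mul (x * y), neg_eq_neg_one_mul (x / y), mul_zpow (-1 : ℂ) (x * y), mul_zpow (-1 : ℂ) (x / y),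
      mul_mul_mul_comm,
      ← zpow_add₀ (by norm_num), show s + d + (s - d) = 2 * s by ring, Even.neg_one_zpow ⟨s, by ring⟩,
      mul_zpow, div_zpow, one_mul, show 2 * s = (s + d) + (s - d) by ring,
      show 2 * d = (s + d) - (s - d) by ring, zpow_add₀ hx (s + d) (s - d),
      zpow_sub₀ hy (s + d) (s - d)]
    field_simp
  rw [thetaTerm, thetaTerm, mul_mul_mul_comm, e2, ← zpow_add₀ hp0, e, zpow_add₀ hp0]
  ring

theorem thetaTerm_mul_odd {p x y : ℂ} (hp0 : p ≠ 0) (hx : x ≠ 0) (hy : y ≠ 0) (s d : ℤ) :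
    thetaTerm p (-(x * y)) (s + d + 1) * thetaTerm p (-(x / y)) (s - d) =
      -((p ^ (s ^ 2) * x ^ (2 * s + 1)) * (p ^ (d ^ 2 + d) * y ^ (2 * d + 1))) := by
  have e : (s + d + 1) * (s + d + 1 - 1) / 2 + (s - d) * (s - d - 1) / 2 = s ^ 2 + (d ^ 2 + d) := by
    have h1 := Int.two_mul_triangle (s + d + 1)
    have h2 := Int.two_mul_triangle (s - d)
    nlinarith
  have e2 : (-(x * y)) ^ (s + d + 1) * (-(x / y)) ^ (s - d) =
      -(x ^ (2 * s + 1) * y ^ (2 * d + 1)) := by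
    rw [neg_eq_neg_one_mul (x * y), neg_eq_neg_one_mul (x / y), mul_zpow (-1 : ℂ) (x * y), mul_zpow (-1 : ℂ) (x / y),
      mul_mul_mul_comm,
      ← zpow_add₀ (by norm_num), show s + d + 1 + (s - d) = 2 * s + 1 by ring,
      Odd.neg_one_zpow ⟨s, rfl⟩,
      mul_zpow, div_zpow, show 2 * s + 1 = (s + d + 1) + (s - d) by ring,
      show 2 * d + 1 = (s + d + 1) - (s - d) by ring,
      zpow_add₀ hx (s + d + 1) (s - d), zpow_sub₀ hy (s + d + 1) (s - d)]
    field_simp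
  rw [thetaTerm, thetaTerm, mul_mul_mul_comm, e2, ← zpow_add₀ hp0, e, zpow_add₀ hp0]
  ring

theorem tsum_int_even_add_odd {f : ℤ → ℂ} (hf : Summable f) :
    ∑' k, f k = (∑' s, f (2 * s)) + ∑' s, f (2 * s + 1) := by
  have h2 : Function.Injective fun s : ℤ => 2 * s := fun a b h => by simpa using h
  have h3 : Function.Injective fun s : ℤ => 2 * s + 1 := fun a b h => by simpa using h
  have he := h2.hasSum_range_iff.2 (hf.comp_injective h2).hasSum
  have ho := h3.hasSum_range_iff.2 (hf.comp_injective h3).hasSum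
  refine (HasSum.add_isCompl ?_ he ho).tsum_eq
  simpa [Set.range, Even, Odd, two_mul, eq_comm] using Int.isCompl_even_odd

/-- The two theta functions of nome `p ^ 2` spanning the bracket space. -/
noncomputable def thetaEven (p x : ℂ) : ℂ := ∑' s : ℤ, p ^ (s ^ 2) * x ^ (2 * s)

/-- The odd companion of `thetaEven`. -/
noncomputable def thetaOdd (p x : ℂ) : ℂ := ∑' s : ℤ, p ^ (s ^ 2 + s) * x ^ (2 * s + 1)

theorem thetaSeries_mul {p x y : ℂ} (hp : ‖p‖ < 1) (hp0 : p ≠ 0) (hx : x ≠ 0) (hy : y ≠ 0) :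
    (∑' k, thetaTerm p (-(x * y)) k) * (∑' k, thetaTerm p (-(x / y)) k) =
      x * (thetaOdd p x * thetaEven p y - thetaEven p x * thetaOdd p y) := by
  have s1 := thetaTerm_summable hp hp0 (neg_ne_zero.2 (mul_ne_zero hx hy))
  have s2 := thetaTerm_summable hp hp0 (neg_ne_zero.2 (div_ne_zero hx hy))
  rw [tsum_mul_tsum_of_summable_norm s1 s2]
  -- New coordinates are (k + l, l), so that the double series can be split by the parity of k + l.
  let e : ℤ × ℤ ≃ ℤ × ℤ := ⟨fun r => (r.1 - r.2, r.2), fun r => (r.1 + r.2, r.2),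
    fun r => by simp, fun r => by simp⟩
  set F : ℤ × ℤ → ℂ := fun z => thetaTerm p (-(x * y)) z.1 * thetaTerm p (-(x / y)) z.2 with hF
  have hsum : Summable (fun z => F (e z)) :=
    e.summable_iff.2 (summable_mul_of_summable_norm s1 s2)
  rw [← e.tsum_eq F, hsum.tsum_prod, tsum_int_even_add_odd hsum.prod]
  have h1 : ∀ s : ℤ, ∑' n, F (e (2 * s, n)) =
      (p ^ (s ^ 2 - s) * x ^ (2 * s)) * thetaEven p y := by
    intro s
    rw [← (Equiv.subLeft s).tsum_eq, thetaEven, ← tsum_mul_left]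
    refine tsum_congr fun d => ?_
    rw [← thetaTerm_mul_even hp0 hx hy s d]
    simp only [hF, e, Equiv.coe_fn_mk, Equiv.subLeft_apply]
    congr 2
    ring
  have h2 : ∀ s : ℤ, ∑' n, F (e (2 * s + 1, n)) =
      -((p ^ (s ^ 2) * x ^ (2 * s + 1)) * thetaOdd p y) := by
    intro s
    rw [← (Equiv.subLeft s).tsum_eq, thetaOdd, ← tsum_mul_left, ← tsum_neg]
    refine tsum_congr fun d => ?_
    rw [← thetaTerm_mul_odd hp0 hx hy s d]
    simp only [hF, e, Equiv.coe_fn_mk, Equiv.subLeft_apply]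
    congr 2
    ring
  rw [tsum_congr h1, tsum_congr h2, tsum_neg, tsum_mul_right, tsum_mul_right]
  have h3 : ∑' s : ℤ, p ^ (s ^ 2 - s) * x ^ (2 * s) = x * thetaOdd p x := by
    rw [← (Equiv.addRight (1 : ℤ)).tsum_eq, thetaOdd, ← tsum_mul_left]
    refine tsum_congr fun s => ?_
    rw [Equiv.coe_addRight, show (s + 1) ^ 2 - (s + 1) = s ^ 2 + s by ring,
      show 2 * (s + 1) = (2 * s + 1) + 1 by ring, zpow_add_one₀ hx]
    ring
  have h4 : ∑' s : ℤ, p ^ (s ^ 2) * x ^ (2 * s + 1) = x * thetaEven p x := by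
    rw [thetaEven, ← tsum_mul_left]
    refine tsum_congr fun s => ?_
    rw [zpow_add_one₀ hx]
    ring
  rw [h3, h4]
  ring

theorem ellTheta_zero_left (z : ℂ) : ellTheta 0 z = 1 - z := by
  rw [ellTheta, tprod_eq_mulSingle 0 fun j hj => by simp [hj]]
  simp

/-- As a function of x, the quotient by x lies in a two-dimensional space whatever y is, and it is
antisymmetric. The case p = 0 is elementary and separate, since the bilateral series needs negative
powers of p. -/
theorem ellTheta_mul_div {p : ℂ} (hp : ‖p‖ < 1) : ∃ f g : ℂ → ℂ, ∀ x y, x ≠ 0 → y ≠ 0 →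
    ellTheta p (x * y) * ellTheta p (x / y) = x * (f x * g y - g x * f y) := by
  rcases eq_or_ne p 0 with rfl | hp0
  · refine ⟨fun x => x + x⁻¹, fun _ => 1, fun x y hx hy => ?_⟩
    rw [ellTheta_zero_left, ellTheta_zero_left]
    field_simp
    ring
  · refine ⟨fun x => (eulerProd p p)⁻¹ * thetaOdd p x, fun x => (eulerProd p p)⁻¹ * thetaEven p x,
      fun x y hx hy => ?_⟩
    rw [jacobi_triple_product hp hp0 (mul_ne_zero hx hy),
      jacobi_triple_product hp hp0 (div_ne_zero hx hy)]
    linear_combination (eulerProd p p)⁻¹ ^ 2 * thetaSeries_mul hp hp0 hx hy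

/-- The elliptic bracket `θ(a u x) θ(u / x) / u`. -/
noncomputable def ellBracket (p a u x : ℂ) : ℂ := ellTheta p (a * u * x) * ellTheta p (u / x) / u

/-- With s² = a, replacing x, y by su, sx in `ellTheta_mul_div` produces the arguments aux and u/x.
-/
theorem ellBracket_rank_two {p a : ℂ} (hp : ‖p‖ < 1) (ha : a ≠ 0) : ∃ f g : ℂ → ℂ,
    ∀ u x, u ≠ 0 → x ≠ 0 → ellBracket p a u x = f u * g x - g u * f x := by
  obtain ⟨f, g, h⟩ := ellTheta_mul_div hp
  obtain ⟨s, hs⟩ := IsAlgClosed.exists_pow_nat_eq a two_pos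
  have hs0 : s ≠ 0 := by rintro rfl; simp at hs; exact ha hs.symm
  refine ⟨fun u => s * f (s * u), fun u => g (s * u), fun u x hu hx => ?_⟩
  have := h (s * u) (s * x) (mul_ne_zero hs0 hu) (mul_ne_zero hs0 hx)
  rw [mul_div_mul_left _ _ hs0, show s * u * (s * x) = a * u * x by rw [← hs]; ring] at this
  rw [ellBracket, this]
  field_simp

/-- The Plücker relation among the six 2×2 minors f(u)g(v) - g(u)f(v) at the four points x, x/B,
C/x, D/x, where x² = AB. -/
theorem ellTheta_three_term {p : ℂ} (hp : ‖p‖ < 1) {A B C D : ℂ} (hA : A ≠ 0) (hB : B ≠ 0)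
    (hC : C ≠ 0) (hD : D ≠ 0) :
    ellTheta p A * ellTheta p B * ellTheta p (C * D / (A * B)) * ellTheta p (D / C) -
      ellTheta p C * ellTheta p (A * B / C) * ellTheta p (D / B) * ellTheta p (D / A) =
      D / A * ellTheta p (C / B) * ellTheta p (A / C) * ellTheta p D * ellTheta p (A * B / D) := by
  obtain ⟨f, g, h⟩ := ellTheta_mul_div hp
  obtain ⟨x, hx⟩ := IsAlgClosed.exists_pow_nat_eq (A * B) two_pos
  have hx0 : x ≠ 0 := by
    rintro rfl
    simp only [ne_eq, OfNat.ofNat_ne_zero, not_false_eq_true, zero_pow, zero_eq_mul] at hx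
    tauto
  have hAe : A = x ^ 2 / B := by rw [hx]; field_simp
  have h1 := h x (x / B) hx0 (by positivity)
  have h2 := h (D / x) (C / x) (by positivity) (by positivity)
  have h3 := h x (C / x) hx0 (by positivity)
  have h4 := h (D / x) (x / B) (by positivity) (by positivity)
  have h5 := h (x / B) (C / x) (by positivity) (by positivity)
  have h6 := h x (D / x) hx0 (by positivity)
  rw [show x * (x / B) = A by rw [hAe]; ring, show x / (x / B) = B by field_simp] at h1
  rw [show D / x * (C / x) = C * D / (A * B) by rw [← hx]; field_simp,
    show D / x / (C / x) = D / C by field_simp] at h2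
  rw [show x * (C / x) = C by field_simp,
    show x / (C / x) = A * B / C by rw [← hx]; field_simp] at h3
  rw [show D / x * (x / B) = D / B by field_simp,
    show D / x / (x / B) = D / A by rw [hAe]; field_simp] at h4
  rw [show x / B * (C / x) = C / B by field_simp,
    show x / B / (C / x) = A / C by rw [hAe]; field_simp] at h5
  rw [show x * (D / x) = D by field_simp,
    show x / (D / x) = A * B / D by rw [← hx]; field_simp] at h6
  have e1 : ellTheta p A * ellTheta p B * ellTheta p (C * D / (A * B)) * ellTheta p (D / C) =
    (ellTheta p A * ellTheta p B) * (ellTheta p (C * D / (A * B)) * ellTheta p (D / C)) := by ring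
  have e2 : ellTheta p C * ellTheta p (A * B / C) * ellTheta p (D / B) * ellTheta p (D / A) =
    (ellTheta p C * ellTheta p (A * B / C)) * (ellTheta p (D / B) * ellTheta p (D / A)) := by ring
  have e3 : D / A * ellTheta p (C / B) * ellTheta p (A / C) * ellTheta p D * ellTheta p (A * B / D) =
    D / A * (ellTheta p (C / B) * ellTheta p (A / C)) * (ellTheta p D * ellTheta p (A * B / D)) := by
    ring
  rw [e1, e2, e3, h1, h2, h3, h4, h5, h6, hAe]
  field_simp
  ring

/-! ### Elliptic shifted factorials. -/

section ShiftedFactorials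

variable (p q z : ℂ)

theorem ellFac_zero : ellFac p q z 0 = 1 := rfl

theorem ellFac_succ (k : ℕ) : ellFac p q z (k + 1) = ellFac p q z k * ellTheta p (z * q ^ k) :=
  Finset.prod_range_succ _ _

theorem ellFac_add (m k : ℕ) :
    ellFac p q z (m + k) = ellFac p q z m * ellFac p q (z * q ^ m) k := by
  rw [ellFac, Finset.prod_range_add]
  simp only [ellFac, pow_add, mul_assoc]

theorem ellFac_one : ellFac p q z 1 = ellTheta p z := by
  simp [ellFac]

theorem ellFac_succ' (k : ℕ) :
    ellFac p q z (k + 1) = ellTheta p z * ellFac p q (z * q) k := by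
  rw [add_comm, ellFac_add, ellFac_one, pow_one]

end ShiftedFactorials

theorem ellFac_ne_zero_of_le {p q z : ℂ} {k N : ℕ} (h : ellFac p q z N ≠ 0) (hk : k ≤ N) :
    ellFac p q z k ≠ 0 := by
  obtain ⟨r, rfl⟩ := Nat.exists_eq_add_of_le hk
  rw [ellFac_add] at h
  exact left_ne_zero_of_mul h

/-- The hypothesis says zq^i · wq^{k-1-i} = 1, so the factors of (w)_k in reverse order sit at the
inverse arguments, and θ(1/u) = -θ(u)/u applies to each. -/
theorem ellFac_reflect {p q z w : ℂ} (hp : ‖p‖ < 1) (hz : z ≠ 0) (hq : q ≠ 0) {k : ℕ}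
    (h : z * w * q ^ k = q) :
    ellFac p q z k = (-z) ^ k * q ^ (k.choose 2) * ellFac p q w k := by
  have h1 : ∀ n : ℕ, ∏ i ∈ Finset.range n, (-(z * q ^ i)) = (-z) ^ n * q ^ (n.choose 2) := by
    intro n
    induction n with
    | zero => simp
    | succ n ih =>
      rw [Finset.prod_range_succ, ih, Nat.choose_succ_succ' n 1, pow_add, pow_succ]
      simp only [Nat.choose_one_right]
      ring
  rw [← h1, ellFac, ellFac, ← Finset.prod_range_reflect (fun i => ellTheta p (w * q ^ i)),
    ← Finset.prod_mul_distrib]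
  refine Finset.prod_congr rfl fun i hi => ?_
  obtain ⟨r, rfl⟩ := Nat.exists_eq_add_of_lt (Finset.mem_range.1 hi)
  have h2 : (z * q ^ i)⁻¹ = w * q ^ (i + r + 1 - 1 - i) := by
    rw [show i + r + 1 - 1 - i = r by omega]
    have : z * w * q ^ (i + r) = 1 := mul_right_cancel₀ hq (by linear_combination h)
    rw [inv_eq_iff_eq_inv, eq_comm]
    refine inv_eq_of_mul_eq_one_left ?_
    linear_combination this
  have h3 := ellTheta_inv hp (mul_ne_zero hz (pow_ne_zero i hq))
  rw [← h2, h3]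
  have : z * q ^ i ≠ 0 := mul_ne_zero hz (pow_ne_zero i hq)
  field_simp

/-! ### The Frenkel–Turaev summation. -/

/-- The summand of the elliptic Frenkel–Turaev sum, cleared of denominators;
the parameters satisfy `a q = b c d h`. -/
noncomputable def ftTerm (p q : ℂ) (N : ℕ) (a b c d h : ℂ) (k : ℕ) : ℂ :=
  ellTheta p (a * q ^ (2 * k)) / ellFac p q (a * q ^ k) (N + 1) *
    (ellFac p q q N / (ellFac p q q k * ellFac p q q (N - k))) *
    (ellFac p q b k * ellFac p q c k * ellFac p q d k * ellFac p q (a * h * q ^ N) k) *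
    (ellFac p q h (N - k) * ellFac p q (c * d * h * q ^ k) (N - k) *
      ellFac p q (b * d * h * q ^ k) (N - k) * ellFac p q (b * c * h * q ^ k) (N - k)) * h ^ k

section FrenkelTuraev

variable {p q : ℂ}

/-- The three-term relation splitting the ratio of consecutive Frenkel–Turaev products. -/
theorem ft_split (hp : ‖p‖ < 1) (hq : q ≠ 0) {a b c d h : ℂ} (hb : b ≠ 0) (hc : c ≠ 0)
    (hd : d ≠ 0) (hh : h ≠ 0) (hbal : a * q = b * c * d * h) (k r : ℕ) :
    ellTheta p (h * d) * ellTheta p (h * b * q ^ (k + r)) * ellTheta p (h * c * q ^ (k + r)) *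
        ellTheta p (a * q ^ (2 * k + 1)) =
      h * q ^ r * (ellTheta p (b * q ^ k) * ellTheta p (c * q ^ k) * ellTheta p (d / q ^ r) *
        ellTheta p (a * h * q ^ (k + r + 1 + k))) +
      ellTheta p (c * d * h * q ^ k) * ellTheta p (b * d * h * q ^ k) *
        ellTheta p (b * c * h * q ^ (k + r + k)) * ellTheta p (h * q ^ r) := by
  have ha : a = b * c * d * h / q := by field_simp; exact hbal
  have h3 := ellTheta_three_term hp (A := c * d * h * q ^ k) (B := b * d * h * q ^ k)
    (C := h * d) (D := a * h * q ^ (k + r + 1 + k)) (by positivity) (by positivity) (by positivity)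
    (by rw [ha]; positivity)
  have hi := ellTheta_inv hp (z := b * q ^ k) (by positivity)
  rw [show h * d * (a * h * q ^ (k + r + 1 + k)) / (c * d * h * q ^ k * (b * d * h * q ^ k)) =
      h * q ^ r by rw [ha]; field_simp; ring,
    show a * h * q ^ (k + r + 1 + k) / (h * d) = b * c * h * q ^ (k + r + k) by
      rw [ha]; field_simp; ring,
    show c * d * h * q ^ k * (b * d * h * q ^ k) / (h * d) = a * q ^ (2 * k + 1) by
      rw [ha]; field_simp; ring,
    show a * h * q ^ (k + r + 1 + k) / (b * d * h * q ^ k) = h * c * q ^ (k + r) by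
      rw [ha]; field_simp; ring,
    show a * h * q ^ (k + r + 1 + k) / (c * d * h * q ^ k) = h * b * q ^ (k + r) by
      rw [ha]; field_simp; ring,
    show h * d / (b * d * h * q ^ k) = (b * q ^ k)⁻¹ by field_simp, hi,
    show c * d * h * q ^ k / (h * d) = c * q ^ k by field_simp,
    show c * d * h * q ^ k * (b * d * h * q ^ k) / (a * h * q ^ (k + r + 1 + k)) = d / q ^ r by
      rw [ha]; field_simp; ring] at h3
  have e : h * b * q ^ (k + r) * (b * q ^ k)⁻¹ = h * q ^ r := by field_simp; ring
  linear_combination -h3 + (ellTheta p (b * q ^ k) * ellTheta p (c * q ^ k) *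
    ellTheta p (d / q ^ r) * ellTheta p (a * h * q ^ (k + r + 1 + k))) * e

/-- Elliptic Pascal rule: it splits the N + 1 term of the Frenkel–Turaev sum into two terms of level
N, and is used with s = bch. -/
theorem ft_pascal (hp : ‖p‖ < 1) (hq : q ≠ 0) {a d s : ℂ} (hd : d ≠ 0) (hs : s ≠ 0)
    (hbal : a * q = s * d) (m r : ℕ) :
    ellTheta p (a * q ^ (2 * (m + 1))) * ellTheta p (q ^ (m + 1 + r + 1)) * ellTheta p d *
        ellTheta p (s * q ^ (m + 1 + r)) =
      ellTheta p (q ^ (r + 1)) * ellTheta p (a * q ^ (m + 1)) * ellTheta p (d * q ^ (m + 1)) *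
        ellTheta p (s * q ^ (m + 1 + r + (m + 1))) +
      q ^ (r + 1) * ellTheta p (d / q ^ (r + 1)) * ellTheta p (q ^ (m + 1)) *
        ellTheta p (a * q ^ (m + 1 + (m + 1 + r) + 1)) * ellTheta p (s * q ^ m) := by
  have ha : a = s * d / q := by field_simp; exact hbal
  have ha0 : a ≠ 0 := by rw [ha]; positivity
  have h3 := ellTheta_three_term hp (A := q ^ (r + 1)) (B := a * q ^ (m + 1)) (C := d)
    (D := a * q ^ (m + 1 + (m + 1 + r) + 1)) (by positivity) (by positivity) hd (by positivity)
  have h4 := ellTheta_inv hp (z := s * q ^ m) (by positivity)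
  have h5 := ellTheta_inv hp (z := d / q ^ (r + 1)) (by positivity)
  have h6 := ellTheta_inv hp (z := q ^ (m + 1)) (by positivity)
  rw [show d * (a * q ^ (m + 1 + (m + 1 + r) + 1)) / (q ^ (r + 1) * (a * q ^ (m + 1))) =
      d * q ^ (m + 1) by field_simp; ring,
    show a * q ^ (m + 1 + (m + 1 + r) + 1) / d = s * q ^ (m + 1 + r + (m + 1)) by
      rw [ha]; field_simp; ring,
    show q ^ (r + 1) * (a * q ^ (m + 1)) / d = s * q ^ (m + 1 + r) by rw [ha]; field_simp; ring,
    show a * q ^ (m + 1 + (m + 1 + r) + 1) / (a * q ^ (m + 1)) = q ^ (m + 1 + r + 1) by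
      field_simp; ring,
    show a * q ^ (m + 1 + (m + 1 + r) + 1) / q ^ (r + 1) = a * q ^ (2 * (m + 1)) by
      field_simp; ring,
    show d / (a * q ^ (m + 1)) = (s * q ^ m)⁻¹ by rw [ha]; field_simp; ring,
    show q ^ (r + 1) / d = (d / q ^ (r + 1))⁻¹ by field_simp,
    show q ^ (r + 1) * (a * q ^ (m + 1)) / (a * q ^ (m + 1 + (m + 1 + r) + 1)) =
      (q ^ (m + 1))⁻¹ by field_simp; ring, h4, h5, h6] at h3
  have e : a * q ^ (2 * (m + 1)) * (s * q ^ m)⁻¹ * (d / q ^ (r + 1))⁻¹ * (q ^ (m + 1))⁻¹ =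
      q ^ (r + 1) := by
    rw [ha]; field_simp; ring
  linear_combination -h3 + (ellTheta p (d / q ^ (r + 1)) * ellTheta p (q ^ (m + 1)) *
        ellTheta p (a * q ^ (m + 1 + (m + 1 + r) + 1)) * ellTheta p (s * q ^ m)) * e

/-- The first coefficient in the recursion for the Frenkel–Turaev terms. -/
noncomputable def ftAlpha (p q : ℂ) (N : ℕ) (a b c d h : ℂ) (k : ℕ) : ℂ :=
  h * q ^ (N - k) * (ellTheta p (b * q ^ k) * ellTheta p (c * q ^ k) *
    ellTheta p (d / q ^ (N - k)) * ellTheta p (a * h * q ^ (N + 1 + k))) /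
    ellTheta p (a * q ^ (2 * k + 1))

/-- The second coefficient in the recursion for the Frenkel–Turaev terms. -/
noncomputable def ftBeta (p q : ℂ) (N : ℕ) (a b c d h : ℂ) (k : ℕ) : ℂ :=
  ellTheta p (c * d * h * q ^ k) * ellTheta p (b * d * h * q ^ k) *
    ellTheta p (b * c * h * q ^ (N + k)) * ellTheta p (h * q ^ (N - k)) /
    ellTheta p (a * q ^ (2 * k + 1))

/-- The total weight is independent of k; this lets the recursion be summed in closed form. -/
theorem ftAlpha_add_ftBeta (hp : ‖p‖ < 1) (hq : q ≠ 0) {a b c d h : ℂ} (hb : b ≠ 0) (hc : c ≠ 0)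
    (hd : d ≠ 0) (hh : h ≠ 0) (hbal : a * q = b * c * d * h)
    (hna : ∀ j : ℕ, ellTheta p (a * q ^ j) ≠ 0) {N k : ℕ} (hk : k ≤ N) :
    ftAlpha p q N a b c d h k + ftBeta p q N a b c d h k =
      ellTheta p (h * d) * ellTheta p (h * b * q ^ N) * ellTheta p (h * c * q ^ N) := by
  obtain ⟨r, rfl⟩ := Nat.exists_eq_add_of_le hk
  rw [ftAlpha, ftBeta, ← add_div, Nat.add_sub_cancel_left, ← ft_split hp hq hb hc hd hh hbal]
  exact mul_div_cancel_right₀ _ (hna _)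

/-- The shift (a, d) → (aq, dq) preserves aq = bcdh. After the common factorials are removed from
the three terms, only `ft_pascal` remains. -/
theorem ftTerm_rec (hp : ‖p‖ < 1) (hq : q ≠ 0) {a b c d h : ℂ} (hb : b ≠ 0) (hc : c ≠ 0)
    (hd : d ≠ 0) (hh : h ≠ 0) (hbal : a * q = b * c * d * h)
    (hna : ∀ j : ℕ, ellTheta p (a * q ^ j) ≠ 0) {N : ℕ} (hnq : ellFac p q q (N + 1) ≠ 0) {m : ℕ}
    (hm : m < N) :
    ftTerm p q (N + 1) a b c d h (m + 1) =
      ftAlpha p q N a b c d h m * ftTerm p q N (a * q) b c (d * q) h m +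
      ftBeta p q N a b c d h (m + 1) * ftTerm p q N (a * q) b c (d * q) h (m + 1) := by
  obtain ⟨r, rfl⟩ := Nat.exists_eq_add_of_lt hm
  rw [show m + r + 1 = m + 1 + r by ring] at *
  have hP := ft_pascal hp hq hd (mul_ne_zero (mul_ne_zero hb hc) hh) (s := b * c * h)
    (by rw [hbal]; ring) m r
  have hnq' : ∀ k ≤ m + 1 + r + 1, ellFac p q q k ≠ 0 := fun k hk => ellFac_ne_zero_of_le hnq hk
  have hqm := hnq' m (by omega)
  have hqr := hnq' r (by omega)
  have hqN := hnq' (m + 1 + r) (by omega)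
  have hq1 := hnq' (m + 1) (by omega)
  have hq2 := hnq' (r + 1) (by omega)
  rw [ellFac_succ, show q * q ^ m = q ^ (m + 1) by ring] at hq1
  rw [ellFac_succ, show q * q ^ r = q ^ (r + 1) by ring] at hq2
  have hq1' := right_ne_zero_of_mul hq1
  have hq2' := right_ne_zero_of_mul hq2
  have hX : ellFac p q (a * q ^ (m + 1 + 1)) (m + 1 + r) ≠ 0 :=
    Finset.prod_ne_zero_iff.2 fun j _ => by rw [mul_assoc, ← pow_add]; exact hna _
  have t1 := hna (m + 1)
  have t2 := hna (m + 1 + (m + 1 + r) + 1)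
  have t3 := hna (2 * (m + 1))
  have t4 := hna (2 * m + 1)
  have t5 := hna (2 * (m + 1) + 1)
  rw [ftAlpha, ftBeta, ftTerm, ftTerm, ftTerm]
  rw [show m + 1 + r + 1 - (m + 1) = r + 1 by omega, show m + 1 + r - (m + 1) = r by omega,
    show m + 1 + r - m = r + 1 by omega]
  have e1 : ellFac p q (a * q ^ (m + 1)) (m + 1 + r + 1 + 1) = ellTheta p (a * q ^ (m + 1)) *
      (ellFac p q (a * q ^ (m + 1 + 1)) (m + 1 + r) *
        ellTheta p (a * q ^ (m + 1 + (m + 1 + r) + 1))) := by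
    rw [ellFac_succ', ellFac_succ, show a * q ^ (m + 1) * q = a * q ^ (m + 1 + 1) by ring,
      show a * q ^ (m + 1 + 1) * q ^ (m + 1 + r) = a * q ^ (m + 1 + (m + 1 + r) + 1) by ring]
  have e2 : ellFac p q (a * q * q ^ m) (m + 1 + r + 1) = ellTheta p (a * q ^ (m + 1)) *
      ellFac p q (a * q ^ (m + 1 + 1)) (m + 1 + r) := by
    rw [ellFac_succ', show a * q * q ^ m = a * q ^ (m + 1) by ring,
      show a * q ^ (m + 1) * q = a * q ^ (m + 1 + 1) by ring]
  have e3 : ellFac p q (a * q * q ^ (m + 1)) (m + 1 + r + 1) =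
      ellFac p q (a * q ^ (m + 1 + 1)) (m + 1 + r) *
        ellTheta p (a * q ^ (m + 1 + (m + 1 + r) + 1)) := by
    rw [ellFac_succ, show a * q * q ^ (m + 1) = a * q ^ (m + 1 + 1) by ring,
      show a * q ^ (m + 1 + 1) * q ^ (m + 1 + r) = a * q ^ (m + 1 + (m + 1 + r) + 1) by ring]
  have e4 : ellFac p q q (m + 1 + r + 1) = ellFac p q q (m + 1 + r) *
      ellTheta p (q ^ (m + 1 + r + 1)) := by
    rw [ellFac_succ, show q * q ^ (m + 1 + r) = q ^ (m + 1 + r + 1) by ring]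
  have e5 : ellFac p q q (m + 1) = ellFac p q q m * ellTheta p (q ^ (m + 1)) := by
    rw [ellFac_succ, show q * q ^ m = q ^ (m + 1) by ring]
  have e6 : ellFac p q q (r + 1) = ellFac p q q r * ellTheta p (q ^ (r + 1)) := by
    rw [ellFac_succ, show q * q ^ r = q ^ (r + 1) by ring]
  have e7 : ellFac p q d (m + 1) = ellTheta p d * ellFac p q (d * q) m := ellFac_succ' _ _ _ _
  have e8 : ellFac p q (d * q) (m + 1) = ellFac p q (d * q) m * ellTheta p (d * q ^ (m + 1)) := by
    rw [ellFac_succ, show d * q * q ^ m = d * q ^ (m + 1) by ring]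
  have e9 : ellFac p q (c * d * h * q ^ (m + 1)) (r + 1) = ellTheta p (c * d * h * q ^ (m + 1)) *
      ellFac p q (c * d * h * q ^ (m + 2)) r := by
    rw [ellFac_succ', show c * d * h * q ^ (m + 1) * q = c * d * h * q ^ (m + 2) by ring]
  have e10 : ellFac p q (b * d * h * q ^ (m + 1)) (r + 1) = ellTheta p (b * d * h * q ^ (m + 1)) *
      ellFac p q (b * d * h * q ^ (m + 2)) r := by
    rw [ellFac_succ', show b * d * h * q ^ (m + 1) * q = b * d * h * q ^ (m + 2) by ring]
  have e11 : ellFac p q (b * c * h * q ^ (m + 1)) (r + 1) =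
      ellFac p q (b * c * h * q ^ (m + 1)) r * ellTheta p (b * c * h * q ^ (m + 1 + r)) := by
    rw [ellFac_succ, show b * c * h * q ^ (m + 1) * q ^ r = b * c * h * q ^ (m + 1 + r) by ring]
  have e12 : ellFac p q (b * c * h * q ^ m) (r + 1) = ellTheta p (b * c * h * q ^ m) *
      ellFac p q (b * c * h * q ^ (m + 1)) r := by
    rw [ellFac_succ', show b * c * h * q ^ m * q = b * c * h * q ^ (m + 1) by ring]
  have e13 : ellFac p q (a * h * q ^ (m + 1 + r + 1)) (m + 1) =
      ellFac p q (a * h * q ^ (m + 1 + r + 1)) m * ellTheta p (a * h * q ^ (m + 1 + r + 1 + m)) := by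
    rw [ellFac_succ, show a * h * q ^ (m + 1 + r + 1) * q ^ m = a * h * q ^ (m + 1 + r + 1 + m) by
      ring]
  rw [show a * q * h * q ^ (m + 1 + r) = a * h * q ^ (m + 1 + r + 1) by ring,
    show c * (d * q) * h * q ^ m = c * d * h * q ^ (m + 1) by ring,
    show b * (d * q) * h * q ^ m = b * d * h * q ^ (m + 1) by ring,
    show c * (d * q) * h * q ^ (m + 1) = c * d * h * q ^ (m + 2) by ring,
    show b * (d * q) * h * q ^ (m + 1) = b * d * h * q ^ (m + 2) by ring,
    show a * q * q ^ (2 * m) = a * q ^ (2 * m + 1) by ring,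
    show a * q * q ^ (2 * (m + 1)) = a * q ^ (2 * (m + 1) + 1) by ring,
    e1, e2, e3, e4, e5, e6, e7, e8, e9, e10, e11, e12, e13, ellFac_succ p q b, ellFac_succ p q c,
    ellFac_succ p q h]
  clear e1 e2 e3 e4 e5 e6 e7 e8 e9 e10 e11 e12 e13 hq1 hq2 hnq' hna hbal hm hnq
  generalize ellFac p q (a * q ^ (m + 1 + 1)) (m + 1 + r) = X at *
  generalize ellFac p q q (m + 1 + r) = QN at *
  generalize ellFac p q q m = Qm at *
  generalize ellFac p q q r = Qr at *
  generalize ellFac p q (d * q) m = DM at *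
  generalize ellFac p q (c * d * h * q ^ (m + 2)) r = CD at *
  generalize ellFac p q (b * d * h * q ^ (m + 2)) r = BD at *
  generalize ellFac p q (b * c * h * q ^ (m + 1)) r = BC at *
  generalize ellFac p q (a * h * q ^ (m + 1 + r + 1)) m = AH at *
  generalize ellTheta p (a * q ^ (m + 1 + (m + 1 + r) + 1)) = T2 at *
  generalize ellTheta p (a * q ^ (m + 1)) = T1 at *
  generalize ellTheta p (a * q ^ (2 * m + 1)) = T4 at *
  generalize ellTheta p (a * q ^ (2 * (m + 1) + 1)) = T5 at *
  generalize ellTheta p (a * q ^ (2 * (m + 1))) = T3 at *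
  generalize ellTheta p (q ^ (m + 1)) = S1 at *
  generalize ellTheta p (q ^ (r + 1)) = S2 at *
  generalize ellTheta p (c * d * h * q ^ (m + 1)) = U1 at *
  generalize ellTheta p (b * d * h * q ^ (m + 1)) = U2 at *
  generalize ellTheta p (h * q ^ r) = U3 at *
  generalize ellTheta p (a * h * q ^ (m + 1 + r + 1 + m)) = U4 at *
  generalize ellTheta p (b * q ^ m) = U5 at *
  generalize ellTheta p (c * q ^ m) = U6 at *
  -- G is the common quotient of the three prefactors; the denominators T4 and T5 cancel against
  -- those of α and β.
  obtain ⟨G, hG⟩ : ∃ G, G = QN / (T1 * X * T2 * (Qm * S1) * (Qr * S2)) := ⟨_, rfl⟩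
  have c0 : T3 / (T1 * (X * T2)) * (QN * ellTheta p (q ^ (m + 1 + r + 1)) /
      (Qm * S1 * (Qr * S2))) = G * (T3 * ellTheta p (q ^ (m + 1 + r + 1))) := by
    rw [hG, div_mul_div_comm, div_mul_eq_mul_div]
    congr 1 <;> ring
  have c1 : T4 / (T1 * X) * (QN / (Qm * (Qr * S2))) = T4 * (G * (T2 * S1)) := by
    rw [hG]; field_simp
  have c2 : T5 / (X * T2) * (QN / (Qm * S1 * Qr)) = T5 * (G * (T1 * S2)) := by
    rw [hG]; field_simp
  rw [pow_succ h m, c0, c1, c2]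
  clear c0 c1 c2 hG
  simp only [mul_assoc T4, mul_assoc T5]
  rw [← mul_assoc (_ / T4), ← mul_assoc (_ / T5), div_mul_cancel₀ _ t4, div_mul_cancel₀ _ t5]
  linear_combination (G * (ellFac p q b m * U5 * (ellFac p q c m * U6) * DM * (AH * U4)) *
    (ellFac p q h r * U3 * (U1 * CD) * (U2 * BD) * BC) * (h ^ m * h)) * hP

/-- At the two ends of the range only one of the two neighbouring terms exists, and the recursion is
a mere cancellation of factorials. -/
theorem ftTerm_rec_zero {a b c d h : ℂ} (hna : ∀ j : ℕ, ellTheta p (a * q ^ j) ≠ 0) {N : ℕ}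
    (hnq : ellFac p q q (N + 1) ≠ 0) :
    ftTerm p q (N + 1) a b c d h 0 =
      ftBeta p q N a b c d h 0 * ftTerm p q N (a * q) b c (d * q) h 0 := by
  have h1 := ellFac_ne_zero_of_le hnq N.le_succ
  have hX : ellFac p q (a * q) (N + 1) ≠ 0 :=
    Finset.prod_ne_zero_iff.2 fun j _ => by rw [mul_assoc, ← pow_succ']; exact hna _
  have t0 := hna 0
  have t1 := hna 1
  have e1 := ellFac_succ' p q a (N + 1)
  have e2 := ellFac_succ' p q (c * d * h) N
  have e3 := ellFac_succ' p q (b * d * h) N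
  have e4 := ellFac_succ p q (b * c * h) N
  have e5 := ellFac_succ p q h N
  simp only [ftTerm, ftBeta, ellFac_zero, Nat.sub_zero, mul_zero, pow_zero, mul_one, zero_add,
    one_mul, add_zero, pow_one] at *
  rw [e1, e2, e3, e4, e5, show c * (d * q) * h = c * d * h * q by ring,
    show b * (d * q) * h = b * d * h * q by ring]
  field_simp

theorem ftTerm_rec_last {a b c d h : ℂ} (hna : ∀ j : ℕ, ellTheta p (a * q ^ j) ≠ 0) {N : ℕ}
    (hnq : ellFac p q q (N + 1) ≠ 0) :
    ftTerm p q (N + 1) a b c d h (N + 1) =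
      ftAlpha p q N a b c d h N * ftTerm p q N (a * q) b c (d * q) h N := by
  have h1 := ellFac_ne_zero_of_le hnq N.le_succ
  have hX : ellFac p q (a * q ^ (N + 1)) (N + 1) ≠ 0 :=
    Finset.prod_ne_zero_iff.2 fun j _ => by rw [mul_assoc, ← pow_add]; exact hna _
  have t0 := hna (2 * (N + 1))
  have t1 := hna (2 * N + 1)
  have e1 := ellFac_succ p q (a * q ^ (N + 1)) (N + 1)
  rw [show a * q ^ (N + 1) * q ^ (N + 1) = a * q ^ (2 * (N + 1)) by ring] at e1
  have e2 := ellFac_succ p q b N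
  have e3 := ellFac_succ p q c N
  have e4 := ellFac_succ' p q d N
  have e5 := ellFac_succ p q (a * h * q ^ (N + 1)) N
  rw [show a * h * q ^ (N + 1) * q ^ N = a * h * q ^ (N + 1 + N) by ring] at e5
  simp only [ftTerm, ftAlpha, ellFac_zero, Nat.sub_self, pow_zero, mul_one, div_one] at *
  rw [e1, e2, e3, e4, e5, show a * q * q ^ N = a * q ^ (N + 1) by ring,
    show a * q * h * q ^ N = a * h * q ^ (N + 1) by ring,
    show a * q * q ^ (2 * N) = a * q ^ (2 * N + 1) by ring]
  field_simp
  ring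

/-- The elliptic Frenkel–Turaev summation. -/
theorem frenkelTuraev_sum (hp : ‖p‖ < 1) (hq : q ≠ 0) {N : ℕ} (hnq : ellFac p q q N ≠ 0) :
    ∀ {a b c d h : ℂ}, b ≠ 0 → c ≠ 0 → d ≠ 0 → h ≠ 0 → a * q = b * c * d * h →
    (∀ j : ℕ, ellTheta p (a * q ^ j) ≠ 0) →
    ∑ k ∈ Finset.range (N + 1), ftTerm p q N a b c d h k =
      ellFac p q (h * b) N * ellFac p q (h * c) N * ellFac p q (h * d) N := by
  induction N with
  | zero =>
    intro a b c d h _ _ _ _ _ hna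
    have := hna 0
    simp only [pow_zero, mul_one] at this
    simp [ftTerm, ellFac_zero, ellFac_one, this]
  | succ N ih =>
    intro a b c d h hb hc hd hh hbal hna
    have ih' := ih (ellFac_ne_zero_of_le hnq N.le_succ) hb hc (mul_ne_zero hd hq) hh
      (a := a * q) (by rw [hbal]; ring)
      (fun j => by rw [mul_assoc, ← pow_succ']; exact hna _)
    rw [Finset.sum_range_succ, Finset.sum_range_succ', ftTerm_rec_zero hna hnq,
      ftTerm_rec_last hna hnq, Finset.sum_congr rfl fun m hm =>
        ftTerm_rec hp hq hb hc hd hh hbal hna hnq (Finset.mem_range.1 hm), Finset.sum_add_distrib]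
    -- The k-th term of level N contributes α_k to index k + 1 and β_k to index k, so it enters the
    -- total with the constant weight α_k + β_k.
    have h1 : ∑ k ∈ Finset.range (N + 1), (ftAlpha p q N a b c d h k + ftBeta p q N a b c d h k) *
        ftTerm p q N (a * q) b c (d * q) h k =
        ellTheta p (h * d) * ellTheta p (h * b * q ^ N) * ellTheta p (h * c * q ^ N) *
        (ellFac p q (h * b) N * ellFac p q (h * c) N * ellFac p q (h * (d * q)) N) := by
      rw [← ih', Finset.mul_sum]
      refine Finset.sum_congr rfl fun k hk => ?_
      rw [ftAlpha_add_ftBeta hp hq hb hc hd hh hbal hna (Finset.mem_range_succ_iff.1 hk)]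
    simp only [add_mul, Finset.sum_add_distrib] at h1
    rw [Finset.sum_range_succ, Finset.sum_range_succ' (fun k => ftBeta p q N a b c d h k * _)] at h1
    rw [ellFac_succ, ellFac_succ, ellFac_succ', show h * d * q = h * (d * q) by ring]
    linear_combination h1

end FrenkelTuraev

/-! ### Genericity along q-orbits, and the factor (q^{-N})_x. -/

/-- No theta value on the `q`-orbit of `z` vanishes. -/
def EllGeneric (p q z : ℂ) : Prop := ∀ m : ℤ, ellTheta p (z * q ^ m) ≠ 0

theorem EllGeneric.ellFac_ne_zero {p q z : ℂ} (h : EllGeneric p q z) (hq : q ≠ 0) {w : ℂ} (m : ℤ)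
    (hw : w = z * q ^ m) (k : ℕ) : ellFac p q w k ≠ 0 := by
  subst hw
  refine Finset.prod_ne_zero_iff.2 fun j _ => ?_
  rw [mul_assoc, ← zpow_natCast, ← zpow_add₀ hq]
  exact h _

theorem EllGeneric.ellTheta_ne_zero {p q z : ℂ} (h : EllGeneric p q z) {w : ℂ} (m : ℤ)
    (hw : w = z * q ^ m) : ellTheta p w ≠ 0 := hw ▸ h m

theorem two_mul_choose_two_add (k : ℕ) : 2 * k.choose 2 + k = k * k := by
  induction k with
  | zero => rfl
  | succ k ih =>
    rw [Nat.choose_succ_succ' k 1, Nat.choose_one_right]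
    linarith

theorem ellFac_zpow_neg {p q : ℂ} (hp : ‖p‖ < 1) (hq : q ≠ 0) (x r : ℕ) :
    ellFac p q (q ^ (-((x + r : ℕ) : ℤ))) x * ellFac p q q r =
      (-(q ^ (x + r))⁻¹) ^ x * q ^ (x.choose 2) * ellFac p q q (x + r) := by
  rw [zpow_neg, zpow_natCast, ellFac_reflect hp (inv_ne_zero (pow_ne_zero _ hq)) hq
    (w := q * q ^ r) (by field_simp; ring), add_comm x r, ellFac_add p q q r x]
  ring

/-! ### The elliptic Bailey transformation. -/

section Bailey

variable {p q : ℂ}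

/-- The part of `ellWeight` not involving the numerator parameters `b`, `c`, `d`. -/
noncomputable def ellCoreWeight (p q : ℂ) (N : ℕ) (a b c d e f g : ℂ) (x : ℕ) : ℂ :=
  ellTheta p (a * q ^ (2 * x)) / ellTheta p a *
    (ellFac p q a x * (ellFac p q e x * ellFac p q f x * ellFac p q g x) *
      ellFac p q (q ^ (-(N : ℤ))) x /
      (ellFac p q q x * (ellFac p q (a * q / b) x * ellFac p q (a * q / c) x *
        ellFac p q (a * q / d) x) * (ellFac p q (a * q / e) x * ellFac p q (a * q / f) x *
        ellFac p q (a * q / g) x) * ellFac p q (a * q ^ (N + 1)) x)) * q ^ x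

theorem ellWeight_eq_core (N : ℕ) (a b c d e f g : ℂ) (x : ℕ) :
    ellWeight p q N a b c d e f g x = ellCoreWeight p q N a b c d e f g x *
      (ellFac p q b x * ellFac p q c x * ellFac p q d x) := by
  simp only [ellWeight, ellCoreWeight, ellFacs, List.map_cons, List.map_nil, List.prod_cons,
    List.prod_nil, mul_one, div_eq_mul_inv, mul_inv]
  ring

/-- The outer coefficient after interchanging the double sum in Bailey's transformation. -/
noncomputable def baileyOuter (p q : ℂ) (N : ℕ) (a b c d e f g lam : ℂ) (k : ℕ) : ℂ :=
  ellTheta p (lam * q ^ (2 * k)) / ellTheta p a * ellFac p q a (N + 1) *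
    ((ellFac p q e k * ellFac p q f k * ellFac p q g k) /
      (ellFac p q (a * q / e) N * ellFac p q (a * q / f) N * ellFac p q (a * q / g) N)) /
    ellFac p q (lam * q ^ k) (N + 1) / ellFac p q q k *
    ((ellFac p q (lam * b / a) k * ellFac p q (lam * c / a) k * ellFac p q (lam * d / a) k) /
      (ellFac p q (a * q / b) k * ellFac p q (a * q / c) k * ellFac p q (a * q / d) k)) *
    (ellFac p q q N / ellFac p q q (N - k)) *
    ((a / lam) ^ k * ((-1) ^ N * (lam * q ^ (N + k)) ^ (N - k) / q ^ (N.choose 2)))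

/-- Collects the powers of q and the signs left by the two reflections in `bailey_term`; the
exponents agree because 2·C(k,2) + k = k². -/
theorem bailey_monomial (hq : q ≠ 0) {L : ℂ} (hL : L ≠ 0) (x m r : ℕ) :
    (-(q ^ (x + r))⁻¹) ^ x * q ^ (x.choose 2) * q ^ x =
      (-1) ^ (x + r) * L ^ (m + r) / q ^ ((x + r).choose 2) *
        ((-L⁻¹) ^ r * q ^ (r.choose 2) * L⁻¹ ^ m) := by
  have h1 := two_mul_choose_two_add x
  have h2 := two_mul_choose_two_add r
  have h3 := two_mul_choose_two_add (x + r)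
  have e : x.choose 2 + x + (x + r).choose 2 = r.choose 2 + (x + r) * x := by nlinarith
  have e' : q ^ (x.choose 2) * q ^ x * q ^ ((x + r).choose 2) =
      q ^ (r.choose 2) * (q ^ (x + r)) ^ x := by
    rw [← pow_mul, ← pow_add, ← pow_add, ← pow_add, e]
  have hs : ((-1 : ℂ)) ^ r * (-1) ^ r = 1 := by rw [← mul_pow]; norm_num
  rw [neg_pow, neg_pow (L⁻¹), inv_pow, inv_pow, inv_pow, pow_add (-1 : ℂ), pow_add L]
  field_simp
  rw [pow_two, hs]
  linear_combination e'

/-- With x = k + m and N = k + m + r, the summand of the double sum factors into a part free of m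
and a Frenkel–Turaev term in m, with base aq^{2k}. The balancing relation for e, f, g is exactly the
one that makes this inner sum summable. -/
theorem bailey_term (hp : ‖p‖ < 1) (hq : q ≠ 0) {a b c d e f g lam : ℂ} (ha : a ≠ 0) (hb : b ≠ 0)
    (hc : c ≠ 0) (hd : d ≠ 0) (he : e ≠ 0) (hf : f ≠ 0) (hg : g ≠ 0) (hl : lam ≠ 0)
    {k m r : ℕ} (hbal : e * f * g = a * lam * q ^ (k + m + r + 1))
    (hlam : lam * b * c * d = a ^ 2 * q) (hnq : ellFac p q q (k + m + r) ≠ 0)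
    (ga : EllGeneric p q a) (gl : EllGeneric p q lam) (gab : EllGeneric p q (a / b))
    (gac : EllGeneric p q (a / c)) (gad : EllGeneric p q (a / d)) (gae : EllGeneric p q (a / e))
    (gaf : EllGeneric p q (a / f)) (gag : EllGeneric p q (a / g)) :
    ellCoreWeight p q (k + m + r) a b c d e f g (k + m) *
        ftTerm p q (k + m) lam (lam * b / a) (lam * c / a) (lam * d / a) (a / lam) k =
      baileyOuter p q (k + m + r) a b c d e f g lam k *
        ftTerm p q (m + r) (a * q ^ (2 * k)) (e * q ^ k) (f * q ^ k) (g * q ^ k)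
          (lam * q ^ (k + m + r + k))⁻¹ m := by
  have hb' : b = a ^ 2 * q / (lam * c * d) := by field_simp; linear_combination hlam
  have hc' : c = a ^ 2 * q / (lam * b * d) := by field_simp; linear_combination hlam
  have hd' : d = a ^ 2 * q / (lam * b * c) := by field_simp; linear_combination hlam
  have he' : e = a * lam * q ^ (k + m + r + 1) / (f * g) := by
    field_simp; linear_combination hbal
  have hf' : f = a * lam * q ^ (k + m + r + 1) / (e * g) := by
    field_simp; linear_combination hbal
  have hg' : g = a * lam * q ^ (k + m + r + 1) / (e * f) := by
    field_simp; linear_combination hbal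
  have hnq' : ∀ j ≤ k + m + r, ellFac p q q j ≠ 0 := fun j hj => ellFac_ne_zero_of_le hnq hj
  have n3 := hnq' r (by omega)
  have n4 := hnq' (k + m) (by omega)
  have n5 := hnq' (m + r) (by omega)
  have n7 : ellFac p q (a * q ^ (k + m + r + 1)) (k + m) ≠ 0 :=
    ga.ellFac_ne_zero hq (k + m + r + 1 : ℕ) (by rw [zpow_natCast]) _
  have n8 : ellFac p q (a * q ^ (k + m + k)) (m + r + 1) ≠ 0 :=
    ga.ellFac_ne_zero hq (k + m + k : ℕ) (by rw [zpow_natCast]) _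
  have n9 : ∀ j i, ellFac p q (lam * q ^ j) i ≠ 0 := fun j i =>
    gl.ellFac_ne_zero hq (j : ℕ) (by rw [zpow_natCast]) _
  have n10 : ∀ j i, ellFac p q (a * q / b * q ^ j) i ≠ 0 := fun j i =>
    gab.ellFac_ne_zero hq (j + 1 : ℕ) (by rw [zpow_natCast]; ring) _
  have n11 : ∀ j i, ellFac p q (a * q / c * q ^ j) i ≠ 0 := fun j i =>
    gac.ellFac_ne_zero hq (j + 1 : ℕ) (by rw [zpow_natCast]; ring) _
  have n12 : ∀ j i, ellFac p q (a * q / d * q ^ j) i ≠ 0 := fun j i =>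
    gad.ellFac_ne_zero hq (j + 1 : ℕ) (by rw [zpow_natCast]; ring) _
  have n13 : ∀ j i, ellFac p q (a * q / e * q ^ j) i ≠ 0 := fun j i =>
    gae.ellFac_ne_zero hq (j + 1 : ℕ) (by rw [zpow_natCast]; ring) _
  have n14 : ∀ j i, ellFac p q (a * q / f * q ^ j) i ≠ 0 := fun j i =>
    gaf.ellFac_ne_zero hq (j + 1 : ℕ) (by rw [zpow_natCast]; ring) _
  have n15 : ∀ j i, ellFac p q (a * q / g * q ^ j) i ≠ 0 := fun j i =>
    gag.ellFac_ne_zero hq (j + 1 : ℕ) (by rw [zpow_natCast]; ring) _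
  have rA : ellFac p q a (k + m) * ellFac p q (a * q ^ (k + m)) k *
      ellFac p q (a * q ^ (k + m + k)) (m + r + 1) =
      ellFac p q a (k + m + r + 1) * ellFac p q (a * q ^ (k + m + r + 1)) (k + m) := by
    rw [← ellFac_add, ← ellFac_add, ← ellFac_add]
    congr 1
    omega
  have rL : ellFac p q (lam * q ^ k) (k + m + r + 1) = ellFac p q (lam * q ^ k) (k + m + 1) *
      ellFac p q (lam * q ^ k * q ^ (k + m + 1)) r := by
    rw [← ellFac_add]
    congr 1
    omega
  have rH := ellFac_reflect hp (z := (lam * q ^ (k + m + r + k))⁻¹) (by positivity) hq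
    (w := lam * q ^ k * q ^ (k + m + 1)) (k := r) (by field_simp; ring)
  have rN := eq_div_of_mul_eq n3 (ellFac_zpow_neg hp hq (k + m) r)
  have hmon := bailey_monomial hq (L := lam * q ^ (k + m + r + k)) (by positivity) (k + m) m r
  have m2 := n9 (k + (k + m + 1)) r
  rw [pow_add, ← mul_assoc] at m2
  have a1 := n10 k m
  have a2 := n11 k m
  have a3 := n12 k m
  have a4 := n13 (k + m) r
  have a5 := n14 (k + m) r
  have a6 := n15 (k + m) r
  rw [ellCoreWeight, baileyOuter, ftTerm, ftTerm]
  rw [Nat.add_sub_cancel_left, Nat.add_sub_cancel_left, show k + m + r - k = m + r by omega,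
    show lam * c / a * (lam * d / a) * (a / lam) * q ^ k = a * q / b * q ^ k by
      rw [hb']; field_simp,
    show lam * b / a * (lam * d / a) * (a / lam) * q ^ k = a * q / c * q ^ k by
      rw [hc']; field_simp,
    show lam * b / a * (lam * c / a) * (a / lam) * q ^ k = a * q / d * q ^ k by
      rw [hd']; field_simp,
    show lam * (a / lam) * q ^ (k + m) = a * q ^ (k + m) by field_simp,
    show a * q ^ (2 * k) * (lam * q ^ (k + m + r + k))⁻¹ * q ^ (m + r) = a / lam by
      field_simp; ring,
    show f * q ^ k * (g * q ^ k) * (lam * q ^ (k + m + r + k))⁻¹ * q ^ m =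
      a * q / e * q ^ (k + m) by rw [he']; field_simp; ring,
    show e * q ^ k * (g * q ^ k) * (lam * q ^ (k + m + r + k))⁻¹ * q ^ m =
      a * q / f * q ^ (k + m) by rw [hf']; field_simp; ring,
    show e * q ^ k * (f * q ^ k) * (lam * q ^ (k + m + r + k))⁻¹ * q ^ m =
      a * q / g * q ^ (k + m) by rw [hg']; field_simp; ring,
    show a * q ^ (2 * k) * q ^ (2 * m) = a * q ^ (2 * (k + m)) by ring,
    show a * q ^ (2 * k) * q ^ m = a * q ^ (k + m + k) by ring,
    rL, rH, rN, ellFac_add p q e k m, ellFac_add p q f k m, ellFac_add p q g k m,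
    ellFac_add p q (a * q / b) k m, ellFac_add p q (a * q / c) k m,
    ellFac_add p q (a * q / d) k m, ellFac_add p q (a * q / e) (k + m) r,
    ellFac_add p q (a * q / f) (k + m) r, ellFac_add p q (a * q / g) (k + m) r]
  have rA' : ellFac p q a (k + m + r + 1) = ellFac p q a (k + m) * ellFac p q (a * q ^ (k + m)) k *
      ellFac p q (a * q ^ (k + m + k)) (m + r + 1) / ellFac p q (a * q ^ (k + m + r + 1)) (k + m) :=
    eq_div_of_mul_eq n7 rA.symm
  rw [rA']
  clear rA' rA rL rH rN hb' hc' hd' he' hf' hg' n9 n10 n11 n12 n13 n14 n15 ga gl gab gac gad gae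
    gaf gag hbal hlam hnq'
  generalize (-(q ^ (k + m + r))⁻¹) ^ (k + m) * q ^ ((k + m).choose 2) = M1 at *
  generalize (-1) ^ (k + m + r) * (lam * q ^ (k + m + r + k)) ^ (m + r) /
    q ^ ((k + m + r).choose 2) = M3 at *
  generalize (-(lam * q ^ (k + m + r + k))⁻¹) ^ r * q ^ (r.choose 2) = M4 at *
  generalize (lam * q ^ (k + m + r + k))⁻¹ ^ m = M5 at *
  generalize ellFac p q (a * q / b * q ^ k) m = X0 at *
  generalize ellFac p q (a * q / c * q ^ k) m = X1 at *
  generalize ellFac p q (a * q / d * q ^ k) m = X2 at *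
  generalize ellFac p q (a * q / e * q ^ (k + m)) r = X3 at *
  generalize ellFac p q (a * q / f * q ^ (k + m)) r = X4 at *
  generalize ellFac p q (a * q / g * q ^ (k + m)) r = X5 at *
  generalize ellFac p q (a * q / b) k = X6 at *
  generalize ellFac p q (a * q / c) k = X7 at *
  generalize ellFac p q (a * q / d) k = X8 at *
  generalize ellFac p q (a * q / e) (k + m) = X9 at *
  generalize ellFac p q (a * q / f) (k + m) = X10 at *
  generalize ellFac p q (a * q / g) (k + m) = X11 at *
  generalize ellFac p q (lam * q ^ k) (k + m + 1) = X12 at *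
  generalize ellFac p q (lam * q ^ k * q ^ (k + m + 1)) r = X13 at *
  generalize ellFac p q (a * q ^ (k + m + k)) (m + r + 1) = X14 at *
  generalize ellFac p q (a * q ^ (k + m)) k = X15 at *
  generalize ellFac p q (a * q ^ (k + m + r + 1)) (k + m) = X16 at *
  generalize ellFac p q (lam * b / a) k = X17 at *
  generalize ellFac p q (lam * c / a) k = X18 at *
  generalize ellFac p q (lam * d / a) k = X19 at *
  generalize ellFac p q (a / lam) m = X20 at *
  generalize ellFac p q (e * q ^ k) m = X21 at *
  generalize ellFac p q (f * q ^ k) m = X22 at *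
  generalize ellFac p q (g * q ^ k) m = X23 at *
  generalize ellFac p q e k = X24 at *
  generalize ellFac p q f k = X25 at *
  generalize ellFac p q g k = X26 at *
  generalize ellFac p q a (k + m) = X27 at *
  generalize ellFac p q q (k + m + r) = X28 at *
  generalize ellFac p q q (k + m) = X29 at *
  generalize ellFac p q q (m + r) = X30 at *
  generalize ellFac p q q k = X31 at *
  generalize ellFac p q q m = X32 at *
  generalize ellFac p q q r = X33 at *
  generalize ellTheta p (a * q ^ (2 * (k + m))) = X34 at *
  generalize ellTheta p (lam * q ^ (2 * k)) = X35 at *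
  generalize ellTheta p a = X36 at *
  generalize (a / lam) ^ k = X37 at *
  generalize q ^ (k + m) = X38 at *
  -- The two sides share the factor C; what differs is a monomial, treated by `hmon`, and pairs
  -- X·X⁻¹, which `hL` and `hR` show to be 1.
  have hL : (X29 * X29⁻¹) * (X0 * X0⁻¹) * (X1 * X1⁻¹) * (X2 * X2⁻¹) = 1 := by
    rw [mul_inv_cancel₀ n4, mul_inv_cancel₀ a1, mul_inv_cancel₀ a2, mul_inv_cancel₀ a3]
    norm_num
  have hR : (X3 * X3⁻¹) * (X4 * X4⁻¹) * (X5 * X5⁻¹) * (X13 * X13⁻¹) * (X14 * X14⁻¹) *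
      (X30 * X30⁻¹) = 1 := by
    rw [mul_inv_cancel₀ a4, mul_inv_cancel₀ a5, mul_inv_cancel₀ a6, mul_inv_cancel₀ m2,
      mul_inv_cancel₀ n8, mul_inv_cancel₀ n5]
    norm_num
  obtain ⟨C, hC⟩ : ∃ C, C = X34 * X35 * X36⁻¹ * X27 * X15 * X16⁻¹ * (X24 * X25 * X26) *
      (X21 * X22 * X23) * X28 * X33⁻¹ * (X9 * X10 * X11)⁻¹ * X12⁻¹ * X31⁻¹ * X32⁻¹ *
      (X17 * X18 * X19) * (X6 * X7 * X8)⁻¹ * X20 * X37 := ⟨_, rfl⟩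
  trans C * (M1 * X38) * ((X29 * X29⁻¹) * (X0 * X0⁻¹) * (X1 * X1⁻¹) * (X2 * X2⁻¹))
  · rw [hC]
    ring
  · rw [hL, hmon, ← hR, hC]
    ring

/-- The prefactor in the elliptic Bailey transformation. -/
noncomputable def baileyFactor (p q : ℂ) (N : ℕ) (a e f g lam : ℂ) : ℂ :=
  (a / lam) ^ N * (ellFac p q (a * q) N * (ellFac p q (lam * q / e) N *
    ellFac p q (lam * q / f) N * ellFac p q (lam * q / g) N) / (ellFac p q (lam * q) N *
    (ellFac p q (a * q / e) N * ellFac p q (a * q / f) N * ellFac p q (a * q / g) N)))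

theorem bailey_outer_monomial (hq : q ≠ 0) {a lam : ℂ} (ha : a ≠ 0) (hl : lam ≠ 0)
    {e f g : ℂ} {k r : ℕ} (hbal : e * f * g = a * lam * q ^ (k + r + 1)) :
    (a / lam) ^ k * ((-1) ^ (k + r) * (lam * q ^ (k + r + k)) ^ r / q ^ ((k + r).choose 2)) *
      (((-(e * (lam * q ^ (k + r))⁻¹)) ^ r * q ^ (r.choose 2)) *
        ((-(f * (lam * q ^ (k + r))⁻¹)) ^ r * q ^ (r.choose 2)) *
        ((-(g * (lam * q ^ (k + r))⁻¹)) ^ r * q ^ (r.choose 2))) =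
      (a / lam) ^ (k + r) * ((-(q ^ (k + r))⁻¹) ^ k * q ^ (k.choose 2)) * q ^ k := by
  have h1 := two_mul_choose_two_add k
  have h2 := two_mul_choose_two_add r
  have h3 := two_mul_choose_two_add (k + r)
  have e1 : (-(e * (lam * q ^ (k + r))⁻¹)) ^ r * (-(f * (lam * q ^ (k + r))⁻¹)) ^ r *
      (-(g * (lam * q ^ (k + r))⁻¹)) ^ r =
      (-1) ^ r * (a * q / (lam ^ 2 * q ^ (2 * (k + r)))) ^ r := by
    rw [← mul_pow, ← mul_pow, ← mul_pow]
    congr 1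
    field_simp
    linear_combination -hbal * q ^ (2 * (k + r))
  have e2 : (k + r + k) * r + r + r.choose 2 * 3 + (k + r) * k =
      2 * (k + r) * r + k.choose 2 + k + (k + r).choose 2 := by nlinarith
  have e3 : (q ^ (k + r + k)) ^ r * q ^ r * (q ^ (r.choose 2)) ^ 3 * (q ^ (k + r)) ^ k =
      (q ^ (2 * (k + r))) ^ r * q ^ (k.choose 2) * q ^ k * q ^ ((k + r).choose 2) := by
    rw [← pow_mul, ← pow_mul, ← pow_mul, ← pow_mul, ← pow_add, ← pow_add, ← pow_add, ← pow_add,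
      ← pow_add, ← pow_add, e2]
  have hs : ((-1 : ℂ)) ^ r * (-1) ^ r = 1 := by rw [← mul_pow]; norm_num
  calc _ = (a / lam) ^ k * ((-1) ^ (k + r) * (lam * q ^ (k + r + k)) ^ r / q ^ ((k + r).choose 2)) *
      (((-(e * (lam * q ^ (k + r))⁻¹)) ^ r * (-(f * (lam * q ^ (k + r))⁻¹)) ^ r *
      (-(g * (lam * q ^ (k + r))⁻¹)) ^ r) * (q ^ (r.choose 2)) ^ 3) := by ring
    _ = (a / lam) ^ k * (-1) ^ k * ((-1) ^ r * (-1) ^ r) * (a / lam) ^ r *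
        ((q ^ (k + r + k)) ^ r * q ^ r * (q ^ (r.choose 2)) ^ 3 * (q ^ (k + r)) ^ k) /
        (q ^ ((k + r).choose 2) * (q ^ (2 * (k + r))) ^ r * (q ^ (k + r)) ^ k) := by
      rw [e1, pow_add (-1 : ℂ), mul_pow lam, div_pow (a * q), mul_pow a, mul_pow (lam ^ 2),
        div_pow a, div_pow a, ← pow_mul lam 2 r, mul_comm 2 r, pow_mul lam r 2]
      field_simp
    _ = _ := by
      rw [hs, e3, pow_add (a / lam), neg_pow (q ^ (k + r))⁻¹, inv_pow]
      field_simp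

/-- Reflection turns the evaluated inner factorials into the tails (λq^{k+1}/x)_r for x = e, f, g.
Since (λq/x)_N = (λq/x)_k (λq^{k+1}/x)_r, they supply both the prefactor and the denominators of the
λ-weight. -/
theorem bailey_outer_eq (hp : ‖p‖ < 1) (hq : q ≠ 0) {a b c d e f g lam : ℂ} (ha : a ≠ 0)
    (he : e ≠ 0) (hf : f ≠ 0) (hg : g ≠ 0) (hl : lam ≠ 0)
    {k r : ℕ} (hbal : e * f * g = a * lam * q ^ (k + r + 1)) (hnq : ellFac p q q (k + r) ≠ 0)
    (ga : EllGeneric p q a) (gl : EllGeneric p q lam) (gle : EllGeneric p q (lam / e))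
    (glf : EllGeneric p q (lam / f)) (glg : EllGeneric p q (lam / g)) :
    baileyOuter p q (k + r) a b c d e f g lam k *
        (ellFac p q ((lam * q ^ (k + r + k))⁻¹ * (e * q ^ k)) r *
          ellFac p q ((lam * q ^ (k + r + k))⁻¹ * (f * q ^ k)) r *
          ellFac p q ((lam * q ^ (k + r + k))⁻¹ * (g * q ^ k)) r) =
      baileyFactor p q (k + r) a e f g lam *
        ellWeight p q (k + r) lam (lam * b / a) (lam * c / a) (lam * d / a) e f g k := by
  have hnq' : ∀ j ≤ k + r, ellFac p q q j ≠ 0 := fun j hj => ellFac_ne_zero_of_le hnq hj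
  have n3 := hnq' r (by omega)
  have n6 : ellTheta p a ≠ 0 := ga.ellTheta_ne_zero 0 (by simp)
  have n7 : ellTheta p lam ≠ 0 := gl.ellTheta_ne_zero 0 (by simp)
  have n9 : ∀ j i, ellFac p q (lam * q ^ j) i ≠ 0 := fun j i =>
    gl.ellFac_ne_zero hq (j : ℕ) (by rw [zpow_natCast]) _
  have n1 := n9 k (k + r + 1)
  have n2 := n9 1 (k + r)
  rw [pow_one] at n2
  have n4 := n9 (k + r + 1) k
  have n5 : ellFac p q (lam * q / e) k ≠ 0 :=
    gle.ellFac_ne_zero hq 1 (by rw [zpow_one]; ring) _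
  have n8 : ellFac p q (lam * q / f) k ≠ 0 :=
    glf.ellFac_ne_zero hq 1 (by rw [zpow_one]; ring) _
  have n10 : ellFac p q (lam * q / g) k ≠ 0 :=
    glg.ellFac_ne_zero hq 1 (by rw [zpow_one]; ring) _
  have rN := eq_div_of_mul_eq n3 (ellFac_zpow_neg hp hq k r)
  have rE : ∀ x : ℂ, x ≠ 0 → ellFac p q ((lam * q ^ (k + r + k))⁻¹ * (x * q ^ k)) r =
      (-(x * (lam * q ^ (k + r))⁻¹)) ^ r * q ^ (r.choose 2) *
        ellFac p q (lam * q / x * q ^ k) r := fun x hx => by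
    rw [show (lam * q ^ (k + r + k))⁻¹ * (x * q ^ k) = x * (lam * q ^ (k + r))⁻¹ by
      field_simp; ring]
    exact ellFac_reflect hp (by positivity) hq (by field_simp; ring)
  have rA := ellFac_succ' p q a (k + r)
  have rL : ellFac p q lam k * ellFac p q (lam * q ^ k) (k + r + 1) =
      ellTheta p lam * ellFac p q (lam * q) (k + r) * ellFac p q (lam * q ^ (k + r + 1)) k := by
    rw [← ellFac_add, ← ellFac_succ', ← ellFac_add]
    congr 1
    omega
  have hmon := bailey_outer_monomial hq ha hl hbal
  have rL' : (ellFac p q (lam * q ^ k) (k + r + 1))⁻¹ = ellFac p q lam k * (ellTheta p lam)⁻¹ *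
      (ellFac p q (lam * q) (k + r))⁻¹ * (ellFac p q (lam * q ^ (k + r + 1)) k)⁻¹ := by
    field_simp
    linear_combination -rL
  rw [ellWeight_eq_core, ellCoreWeight, baileyOuter, baileyFactor]
  rw [Nat.add_sub_cancel_left, rE e he, rE f hf, rE g hg, rA, rN,
    ellFac_add p q (lam * q / e) k r, ellFac_add p q (lam * q / f) k r,
    ellFac_add p q (lam * q / g) k r, show lam * q / (lam * b / a) = a * q / b by field_simp,
    show lam * q / (lam * c / a) = a * q / c by field_simp,
    show lam * q / (lam * d / a) = a * q / d by field_simp]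
  generalize (-1) ^ (k + r) * (lam * q ^ (k + r + k)) ^ r / q ^ ((k + r).choose 2) = M2 at *
  generalize (-(e * (lam * q ^ (k + r))⁻¹)) ^ r * q ^ (r.choose 2) = M3 at *
  generalize (-(f * (lam * q ^ (k + r))⁻¹)) ^ r * q ^ (r.choose 2) = M4 at *
  generalize (-(g * (lam * q ^ (k + r))⁻¹)) ^ r * q ^ (r.choose 2) = M5 at *
  generalize (-(q ^ (k + r))⁻¹) ^ k * q ^ (k.choose 2) = M7 at *
  clear rE n9 hnq'
  generalize (a / lam) ^ (k + r) = X0 at *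
  generalize (a / lam) ^ k = X1 at *
  generalize ellFac p q (lam * q ^ k) (k + r + 1) = X2 at *
  generalize ellFac p q (lam * q ^ (k + r + 1)) k = X3 at *
  generalize ellFac p q (lam * q / e * q ^ k) r = X4 at *
  generalize ellFac p q (lam * q / f * q ^ k) r = X5 at *
  generalize ellFac p q (lam * q / g * q ^ k) r = X6 at *
  generalize ellFac p q (lam * q / e) k = X7 at *
  generalize ellFac p q (lam * q / f) k = X8 at *
  generalize ellFac p q (lam * q / g) k = X9 at *
  generalize ellFac p q (a * q / b) k = X10 at *
  generalize ellFac p q (a * q / c) k = X11 at *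
  generalize ellFac p q (a * q / d) k = X12 at *
  generalize ellFac p q (a * q / e) (k + r) = X13 at *
  generalize ellFac p q (a * q / f) (k + r) = X14 at *
  generalize ellFac p q (a * q / g) (k + r) = X15 at *
  generalize ellFac p q (lam * b / a) k = X16 at *
  generalize ellFac p q (lam * c / a) k = X17 at *
  generalize ellFac p q (lam * d / a) k = X18 at *
  generalize ellFac p q (lam * q) (k + r) = X19 at *
  generalize ellFac p q (a * q) (k + r) = X20 at *
  generalize ellFac p q lam k = X21 at *
  generalize ellFac p q e k = X22 at *
  generalize ellFac p q f k = X23 at *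
  generalize ellFac p q g k = X24 at *
  generalize ellFac p q q (k + r) = X25 at *
  generalize ellFac p q q r = X26 at *
  generalize ellFac p q q k = X27 at *
  generalize ellTheta p (lam * q ^ (2 * k)) = X28 at *
  generalize ellTheta p lam = X29 at *
  generalize ellTheta p a = X30 at *
  generalize q ^ k = X31 at *
  have hL : X30 * X30⁻¹ = 1 := mul_inv_cancel₀ n6
  have hR : (X7 * X7⁻¹) * (X8 * X8⁻¹) * (X9 * X9⁻¹) = 1 := by
    rw [mul_inv_cancel₀ n5, mul_inv_cancel₀ n8, mul_inv_cancel₀ n10]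
    norm_num
  obtain ⟨C, hC⟩ : ∃ C, C = X28 * X20 * (X22 * X23 * X24) * (X13 * X14 * X15)⁻¹ *
      (X21 * X29⁻¹ * X19⁻¹ * X3⁻¹) * X27⁻¹ * (X16 * X17 * X18) * (X10 * X11 * X12)⁻¹ * X25 * X26⁻¹ *
      (X4 * X5 * X6) := ⟨_, rfl⟩
  trans C * (X1 * M2 * (M3 * M4 * M5)) * (X30 * X30⁻¹)
  · rw [div_eq_mul_inv _ X2, rL', hC]
    ring
  · rw [hL, hmon, ← hR, hC]
    ring

/-- Bailey's transformation for very-well-poised elliptic hypergeometric sums. -/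
theorem bailey_transformation (hp : ‖p‖ < 1) (hq : q ≠ 0) {a b c d e f g lam : ℂ} (ha : a ≠ 0)
    (hb : b ≠ 0) (hc : c ≠ 0) (hd : d ≠ 0) (he : e ≠ 0) (hf : f ≠ 0) (hg : g ≠ 0) (hl : lam ≠ 0)
    {N : ℕ} (hbal : e * f * g = a * lam * q ^ (N + 1))
    (hlam : lam * b * c * d = a ^ 2 * q) (hnq : ellFac p q q N ≠ 0)
    (ga : EllGeneric p q a) (gl : EllGeneric p q lam) (gab : EllGeneric p q (a / b))
    (gac : EllGeneric p q (a / c)) (gad : EllGeneric p q (a / d)) (gae : EllGeneric p q (a / e))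
    (gaf : EllGeneric p q (a / f)) (gag : EllGeneric p q (a / g)) (gle : EllGeneric p q (lam / e))
    (glf : EllGeneric p q (lam / f)) (glg : EllGeneric p q (lam / g)) :
    ∑ x ∈ Finset.range (N + 1), ellWeight p q N a b c d e f g x =
      baileyFactor p q N a e f g lam * ∑ x ∈ Finset.range (N + 1),
        ellWeight p q N lam (lam * b / a) (lam * c / a) (lam * d / a) e f g x := by
  have hnq' : ∀ j ≤ N, ellFac p q q j ≠ 0 := fun j hj => ellFac_ne_zero_of_le hnq hj
  -- With base λ, parameters λb/a, λc/a, λd/a and h = a/λ, the closed form of the Frenkel–Turaev sum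
  -- is (b, c, d)_x.
  have h1 : ∀ x ∈ Finset.range (N + 1), ellWeight p q N a b c d e f g x =
      ∑ k ∈ Finset.range (x + 1), ellCoreWeight p q N a b c d e f g (k + (x - k)) *
        ftTerm p q (k + (x - k)) lam (lam * b / a) (lam * c / a) (lam * d / a) (a / lam) k := by
    intro x hx
    have hft := frenkelTuraev_sum hp hq (hnq' x (Finset.mem_range_succ_iff.1 hx))
      (a := lam) (b := lam * b / a) (c := lam * c / a) (d := lam * d / a) (h := a / lam)
      (by positivity) (by positivity) (by positivity) (by positivity)
      (by field_simp; linear_combination -hlam)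
      (fun j => gl.ellTheta_ne_zero j (by rw [zpow_natCast]))
    rw [show a / lam * (lam * b / a) = b by field_simp,
      show a / lam * (lam * c / a) = c by field_simp,
      show a / lam * (lam * d / a) = d by field_simp] at hft
    rw [ellWeight_eq_core, ← hft, Finset.mul_sum]
    refine Finset.sum_congr rfl fun k hk => ?_
    rw [Nat.add_sub_cancel' (Finset.mem_range_succ_iff.1 hk)]
  -- Interchange of the triangular double sum: k becomes the outer variable and m = x - k the inner
  -- one.
  rw [Finset.sum_congr rfl h1, Finset.sum_range_diag_flip (N + 1) (fun k m =>
    ellCoreWeight p q N a b c d e f g (k + m) *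
      ftTerm p q (k + m) lam (lam * b / a) (lam * c / a) (lam * d / a) (a / lam) k),
    Finset.mul_sum]
  refine Finset.sum_congr rfl fun k hk => ?_
  obtain ⟨s, rfl⟩ := Nat.exists_eq_add_of_le (Finset.mem_range_succ_iff.1 hk)
  rw [← bailey_outer_eq hp hq ha he hf hg hl hbal hnq ga gl gle glf glg, show k + s + 1 - k = s + 1
    by omega, ← frenkelTuraev_sum hp hq (hnq' s (by omega)) (a := a * q ^ (2 * k))
    (by positivity) (by positivity) (by positivity) (by positivity)
    (by field_simp; linear_combination -hbal * q ^ (3 * k))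
    (fun j => ga.ellTheta_ne_zero (2 * k + j : ℕ) (by rw [zpow_natCast]; ring)), Finset.mul_sum]
  refine Finset.sum_congr rfl fun m hm => ?_
  obtain ⟨r, rfl⟩ := Nat.exists_eq_add_of_le (Finset.mem_range_succ_iff.1 hm)
  have := bailey_term hp hq ha hb hc hd he hf hg hl (k := k) (m := m) (r := r)
    (by rw [hbal]; ring) hlam (by rwa [← add_assoc] at hnq) ga gl gab gac gad gae gaf gag
  rw [show k + (m + r) = k + m + r by ring]
  exact this

end Bailey

/-! ### Cauchy–Binet and determinants of products of linear forms. -/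

section Determinants

variable {R : Type*} [CommRing R]

theorem StrictMono.comp_perm_injective {n M : ℕ} {y y' : Fin n → Fin M} {σ σ' : Equiv.Perm (Fin n)}
    (hy : StrictMono y) (hy' : StrictMono y') (h : y ∘ σ = y' ∘ σ') : y = y' ∧ σ = σ' := by
  have hr : Set.range y = Set.range y' := by
    rw [← σ.surjective.range_comp y, h, σ'.surjective.range_comp]
  have hyy := (StrictMono.range_inj hy hy').1 hr
  refine ⟨hyy, Equiv.ext fun i => hy.injective ?_⟩
  have := congrFun h i
  rwa [← hyy] at this

open Classical in
-- Sorting writes each injective tuple uniquely as an increasing tuple composed with a permutation.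
theorem sum_injective_eq_sum_strictMono {n M : ℕ} (F : (Fin n → Fin M) → R) :
    ∑ x : Fin n → Fin M with Function.Injective x, F x =
      ∑ y : Fin n → Fin M with StrictMono y, ∑ σ : Equiv.Perm (Fin n), F (y ∘ σ) := by
  rw [← Finset.sum_product', eq_comm]
  refine Finset.sum_bij (fun r _ => r.1 ∘ r.2) ?_ ?_ ?_ fun _ _ => rfl
  · intro r hr
    simp only [Finset.mem_product, Finset.mem_filter, Finset.mem_univ, true_and, and_true] at hr ⊢
    exact hr.injective.comp r.2.injective
  · intro r hr r' hr' h
    simp only [Finset.mem_product, Finset.mem_filter, Finset.mem_univ, true_and, and_true] at hr hr'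
    exact Prod.ext_iff.2 (StrictMono.comp_perm_injective hr hr' h)
  · intro x hx
    simp only [Finset.mem_filter, Finset.mem_univ, true_and] at hx
    refine ⟨(x ∘ Tuple.sort x, (Tuple.sort x)⁻¹), ?_, ?_⟩
    · simp only [Finset.mem_product, Finset.mem_filter, Finset.mem_univ, true_and, and_true]
      exact (Tuple.monotone_sort x).strictMono_of_injective (hx.comp (Tuple.sort x).injective)
    · funext i
      simp

open Classical in
/-- The Cauchy–Binet formula (discrete Andréief identity) over increasing index tuples. -/
theorem sum_strictMono_det_mul_det {n M : ℕ} (A B : Fin M → Fin n → R) :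
    ∑ x : Fin n → Fin M with StrictMono x,
        (Matrix.of fun j k => A (x j) k).det * (Matrix.of fun j k => B (x j) k).det =
      (Matrix.of fun k l => ∑ y, A y k * B y l).det := by
  have h1 : (Matrix.of fun k l => ∑ y, A y k * B y l).det =
      ∑ x : Fin n → Fin M, (∏ k, A (x k) k) * (Matrix.of fun k l => B (x k) l).det := by
    have : (Matrix.of fun k l => ∑ y, A y k * B y l) =
        fun k => ∑ y, A y k • (fun l => B y l) := by
      funext k l
      simp [Finset.sum_apply]
    rw [this]
    -- Expansion of the determinant by multilinearity in its rows; tuples with a repetition then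
    -- drop out because two rows coincide.
    have h2 := (Matrix.detRowAlternating (n := Fin n) (R := R)).toMultilinearMap.map_sum
      (fun k y => A y k • (fun l => B y l))
    refine h2.trans (Finset.sum_congr rfl fun x _ => ?_)
    exact (Matrix.detRowAlternating (n := Fin n) (R := R)).toMultilinearMap.map_smul_univ _ _
  rw [h1, ← Finset.sum_filter_add_sum_filter_not (s := Finset.univ)
      (fun x : Fin n → Fin M => Function.Injective x),
    sum_injective_eq_sum_strictMono]
  have h3 : ∑ x : Fin n → Fin M with ¬Function.Injective x,
      (∏ k, A (x k) k) * (Matrix.of fun k l => B (x k) l).det = 0 := by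
    refine Finset.sum_eq_zero fun x hx => ?_
    simp only [Function.Injective, Finset.mem_filter, Finset.mem_univ, true_and, not_forall] at hx
    obtain ⟨i, j, hij, hne⟩ := hx
    rw [Matrix.det_zero_of_row_eq hne (by funext l; simp [hij]), mul_zero]
  rw [h3, add_zero]
  refine Finset.sum_congr rfl fun y _ => ?_
  rw [Matrix.det_apply', Finset.sum_mul]
  refine Finset.sum_congr rfl fun σ _ => ?_
  have := Matrix.det_permute σ (Matrix.of fun j k => B (y j) k)
  have h4 : (Matrix.of fun k l => B ((y ∘ σ) k) l) =
    (Matrix.of fun j k => B (y j) k).submatrix σ id := rfl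
  rw [h4, this]
  simp only [Matrix.of_apply, Function.comp_apply]
  ring

theorem exists_prod_linear_eq_sum (u v : ℕ → R) (d : ℕ) : ∃ c : ℕ → R, ∀ s t : R,
    ∏ i ∈ Finset.range d, (u i * t - v i * s) =
      ∑ m ∈ Finset.range (d + 1), c m * (s ^ m * t ^ (d - m)) := by
  -- Vanishing of c beyond d is carried along so that the induction can extend the old sum by one
  -- term.
  suffices h : ∃ c : ℕ → R, (∀ m, d < m → c m = 0) ∧ ∀ s t : R,
      ∏ i ∈ Finset.range d, (u i * t - v i * s) =
        ∑ m ∈ Finset.range (d + 1), c m * (s ^ m * t ^ (d - m)) from ⟨h.choose, h.choose_spec.2⟩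
  induction d with
  | zero => exact ⟨fun m => if m = 0 then 1 else 0, fun m hm => if_neg hm.ne', fun s t => by simp⟩
  | succ d ih =>
    obtain ⟨c, hc0, hc⟩ := ih
    refine ⟨fun m => u d * c m - v d * (if m = 0 then 0 else c (m - 1)), fun m hm => ?_,
      fun s t => ?_⟩
    · simp [hc0 m (by omega), hc0 (m - 1) (by omega)]
    · rw [Finset.prod_range_succ, hc]
      simp only [sub_mul, Finset.sum_sub_distrib]
      rw [mul_sub]
      congr 1
      · rw [Finset.sum_range_succ _ (d + 1), hc0 (d + 1) (by omega), Finset.sum_mul]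
        simp only [mul_zero, zero_mul, add_zero]
        refine Finset.sum_congr rfl fun m hm => ?_
        rw [Nat.sub_add_comm (Finset.mem_range_succ_iff.1 hm)]
        ring
      · rw [Finset.sum_range_succ' _ (d + 1), Finset.sum_mul]
        simp only [if_true, mul_zero, zero_mul, add_zero, Nat.add_one_ne_zero, if_false,
          Nat.add_sub_cancel, Nat.add_sub_add_right]
        refine Finset.sum_congr rfl fun m _ => ?_
        ring

/-- A determinant of products of linear forms is proportional to the projective Vandermonde
determinant. -/
theorem det_prod_linear_mul {n : ℕ} (u v : Fin n → ℕ → R) (s t s' t' : Fin n → R) :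
    (Matrix.of fun j k => ∏ i ∈ Finset.range (n - 1), (u k i * t j - v k i * s j)).det *
        ∏ i, ∏ j ∈ Finset.Ioi i, (s' j * t' i - s' i * t' j) =
      (Matrix.of fun j k => ∏ i ∈ Finset.range (n - 1), (u k i * t' j - v k i * s' j)).det *
        ∏ i, ∏ j ∈ Finset.Ioi i, (s j * t i - s i * t j) := by
  choose c hc using fun k => exists_prod_linear_eq_sum (u k) (v k) (n - 1)
  -- Each column is a binary form of degree n - 1, so the matrix is the projective Vandermonde
  -- matrix times a coefficient matrix not involving the points.
  have key : ∀ s t : Fin n → R,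
      (Matrix.of fun j k => ∏ i ∈ Finset.range (n - 1), (u k i * t j - v k i * s j)) =
        Matrix.projVandermonde s t * Matrix.of fun (m k : Fin n) => c k m := by
    intro s t
    funext j k
    have hn : n - 1 + 1 = n := Nat.sub_add_cancel (by have := j.2; omega)
    rw [Matrix.of_apply, hc, Matrix.mul_apply, hn,
      Finset.sum_range (fun m => c k m * (s j ^ m * t j ^ (n - 1 - m)))]
    refine Finset.sum_congr rfl fun m _ => ?_
    rw [Matrix.projVandermonde_apply, Matrix.of_apply, Fin.val_rev, mul_comm]
    congr 3
    omega
  rw [key, key, Matrix.det_mul, Matrix.det_mul, Matrix.det_projVandermonde,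
    Matrix.det_projVandermonde]
  ring

end Determinants

/-! ### The bracket determinant and absorption of brackets. -/

section BracketDeterminant

variable {p q : ℂ}

/-- The product of `k` brackets in base `a` attached to the parameter `b = a β`. -/
noncomputable def bracketProd (p q a b x : ℂ) (k : ℕ) : ℂ :=
  ∏ i ∈ Finset.range k, ellBracket p a (b / a * q ^ i) x

theorem ellBracket_self (hp : ‖p‖ < 1) {a u : ℂ} (hu : u ≠ 0) : ellBracket p a u u = 0 := by
  rw [ellBracket, div_self hu, ellTheta_one hp, mul_zero, zero_div]

theorem ellBracket_swap (hp : ‖p‖ < 1) {a u x : ℂ} (hu : u ≠ 0) (hx : x ≠ 0) :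
    ellBracket p a u x = -ellBracket p a x u := by
  rw [ellBracket, ellBracket, show u / x = (x / u)⁻¹ by rw [inv_div],
    ellTheta_inv hp (div_ne_zero hx hu), mul_right_comm a u x]
  field_simp

theorem prod_fin_sub_eq_range {n : ℕ} (F : ℕ → ℕ → ℂ) :
    ∏ k : Fin n, ∏ i ∈ Finset.range (n - 1 - k), F k i =
      ∏ j ∈ Finset.range n, ∏ i ∈ Finset.range j, F (n - 1 - j) i := by
  rw [Fin.prod_univ_eq_prod_range (fun k => ∏ i ∈ Finset.range (n - 1 - k), F k i) n,
    ← Finset.prod_range_reflect]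
  refine Finset.prod_congr rfl fun j hj => ?_
  rw [Finset.mem_range] at hj
  rw [show n - 1 - (n - 1 - j) = j by omega]

theorem prod_Ioi_swap {n : ℕ} (F : Fin n → Fin n → ℂ) :
    ∏ i, ∏ j ∈ Finset.Ioi i, F i j = ∏ k : Fin n, ∏ i ∈ Finset.Iio k, F i k :=
  Finset.prod_comm' fun x y => by simp

theorem prod_Iio_fin {n : ℕ} (k : Fin n) (F : ℕ → ℂ) :
    ∏ i ∈ Finset.Iio k, F i = ∏ i ∈ Finset.range k, F i := by
  rw [← Nat.Iio_eq_range, ← Fin.map_valEmbedding_Iio, Finset.prod_map]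
  rfl

/-- Warnaar's type of determinant evaluation for products of brackets. -/
theorem det_bracketProd (hp : ‖p‖ < 1) (hq : q ≠ 0) {a b c : ℂ} (ha : a ≠ 0) (hb : b ≠ 0)
    (hc : c ≠ 0) {n : ℕ}
    (hne : ∀ i j : ℕ, i < j → j < n → ellBracket p a (b / a * q ^ j) (b / a * q ^ i) ≠ 0)
    {x : Fin n → ℂ} (hx : ∀ j, x j ≠ 0) :
    (Matrix.of fun j k : Fin n => bracketProd p q a b (x j) k *
        bracketProd p q a c (x j) (n - 1 - k)).det =
      (∏ k : Fin n, (-1) ^ (k : ℕ)) * (∏ j ∈ Finset.range n,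
        bracketProd p q a c (b / a * q ^ (n - 1 - j)) j) *
        ∏ i, ∏ j ∈ Finset.Ioi i, ellBracket p a (x j) (x i) := by
  obtain ⟨f, g, hfg⟩ := ellBracket_rank_two hp ha
  have hy : ∀ j : ℕ, b / a * q ^ j ≠ 0 := fun j => by positivity
  have hz : ∀ j : ℕ, c / a * q ^ j ≠ 0 := fun j => by positivity
  -- The n - 1 nodes of column k: the first k come from b, the rest from c.
  let w : Fin n → ℕ → ℂ := fun k i => if i < k then b / a * q ^ i else c / a * q ^ (i - k)
  have hw : ∀ k i, w k i ≠ 0 := fun k i => by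
    simp only [w]
    split_ifs
    exacts [hy _, hz _]
  have key : ∀ X : Fin n → ℂ, (∀ j, X j ≠ 0) → (Matrix.of fun j k : Fin n =>
      bracketProd p q a b (X j) k * bracketProd p q a c (X j) (n - 1 - k)) =
      Matrix.of fun j k => ∏ i ∈ Finset.range (n - 1),
        (f (w k i) * g (X j) - g (w k i) * f (X j)) := by
    intro X hX
    ext j k
    simp only [Matrix.of_apply, ← hfg _ _ (hw _ _) (hX _)]
    have hk := k.2
    obtain ⟨m, hm⟩ : ∃ m, n - 1 = k + m := ⟨n - 1 - k, by omega⟩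
    rw [hm, Finset.prod_range_add, Nat.add_sub_cancel_left]
    refine congrArg₂ (· * ·) (Finset.prod_congr rfl fun i hi => ?_)
      (Finset.prod_congr rfl fun i hi => ?_)
    · simp only [w, if_pos (Finset.mem_range.1 hi)]
    · simp only [w, if_neg (not_lt.2 (Nat.le_add_right (k : ℕ) i)), Nat.add_sub_cancel_left]
  -- The constant is found by comparing with the special points bq^j/a.
  have hdet := det_prod_linear_mul (fun k i => f (w k i)) (fun k i => g (w k i))
    (fun j => f (x j)) (fun j => g (x j)) (fun j : Fin n => f (b / a * q ^ (j : ℕ)))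
    (fun j : Fin n => g (b / a * q ^ (j : ℕ)))
  rw [← key x hx, ← key (fun j : Fin n => b / a * q ^ (j : ℕ)) fun j => hy j] at hdet
  have hV : ∀ X : Fin n → ℂ, (∀ j, X j ≠ 0) → ∏ i, ∏ j ∈ Finset.Ioi i,
      (f (X j) * g (X i) - f (X i) * g (X j)) =
      ∏ i, ∏ j ∈ Finset.Ioi i, ellBracket p a (X j) (X i) := fun X hX =>
    Finset.prod_congr rfl fun i _ => Finset.prod_congr rfl fun j _ => by
      rw [hfg _ _ (hX _) (hX _)]
      ring
  rw [hV x hx, hV (fun j : Fin n => b / a * q ^ (j : ℕ)) fun j => hy j] at hdet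
  have hVne : ∏ i : Fin n, ∏ j ∈ Finset.Ioi i,
      ellBracket p a (b / a * q ^ (j : ℕ)) (b / a * q ^ (i : ℕ)) ≠ 0 :=
    Finset.prod_ne_zero_iff.2 fun i _ => Finset.prod_ne_zero_iff.2 fun j hj => by
      have hij : i < j := Finset.mem_Ioi.1 hj
      exact hne i j hij j.2
  -- At the point bq^j/a every column k > j contains the vanishing bracket with node bq^j/a, so the
  -- matrix is lower triangular.
  have htri : (Matrix.of fun j k : Fin n => bracketProd p q a b (b / a * q ^ (j : ℕ)) k *
      bracketProd p q a c (b / a * q ^ (j : ℕ)) (n - 1 - k)).det =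
      ∏ k : Fin n, (bracketProd p q a b (b / a * q ^ (k : ℕ)) k *
        bracketProd p q a c (b / a * q ^ (k : ℕ)) (n - 1 - k)) := by
    refine (Matrix.det_of_isLowerTriangular _ fun j k hjk => ?_).trans rfl
    have hjk' : j < k := hjk
    rw [Matrix.of_apply, bracketProd, Finset.prod_eq_zero (Finset.mem_range.2 hjk')
      (ellBracket_self hp (hy _)), zero_mul]
  -- The b-brackets on the diagonal are those of the Vandermonde product with arguments swapped, one
  -- sign for each of the k brackets in row k.
  have hsign : ∏ k : Fin n, bracketProd p q a b (b / a * q ^ (k : ℕ)) k =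
      (∏ k : Fin n, (-1) ^ (k : ℕ)) * ∏ i : Fin n, ∏ j ∈ Finset.Ioi i,
        ellBracket p a (b / a * q ^ (j : ℕ)) (b / a * q ^ (i : ℕ)) := by
    rw [prod_Ioi_swap, ← Finset.prod_mul_distrib]
    refine Finset.prod_congr rfl fun k _ => ?_
    rw [prod_Iio_fin k fun i => ellBracket p a (b / a * q ^ (k : ℕ)) (b / a * q ^ i), bracketProd]
    have e : (-1 : ℂ) ^ (k : ℕ) = ∏ i ∈ Finset.range k, (-1) := by simp
    rw [e, ← Finset.prod_mul_distrib]
    refine Finset.prod_congr rfl fun i _ => ?_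
    rw [ellBracket_swap hp (hy _) (hy _), neg_one_mul]
  refine mul_right_cancel₀ hVne (hdet.trans ?_)
  rw [htri, Finset.prod_mul_distrib, hsign]
  simp only [bracketProd]
  rw [prod_fin_sub_eq_range (fun k i => ellBracket p a (c / a * q ^ i) (b / a * q ^ k))]
  ring

/-- The brackets at q^x are, up to a power, (bq^x)_k times (aq^{x+1-k}/b)_k. Regrouping by (b)_x
(bq^x)_k = (b)_k (bq^k)_x, and likewise in the denominator, replaces b by bq^k. -/
theorem bracketProd_mul_ellFac (hp : ‖p‖ < 1) (hq : q ≠ 0) {a b : ℂ} (ha : a ≠ 0) (hb : b ≠ 0)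
    (gab : EllGeneric p q (a / b)) (x k : ℕ) :
    bracketProd p q a b (q ^ x) k * (ellFac p q b x * (ellFac p q (a * q / b) x)⁻¹) =
      (-(q ^ x)⁻¹) ^ k * (ellFac p q b k * ellFac p q (a * q / (b * q ^ k)) k) *
        (ellFac p q (b * q ^ k) x * (ellFac p q (a * q / (b * q ^ k)) x)⁻¹) := by
  have h1 : bracketProd p q a b (q ^ x) k = (-(q ^ x)⁻¹) ^ k * (ellFac p q (b * q ^ x) k *
      ellFac p q (a * q / (b * q ^ k) * q ^ x) k) := by
    rw [bracketProd, ellFac, ellFac,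
      ← Finset.prod_range_reflect (fun i => ellTheta p (a * q / (b * q ^ k) * q ^ x * q ^ i))]
    have e : (-(q ^ x)⁻¹) ^ k = ∏ i ∈ Finset.range k, (-(q ^ x)⁻¹) := by simp
    rw [e, ← Finset.prod_mul_distrib, ← Finset.prod_mul_distrib]
    refine Finset.prod_congr rfl fun i hi => ?_
    obtain ⟨r, rfl⟩ := Nat.exists_eq_add_of_lt (Finset.mem_range.1 hi)
    rw [show i + r + 1 - 1 - i = r by omega, ellBracket,
      show a * (b / a * q ^ i) * q ^ x = b * q ^ x * q ^ i by field_simp]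
    have h2 := ellTheta_inv hp (z := b / a * q ^ i / q ^ x) (by positivity)
    rw [show (b / a * q ^ i / q ^ x)⁻¹ = a * q / (b * q ^ (i + r + 1)) * q ^ x * q ^ r by
      field_simp; ring] at h2
    rw [h2]
    field_simp
    ring
  have h3 : ellFac p q b x * ellFac p q (b * q ^ x) k =
      ellFac p q b k * ellFac p q (b * q ^ k) x := by
    rw [← ellFac_add, ← ellFac_add, add_comm]
  have h4 : ellFac p q (a * q / (b * q ^ k)) x * ellFac p q (a * q / (b * q ^ k) * q ^ x) k =
      ellFac p q (a * q / (b * q ^ k)) k * ellFac p q (a * q / b) x := by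
    have := ellFac_add p q (a * q / (b * q ^ k)) k x
    rw [show a * q / (b * q ^ k) * q ^ k = a * q / b by field_simp] at this
    rw [← this, ← ellFac_add, add_comm]
  have n1 : ellFac p q (a * q / (b * q ^ k)) x ≠ 0 :=
    gab.ellFac_ne_zero hq (1 - k : ℤ) (by rw [zpow_sub₀ hq, zpow_natCast]; field_simp) _
  have n2 : ellFac p q (a * q / b) x ≠ 0 :=
    gab.ellFac_ne_zero hq 1 (by rw [zpow_one]; ring) _
  rw [h1]
  have h5 : ellFac p q (a * q / (b * q ^ k) * q ^ x) k * (ellFac p q (a * q / b) x)⁻¹ =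
      ellFac p q (a * q / (b * q ^ k)) k * (ellFac p q (a * q / (b * q ^ k)) x)⁻¹ := by
    rw [← div_eq_mul_inv, ← div_eq_mul_inv, div_eq_div_iff n2 n1]
    linear_combination h4
  calc _ = (-(q ^ x)⁻¹) ^ k * (ellFac p q b x * ellFac p q (b * q ^ x) k) *
      (ellFac p q (a * q / (b * q ^ k) * q ^ x) k * (ellFac p q (a * q / b) x)⁻¹) := by ring
    _ = _ := by
      rw [h3, h5]
      ring

end BracketDeterminant

/-! ### The Selberg sum as a determinant. -/

section SelbergDeterminant

variable {p q : ℂ}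

/-- The constant produced by absorbing `k` brackets into the parameter `b`. -/
noncomputable def absorbConst (p q a b : ℂ) (k : ℕ) : ℂ :=
  ellFac p q b k * ellFac p q (a * q / (b * q ^ k)) k

theorem ellWeight_absorb (hp : ‖p‖ < 1) (hq : q ≠ 0) {a b c e f : ℂ} (ha : a ≠ 0) (hb : b ≠ 0)
    (hc : c ≠ 0) (he : e ≠ 0) (hf : f ≠ 0) (gab : EllGeneric p q (a / b))
    (gac : EllGeneric p q (a / c)) (gae : EllGeneric p q (a / e)) (gaf : EllGeneric p q (a / f))
    (N : ℕ) (d g : ℂ) (x k k' l l' : ℕ) :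
    (q ^ x) ^ (k + k' + (l + l')) * ellWeight p q N a b c d e f g x *
        (bracketProd p q a b (q ^ x) k * bracketProd p q a c (q ^ x) k') *
        (bracketProd p q a e (q ^ x) l * bracketProd p q a f (q ^ x) l') =
      (-1) ^ (k + k' + (l + l')) * (absorbConst p q a b k * absorbConst p q a c k') *
        (absorbConst p q a e l * absorbConst p q a f l') *
        ellWeight p q N a (b * q ^ k) (c * q ^ k') d (e * q ^ l) (f * q ^ l') g x := by
  have h1 := bracketProd_mul_ellFac hp hq ha hb gab x k
  have h2 := bracketProd_mul_ellFac hp hq ha hc gac x k'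
  have h3 := bracketProd_mul_ellFac hp hq ha he gae x l
  have h4 := bracketProd_mul_ellFac hp hq ha hf gaf x l'
  have h5 : (q ^ x) ^ (k + k' + (l + l')) * ((-(q ^ x)⁻¹) ^ k * (-(q ^ x)⁻¹) ^ k' *
      ((-(q ^ x)⁻¹) ^ l * (-(q ^ x)⁻¹) ^ l')) = (-1) ^ (k + k' + (l + l')) := by
    rw [← pow_add, ← pow_add, ← pow_add, ← mul_pow]
    congr 1
    field_simp
  simp only [ellWeight, absorbConst, ellFacs, List.map_cons, List.map_nil, List.prod_cons,
    List.prod_nil, mul_one, div_eq_mul_inv (_ * _ : ℂ) (ellFac p q q x * _), mul_inv]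
  obtain ⟨C, hC⟩ : ∃ C, C = ellTheta p (a * q ^ (2 * x)) / ellTheta p a * ellFac p q a x *
    ellFac p q d x * ellFac p q g x * ellFac p q (q ^ (-(N : ℤ))) x * (ellFac p q q x)⁻¹ *
    (ellFac p q (a * q / d) x)⁻¹ * (ellFac p q (a * q / g) x)⁻¹ *
    (ellFac p q (a * q ^ (N + 1)) x)⁻¹ * q ^ x := ⟨_, rfl⟩
  calc _ = (q ^ x) ^ (k + k' + (l + l')) * C *
      (bracketProd p q a b (q ^ x) k * (ellFac p q b x * (ellFac p q (a * q / b) x)⁻¹)) *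
      (bracketProd p q a c (q ^ x) k' * (ellFac p q c x * (ellFac p q (a * q / c) x)⁻¹)) *
      (bracketProd p q a e (q ^ x) l * (ellFac p q e x * (ellFac p q (a * q / e) x)⁻¹)) *
      (bracketProd p q a f (q ^ x) l' * (ellFac p q f x * (ellFac p q (a * q / f) x)⁻¹)) := by
        rw [hC]; ring
    _ = _ := by
        rw [h1, h2, h3, h4, ← h5, hC]; ring

theorem prod_Ioi_pair_mul {n : ℕ} (y : Fin n → ℂ) :
    ∏ i, ∏ j ∈ Finset.Ioi i, (y i * y j) = ∏ i, y i ^ (n - 1) := by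
  have := Finset.prod_prod_Ioi_mul_eq_prod_prod_off_diag (fun _ i : Fin n => y i)
  simpa only [Finset.prod_const, Finset.card_compl, Finset.card_singleton, Fintype.card_fin]
    using this

/-- Each pair factor is q^{x_j + x_k} times a bracket, and each index lies in n - 1 pairs; squaring
gives the exponent 2(n - 1), the number of brackets absorbed later. -/
theorem prod_pair_eq_bracket (hq : q ≠ 0) (a : ℂ) {n : ℕ} (x : Fin n → ℕ) :
    ∏ j : Fin n, ∏ k ∈ Finset.Ioi j, (q ^ (x j) * ellTheta p (q ^ ((x k : ℤ) - (x j : ℤ))) *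
        ellTheta p (a * q ^ (x j + x k))) ^ 2 =
      (∏ j, (q ^ x j) ^ (n - 1 + (n - 1))) *
        (∏ j : Fin n, ∏ k ∈ Finset.Ioi j, ellBracket p a (q ^ x k) (q ^ x j)) ^ 2 := by
  have h : ∀ j k : Fin n, (q ^ (x j) * ellTheta p (q ^ ((x k : ℤ) - (x j : ℤ))) *
      ellTheta p (a * q ^ (x j + x k))) ^ 2 = (q ^ x j * q ^ x k) ^ 2 *
        ellBracket p a (q ^ x k) (q ^ x j) ^ 2 := by
    intro j k
    rw [← mul_pow, ellBracket, zpow_sub₀ hq, zpow_natCast, zpow_natCast,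
      show a * q ^ (x j + x k) = a * q ^ x k * q ^ x j by ring]
    congr 1
    field_simp
  simp only [h, Finset.prod_mul_distrib, Finset.prod_pow]
  have h2 := prod_Ioi_pair_mul fun j => q ^ x j
  simp only [Finset.prod_mul_distrib, Finset.prod_pow] at h2
  rw [h2]
  ring

theorem det_mul_row_column {n : ℕ} (u v : Fin n → ℂ) (A : Fin n → Fin n → ℂ) :
    (Matrix.of fun k l => u k * v l * A k l).det = (∏ k, u k) * (∏ l, v l) * (Matrix.of A).det := by
  have h1 := Matrix.det_mul_column u (Matrix.of fun k l => v l * A k l)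
  have h2 := Matrix.det_mul_row v (Matrix.of A)
  simp only [Matrix.of_apply] at h1 h2
  rw [mul_assoc, ← h2, ← h1]
  simp only [mul_assoc]

theorem prod_fin_mul_sub (n : ℕ) (F G : ℕ → ℂ) :
    ∏ k : Fin n, (F k * G (n - 1 - k)) = ∏ j ∈ Finset.range n, (F j * G j) := by
  rw [Fin.prod_univ_eq_prod_range (fun k => F k * G (n - 1 - k)) n, Finset.prod_mul_distrib,
    Finset.prod_mul_distrib, Finset.prod_range_reflect]

/-- The discrete Selberg sum as a determinant of one-variable sums. -/
theorem ellSelbergSum_eq_det (hp : ‖p‖ < 1) (hq : q ≠ 0) {a b c e f : ℂ} (ha : a ≠ 0) (hb : b ≠ 0)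
    (hc : c ≠ 0) (he : e ≠ 0) (hf : f ≠ 0) (gab : EllGeneric p q (a / b))
    (gac : EllGeneric p q (a / c)) (gae : EllGeneric p q (a / e)) (gaf : EllGeneric p q (a / f))
    {n : ℕ} (hnb : ∀ i j : ℕ, i < j → j < n → ellBracket p a (b / a * q ^ j) (b / a * q ^ i) ≠ 0)
    (hne : ∀ i j : ℕ, i < j → j < n → ellBracket p a (e / a * q ^ j) (e / a * q ^ i) ≠ 0)
    (N : ℕ) (d g : ℂ) :
    ellSelbergSum p q n N a b c d e f g *
        ((∏ j ∈ Finset.range n, bracketProd p q a c (b / a * q ^ (n - 1 - j)) j) *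
          ∏ j ∈ Finset.range n, bracketProd p q a f (e / a * q ^ (n - 1 - j)) j) =
      (∏ j ∈ Finset.range n, (absorbConst p q a b j * absorbConst p q a c j)) *
        (∏ j ∈ Finset.range n, (absorbConst p q a e j * absorbConst p q a f j)) *
        (Matrix.of fun k l : Fin n => ∑ x ∈ Finset.range (N + 1),
          ellWeight p q N a (b * q ^ (k : ℕ)) (c * q ^ (n - 1 - k)) d
            (e * q ^ (l : ℕ)) (f * q ^ (n - 1 - l)) g x).det := by
  classical
  have hx : ∀ x : Fin n → ℕ, ∀ j, q ^ x j ≠ 0 := fun x j => pow_ne_zero _ hq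
  -- The sign in `det_bracketProd` occurs once for (b, c) and once for (e, f).
  have hsgn : (∏ k : Fin n, (-1 : ℂ) ^ (k : ℕ)) ^ 2 = 1 := by
    rw [← Finset.prod_pow]
    exact Finset.prod_eq_one fun k _ => by rw [← pow_mul, mul_comm, pow_mul]; norm_num
  -- The whole weight goes into A together with the b, c brackets; B holds only the e, f brackets.
  set A : Fin (N + 1) → Fin n → ℂ := fun y k => (q ^ (y : ℕ)) ^ (n - 1 + (n - 1)) *
    ellWeight p q N a b c d e f g y *
    (bracketProd p q a b (q ^ (y : ℕ)) k * bracketProd p q a c (q ^ (y : ℕ)) (n - 1 - k)) with hA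
  set B : Fin (N + 1) → Fin n → ℂ := fun y k =>
    bracketProd p q a e (q ^ (y : ℕ)) k * bracketProd p q a f (q ^ (y : ℕ)) (n - 1 - k) with hB
  have hL : ellSelbergSum p q n N a b c d e f g *
        ((∏ j ∈ Finset.range n, bracketProd p q a c (b / a * q ^ (n - 1 - j)) j) *
          ∏ j ∈ Finset.range n, bracketProd p q a f (e / a * q ^ (n - 1 - j)) j) =
      ∑ x : Fin n → Fin (N + 1) with StrictMono x,
        (Matrix.of fun j k => A (x j) k).det * (Matrix.of fun j k => B (x j) k).det := by
    rw [ellSelbergSum, Finset.sum_mul]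
    refine Finset.sum_congr (by congr) fun x _ => ?_
    have hb1 := det_bracketProd hp hq ha hb hc hnb (hx fun j => x j)
    have he1 := det_bracketProd hp hq ha he hf hne (hx fun j => x j)
    have hA1 : (Matrix.of fun j k => A (x j) k).det =
        (∏ j, ((q ^ (x j : ℕ)) ^ (n - 1 + (n - 1)) * ellWeight p q N a b c d e f g (x j))) *
        (Matrix.of fun j k : Fin n => bracketProd p q a b (q ^ (x j : ℕ)) k *
          bracketProd p q a c (q ^ (x j : ℕ)) (n - 1 - k)).det :=
      Matrix.det_mul_column _ _
    rw [hA1, hb1, show (Matrix.of fun j k => B (x j) k).det = _ from he1,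
      prod_pair_eq_bracket hq a fun j => (x j : ℕ), Finset.prod_mul_distrib]
    linear_combination (-(∏ j, (q ^ (x j : ℕ)) ^ (n - 1 + (n - 1))) *
      (∏ j : Fin n, ∏ k ∈ Finset.Ioi j, ellBracket p a (q ^ (x k : ℕ)) (q ^ (x j : ℕ))) ^ 2 *
      (∏ j, ellWeight p q N a b c d e f g (x j)) *
      ((∏ j ∈ Finset.range n, bracketProd p q a c (b / a * q ^ (n - 1 - j)) j) *
          ∏ j ∈ Finset.range n, bracketProd p q a f (e / a * q ^ (n - 1 - j)) j)) * hsgn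
  rw [hL, sum_strictMono_det_mul_det]
  have hE : ∀ k l : Fin n, ∑ y, A y k * B y l =
      (absorbConst p q a b k * absorbConst p q a c (n - 1 - k)) *
      (absorbConst p q a e l * absorbConst p q a f (n - 1 - l)) * ∑ x ∈ Finset.range (N + 1),
          ellWeight p q N a (b * q ^ (k : ℕ)) (c * q ^ (n - 1 - k)) d
            (e * q ^ (l : ℕ)) (f * q ^ (n - 1 - l)) g x := by
    intro k l
    rw [Finset.sum_range, Finset.mul_sum]
    refine Finset.sum_congr rfl fun y _ => ?_
    have := ellWeight_absorb hp hq ha hb hc he hf gab gac gae gaf N d g y k (n - 1 - k) l (n - 1 - l)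
    rw [show (k : ℕ) + (n - 1 - k) = n - 1 by omega, show (l : ℕ) + (n - 1 - l) = n - 1 by omega,
      Even.neg_one_pow ⟨n - 1, rfl⟩, one_mul] at this
    exact this
  simp only [hE]
  rw [det_mul_row_column, prod_fin_mul_sub n (absorbConst p q a b) (absorbConst p q a c),
    prod_fin_mul_sub n (absorbConst p q a e) (absorbConst p q a f)]

end SelbergDeterminant

/-! ### Comparison of constants in the bases a and λ. -/

section GenericTransformation

variable {p q : ℂ}

/-- The genericity conditions under which the determinantal proof applies directly. -/
structure SelbergGeneric (p q a b c d e f g lam : ℂ) : Prop where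
  gen_a : EllGeneric p q a
  gen_lam : EllGeneric p q lam
  a_div_b : EllGeneric p q (a / b)
  a_div_c : EllGeneric p q (a / c)
  a_div_d : EllGeneric p q (a / d)
  a_div_e : EllGeneric p q (a / e)
  a_div_f : EllGeneric p q (a / f)
  a_div_g : EllGeneric p q (a / g)
  lam_div_e : EllGeneric p q (lam / e)
  lam_div_f : EllGeneric p q (lam / f)
  lam_div_g : EllGeneric p q (lam / g)
  lam_mul_b : EllGeneric p q (lam * b / a)
  lam_mul_c : EllGeneric p q (lam * c / a)
  lam_mul_d : EllGeneric p q (lam * d / a)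
  gen_e : EllGeneric p q e
  gen_f : EllGeneric p q f
  b_sq : EllGeneric p q (b ^ 2 / a)
  b_sq' : EllGeneric p q (lam * b ^ 2 / a ^ 2)
  e_sq : EllGeneric p q (e ^ 2 / a)
  e_sq' : EllGeneric p q (e ^ 2 / lam)
  b_mul_c : EllGeneric p q (b * c / a)
  c_div_b : EllGeneric p q (c / b)
  e_mul_f : EllGeneric p q (e * f / a)
  f_div_e : EllGeneric p q (f / e)

theorem EllGeneric.shift {z w : ℂ} (h : EllGeneric p q z) (hq : q ≠ 0) (m : ℤ)
    (hw : w = z * q ^ m) : EllGeneric p q w := fun j => by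
  rw [hw, mul_assoc, ← zpow_add₀ hq]
  exact h _

theorem EllGeneric.div_mul_pow {a b : ℂ} (h : EllGeneric p q (a / b)) (hq : q ≠ 0) (k : ℕ) :
    EllGeneric p q (a / (b * q ^ k)) :=
  h.shift hq (-k) (by rw [zpow_neg, zpow_natCast]; field_simp)

theorem bracketProd_eq {a c u : ℂ} (ha : a ≠ 0) (j : ℕ) :
    bracketProd p q a c u j = ellFac p q (c * u) j *
      ∏ i ∈ Finset.range j, (ellTheta p (c / a * q ^ i / u) / (c / a * q ^ i)) := by
  rw [bracketProd, ellFac, ← Finset.prod_mul_distrib]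
  refine Finset.prod_congr rfl fun i _ => ?_
  rw [ellBracket, show a * (c / a * q ^ i) * u = c * u * q ^ i by field_simp, mul_div_assoc]

theorem bracketProd_ne_zero (hq : q ≠ 0) {a b c : ℂ} (ha : a ≠ 0) (hb : b ≠ 0) (hc : c ≠ 0)
    (h1 : EllGeneric p q (b * c / a)) (h2 : EllGeneric p q (c / b)) (m j : ℕ) :
    bracketProd p q a c (b / a * q ^ m) j ≠ 0 := by
  rw [bracketProd_eq ha]
  refine mul_ne_zero (h1.ellFac_ne_zero hq m (by rw [zpow_natCast]; ring) _)
    (Finset.prod_ne_zero_iff.2 fun i _ => div_ne_zero (h2.ellTheta_ne_zero (i - m : ℤ) ?_)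
      (by positivity))
  rw [zpow_sub₀ hq, zpow_natCast, zpow_natCast]
  field_simp

/-- Genericity of b²/a covers one theta factor. The other is θ(q^{j-i}) with j - i ≤ n - 1 ≤ N,
which is non-zero because (q)_N is. -/
theorem ellBracket_node_ne_zero (hq : q ≠ 0) {a b : ℂ} (ha : a ≠ 0) (hb : b ≠ 0)
    (h : EllGeneric p q (b ^ 2 / a)) {n N : ℕ} (hn : n ≤ N + 1) (hnq : ellFac p q q N ≠ 0)
    (i j : ℕ) (hij : i < j) (hj : j < n) :
    ellBracket p a (b / a * q ^ j) (b / a * q ^ i) ≠ 0 := by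
  obtain ⟨r, rfl⟩ := Nat.exists_eq_add_of_lt hij
  have h1 : ellTheta p (q ^ (r + 1)) ≠ 0 := by
    have := Finset.prod_ne_zero_iff.1 hnq r (Finset.mem_range.2 (by omega))
    rwa [← pow_succ'] at this
  rw [ellBracket, show b / a * q ^ (i + r + 1) / (b / a * q ^ i) = q ^ (r + 1) by
    field_simp; ring]
  exact div_ne_zero (mul_ne_zero (h.ellTheta_ne_zero (i + r + 1 + i : ℕ)
    (by rw [zpow_natCast]; field_simp; ring)) h1) (by positivity)

/-- The nodes b/a and c/a are the same in both bases, so only one factorial differs. The definition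
of λ makes reflection turn it into (d)_j in base λ and (λd/a)_j in base a. -/
theorem bracketProd_bc_ratio (hp : ‖p‖ < 1) (hq : q ≠ 0) {a b c d lam : ℂ} (ha : a ≠ 0)
    (hb : b ≠ 0) (hc : c ≠ 0) (hl : lam ≠ 0) {n j : ℕ} (hj : j < n)
    (hlam : lam * b * c * d * q ^ n = a ^ 2 * q ^ 2) :
    bracketProd p q lam (lam * c / a) (lam * b / a / lam * q ^ (n - 1 - j)) j *
        ellFac p q (lam * d / a) j =
      (lam / a) ^ j * ellFac p q d j * bracketProd p q a c (b / a * q ^ (n - 1 - j)) j := by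
  obtain ⟨m, rfl⟩ := Nat.exists_eq_add_of_lt hj
  rw [show j + m + 1 - 1 - j = m by omega]
  have hlam' : lam * b * c * d * q ^ (j + m) = a ^ 2 * q :=
    mul_right_cancel₀ hq (by linear_combination hlam)
  have h1 := ellFac_reflect hp (z := lam * c / a * (b / a * q ^ m)) (w := d) (k := j)
    (by positivity) hq (by field_simp; linear_combination hlam')
  have h2 := ellFac_reflect hp (z := c * (b / a * q ^ m)) (w := lam * d / a) (k := j)
    (by positivity) hq (by field_simp; linear_combination hlam')
  rw [bracketProd_eq ha, bracketProd_eq hl, show lam * b / a / lam = b / a by field_simp,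
    show lam * c / a / lam = c / a by field_simp, h1, h2,
    show -(lam * c / a * (b / a * q ^ m)) = lam / a * (-(c * (b / a * q ^ m))) by ring, mul_pow]
  ring

/-- Here e and f stay fixed, so the nodes scale by a/λ, which gives (λ/a)^j; balancing identifies
the remaining factorial with aq/g or λq/g directly, without reflection. -/
theorem bracketProd_ef_ratio {a e f g lam : ℂ} (ha : a ≠ 0) (he : e ≠ 0) (hf : f ≠ 0)
    (hg : g ≠ 0) (hl : lam ≠ 0) (hq : q ≠ 0) {n N j : ℕ} (hj : j < n) (hn : n ≤ N + 1)
    (hbal : e * f * g * q ^ n = a * lam * q ^ (N + 2)) :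
    bracketProd p q lam f (e / lam * q ^ (n - 1 - j)) j *
        ellFac p q (lam * q / g * q ^ (N - j)) j =
      (lam / a) ^ j * ellFac p q (a * q / g * q ^ (N - j)) j *
        bracketProd p q a f (e / a * q ^ (n - 1 - j)) j := by
  obtain ⟨m, rfl⟩ := Nat.exists_eq_add_of_lt hj
  obtain ⟨s, rfl⟩ := Nat.exists_eq_add_of_le (show j ≤ N by omega)
  rw [show j + m + 1 - 1 - j = m by omega, show j + s - j = s by omega]
  have hbal' : e * f * g * q ^ m = a * lam * q ^ (s + 1) :=
    mul_right_cancel₀ (pow_ne_zero (j + 1) hq) (by linear_combination hbal)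
  have hP : ∏ i ∈ Finset.range j, (ellTheta p (f / lam * q ^ i / (e / lam * q ^ m)) /
        (f / lam * q ^ i)) = (lam / a) ^ j * ∏ i ∈ Finset.range j,
        (ellTheta p (f / a * q ^ i / (e / a * q ^ m)) / (f / a * q ^ i)) := by
    have h : (lam / a) ^ j = ∏ i ∈ Finset.range j, (lam / a) := by
      rw [Finset.prod_const, Finset.card_range]
    rw [h, ← Finset.prod_mul_distrib]
    refine Finset.prod_congr rfl fun i _ => ?_
    rw [show f / lam * q ^ i / (e / lam * q ^ m) = f / a * q ^ i / (e / a * q ^ m) by field_simp]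
    field_simp
  rw [bracketProd_eq ha, bracketProd_eq hl, hP,
    show f * (e / lam * q ^ m) = a * q / g * q ^ s by field_simp; linear_combination hbal',
    show f * (e / a * q ^ m) = lam * q / g * q ^ s by field_simp; linear_combination hbal']
  ring

/-- The parameter-dependent part of `baileyFactor`. -/
noncomputable def baileyQuot (p q : ℂ) (N : ℕ) (a lam x : ℂ) : ℂ :=
  ellFac p q (lam * q / x) N / ellFac p q (a * q / x) N

theorem baileyFactor_eq (N : ℕ) (a e f g lam : ℂ) :
    baileyFactor p q N a e f g lam = (a / lam) ^ N * (ellFac p q (a * q) N /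
      ellFac p q (lam * q) N) * baileyQuot p q N a lam g * baileyQuot p q N a lam e *
      baileyQuot p q N a lam f := by
  simp only [baileyFactor, baileyQuot, div_eq_mul_inv, mul_inv]
  ring

/-- The factorials of length N at eq^j split into j factors, which cancel against or become part of
the absorption constants, and N - j factors at e. This is the origin of the lengths N - j in the
prefactor. -/
theorem baileyQuot_absorb (hq : q ≠ 0) {a e lam : ℂ} (h1 : EllGeneric p q (a / e))
    {N j : ℕ} (hj : j ≤ N) :
    baileyQuot p q N a lam (e * q ^ j) * absorbConst p q a e j =
      ellFac p q (lam * q / e) (N - j) / ellFac p q (a * q / e) (N - j) *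
        absorbConst p q lam e j := by
  obtain ⟨s, rfl⟩ := Nat.exists_eq_add_of_le hj
  have h : ∀ x : ℂ, ellFac p q (x * q / (e * q ^ j)) (j + s) =
      ellFac p q (x * q / (e * q ^ j)) j * ellFac p q (x * q / e) s := fun x => by
    rw [ellFac_add, show x * q / (e * q ^ j) * q ^ j = x * q / e by field_simp]
  have n1 : ellFac p q (a * q / (e * q ^ j)) j ≠ 0 :=
    (h1.div_mul_pow hq j).ellFac_ne_zero hq 1 (by rw [zpow_one]; ring) _
  have n2 : ellFac p q (a * q / e) s ≠ 0 := h1.ellFac_ne_zero hq 1 (by rw [zpow_one]; ring) _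
  rw [baileyQuot, absorbConst, absorbConst, h, h, Nat.add_sub_cancel_left]
  generalize ellFac p q (a * q / (e * q ^ j)) j = X at *
  generalize ellFac p q (a * q / e) s = Y at *
  field_simp

theorem baileyQuot_split (hq : q ≠ 0) {a g lam : ℂ} (h1 : EllGeneric p q (a / g)) {N j : ℕ}
    (hj : j ≤ N) :
    baileyQuot p q N a lam g * ellFac p q (a * q / g * q ^ (N - j)) j =
      ellFac p q (lam * q / g) (N - j) / ellFac p q (a * q / g) (N - j) *
        ellFac p q (lam * q / g * q ^ (N - j)) j := by
  obtain ⟨s, rfl⟩ := Nat.exists_eq_add_of_le hj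
  have n1 : ellFac p q (a * q / g) s ≠ 0 := h1.ellFac_ne_zero hq 1 (by rw [zpow_one]; ring) _
  have n2 : ellFac p q (a * q / g * q ^ s) j ≠ 0 :=
    (h1.shift hq (1 + s : ℤ) rfl).ellFac_ne_zero hq 0
      (by rw [zpow_add₀ hq, zpow_natCast]; simp; ring) _
  rw [baileyQuot, Nat.add_sub_cancel_left, add_comm, ellFac_add, ellFac_add]
  generalize ellFac p q (a * q / g) s = X at *
  generalize ellFac p q (a * q / g * q ^ s) j = Y at *
  field_simp

end GenericTransformation

/-! ### The transformation for generic parameters. -/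

section GenericTheorem

variable {p q : ℂ}

/-- The `j`-th factor in the prefactor of the transformation of elliptic Selberg sums. -/
noncomputable def selbergRatio (p q : ℂ) (N : ℕ) (a b c d e f g lam : ℂ) (j : ℕ) : ℂ :=
  (ellFacs p q [b, c, d] j * ellFacs p q [lam * q / e, lam * q / f, lam * q / g] (N - j)) /
    (ellFacs p q [lam * b / a, lam * c / a, lam * d / a] j *
      ellFacs p q [a * q / e, a * q / f, a * q / g] (N - j))

theorem absorbConst_transform {a b lam : ℂ} (ha : a ≠ 0) (hl : lam ≠ 0) (j : ℕ) :
    absorbConst p q a b j * ellFac p q (lam * b / a) j =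
      absorbConst p q lam (lam * b / a) j * ellFac p q b j := by
  rw [absorbConst, absorbConst, show lam * q / (lam * b / a * q ^ j) = a * q / (b * q ^ j) by
    field_simp]
  ring

theorem prod_transform_aux {K : Type*} [Field K] {Qe Ae De Le Ae' Qf Af Df Lf Af' Qg Zg Dg Lg Zg'
    Cbc Cbc' Cef Cef' r Ab Ab' Ac Ac' b b' c c' d d' : K}
    (hb' : b' ≠ 0) (hc' : c' ≠ 0) (hd' : d' ≠ 0) (hZ : Zg ≠ 0) (hZ' : Zg' ≠ 0)
    (he : Qe * Ae = Le / De * Ae') (hf : Qf * Af = Lf / Df * Af') (hg : Qg * Zg = Lg / Dg * Zg')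
    (hbc : Cbc' * d' = r * d * Cbc) (hef : Cef' * Zg' = r * Zg * Cef)
    (hb : Ab * b' = Ab' * b) (hc : Ac * c' = Ac' * c) :
    Ab * Ac * (Ae * Af) * (Qg * Qe * Qf) * (Cbc' * Cef') =
      r ^ 2 * (b * (c * d) * (Le * (Lf * Lg)) / (b' * (c' * d') * (De * (Df * Dg)))) *
        (Cbc * Cef) * (Ab' * Ac' * (Ae' * Af')) := by
  refine mul_right_cancel₀ (b := b' * c' * d' * Zg * Zg') (by positivity) ?_
  calc _ = (Qe * Ae) * (Qf * Af) * (Qg * Zg) * (Cbc' * d') * (Cef' * Zg') * (Ab * b') *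
        (Ac * c') := by ring
    _ = (Le / De) * (Lf / Df) * (Lg / Dg) * Ae' * Af' * Zg' * (r * d * Cbc) * (r * Zg * Cef) *
        (Ab' * b) * (Ac' * c) := by rw [he, hf, hg, hbc, hef, hb, hc]; ring
    _ = r ^ 2 * ((b / b') * (c / c') * (d / d') * ((Le / De) * (Lf / Df) * (Lg / Dg))) *
        (Cbc * Cef) * (Ab' * Ac' * (Ae' * Af')) * (b' * c' * d' * Zg * Zg') := by
      obtain ⟨x, rfl⟩ : ∃ x, b = x * b' := ⟨b / b', (div_mul_cancel₀ _ hb').symm⟩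
      obtain ⟨y, rfl⟩ : ∃ y, c = y * c' := ⟨c / c', (div_mul_cancel₀ _ hc').symm⟩
      obtain ⟨z, rfl⟩ : ∃ z, d = z * d' := ⟨d / d', (div_mul_cancel₀ _ hd').symm⟩
      rw [mul_div_cancel_right₀ _ hb', mul_div_cancel_right₀ _ hc', mul_div_cancel_right₀ _ hd']
      ring
    _ = _ := by simp only [div_eq_mul_inv, mul_inv]; ring

/-- All constants in the two determinant formulas and in the Bailey prefactor are products over the
same j, so they can be compared one j at a time. The three factorials at λb/a, λc/a, λd/a enter
through the two absorption constants and the b, c node product. -/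
theorem selberg_factor_transform (hp : ‖p‖ < 1) (hq : q ≠ 0) {a b c d e f g lam : ℂ} (ha : a ≠ 0)
    (hb : b ≠ 0) (hc : c ≠ 0) (he : e ≠ 0) (hf : f ≠ 0) (hg : g ≠ 0) (hl : lam ≠ 0)
    (G : SelbergGeneric p q a b c d e f g lam) {n N j : ℕ} (hj : j < n) (hn : n ≤ N + 1)
    (hbal : e * f * g * q ^ n = a * lam * q ^ (N + 2))
    (hlam : lam * b * c * d * q ^ n = a ^ 2 * q ^ 2) :
    absorbConst p q a b j * absorbConst p q a c j *
        (absorbConst p q a e j * absorbConst p q a f j) *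
        (baileyQuot p q N a lam g * baileyQuot p q N a lam (e * q ^ j) *
          baileyQuot p q N a lam (f * q ^ j)) *
        (bracketProd p q lam (lam * c / a) (lam * b / a / lam * q ^ (n - 1 - j)) j *
          bracketProd p q lam f (e / lam * q ^ (n - 1 - j)) j) =
      ((lam / a) ^ j) ^ 2 * selbergRatio p q N a b c d e f g lam j *
        (bracketProd p q a c (b / a * q ^ (n - 1 - j)) j *
          bracketProd p q a f (e / a * q ^ (n - 1 - j)) j) *
        (absorbConst p q lam (lam * b / a) j * absorbConst p q lam (lam * c / a) j *
          (absorbConst p q lam e j * absorbConst p q lam f j)) := by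
  have hjN : j ≤ N := by omega
  have hgen : ∀ z : ℂ, EllGeneric p q (z / g) → ellFac p q (z * q / g * q ^ (N - j)) j ≠ 0 :=
    fun z h => (h.shift hq (1 + (N - j : ℕ) : ℤ) rfl).ellFac_ne_zero hq 0
      (by rw [zpow_add₀ hq, zpow_natCast]; simp; ring) _
  simp only [selbergRatio, ellFacs, List.map_cons, List.map_nil, List.prod_cons, List.prod_nil,
    mul_one]
  exact prod_transform_aux
    (G.lam_mul_b.ellFac_ne_zero hq 0 (by simp) _) (G.lam_mul_c.ellFac_ne_zero hq 0 (by simp) _)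
    (G.lam_mul_d.ellFac_ne_zero hq 0 (by simp) _) (hgen _ G.a_div_g) (hgen _ G.lam_div_g)
    (baileyQuot_absorb hq G.a_div_e hjN) (baileyQuot_absorb hq G.a_div_f hjN)
    (baileyQuot_split hq G.a_div_g hjN) (bracketProd_bc_ratio hp hq ha hb hc hl hj hlam)
    (bracketProd_ef_ratio ha he hf hg hl hq hj hn hbal) (absorbConst_transform ha hl j)
    (absorbConst_transform ha hl j)

/-- The exponent is the sum of N - 2j over j < n. -/
theorem prod_div_pow_eq_zpow {K : Type*} [Field K] {a l : K} (ha : a ≠ 0) (hl : l ≠ 0) (n N : ℕ) :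
    ∏ j ∈ Finset.range n, ((a / l) ^ N * ((l / a) ^ j) ^ 2) =
      (a / l) ^ (((N : ℤ) + 1 - (n : ℤ)) * (n : ℤ)) := by
  have h : a / l ≠ 0 := div_ne_zero ha hl
  induction n with
  | zero => simp
  | succ n ih =>
    rw [Finset.prod_range_succ, ih, ← inv_div a l, ← zpow_natCast, ← zpow_natCast, ← zpow_natCast,
      inv_zpow', ← zpow_mul, ← zpow_add₀ h, ← zpow_add₀ h]
    congr 1
    push_cast
    ring

theorem absorbConst_ne_zero (hq : q ≠ 0) {a b : ℂ} (h1 : EllGeneric p q b)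
    (h2 : EllGeneric p q (a / b)) (j : ℕ) : absorbConst p q a b j ≠ 0 :=
  mul_ne_zero (h1.ellFac_ne_zero hq 0 (by simp) _)
    ((h2.div_mul_pow hq j).ellFac_ne_zero hq 1 (by rw [zpow_one]; ring) _)

/-- The products bq^k · cq^{n-1-k} and eq^l · fq^{n-1-l} do not depend on k and l, so every entry is
balanced with the same λ. The Bailey prefactor does not involve b, c, d, hence depends on the column
only and can be taken out of the determinant. -/
theorem det_bailey (hp : ‖p‖ < 1) (hq : q ≠ 0) {a b c d e f g lam : ℂ} (ha : a ≠ 0)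
    (hb : b ≠ 0) (hc : c ≠ 0) (hd : d ≠ 0) (he : e ≠ 0) (hf : f ≠ 0) (hg : g ≠ 0) (hl : lam ≠ 0)
    (G : SelbergGeneric p q a b c d e f g lam) {n N : ℕ} (hnq : ellFac p q q N ≠ 0)
    (hbal : e * f * g * q ^ n = a * lam * q ^ (N + 2))
    (hlam : lam * b * c * d * q ^ n = a ^ 2 * q ^ 2) :
    (Matrix.of fun k l : Fin n => ∑ x ∈ Finset.range (N + 1),
      ellWeight p q N a (b * q ^ (k : ℕ)) (c * q ^ (n - 1 - k)) d
        (e * q ^ (l : ℕ)) (f * q ^ (n - 1 - l)) g x).det =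
    (∏ j ∈ Finset.range n, ((a / lam) ^ N * (ellFac p q (a * q) N / ellFac p q (lam * q) N) *
      (baileyQuot p q N a lam g * baileyQuot p q N a lam (e * q ^ j) *
        baileyQuot p q N a lam (f * q ^ j)))) *
    (Matrix.of fun k l : Fin n => ∑ x ∈ Finset.range (N + 1),
      ellWeight p q N lam (lam * b / a * q ^ (k : ℕ)) (lam * c / a * q ^ (n - 1 - k)) (lam * d / a)
        (e * q ^ (l : ℕ)) (f * q ^ (n - 1 - l)) g x).det := by
  have hprod : ∏ j ∈ Finset.range n, ((a / lam) ^ N *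
      (ellFac p q (a * q) N / ellFac p q (lam * q) N) *
      (baileyQuot p q N a lam g * baileyQuot p q N a lam (e * q ^ j) *
        baileyQuot p q N a lam (f * q ^ j))) =
      ∏ l : Fin n, baileyFactor p q N a (e * q ^ (l : ℕ)) (f * q ^ (n - 1 - l)) g lam := by
    have := prod_fin_mul_sub n (fun j => (a / lam) ^ N *
      (ellFac p q (a * q) N / ellFac p q (lam * q) N) * baileyQuot p q N a lam g *
        baileyQuot p q N a lam (e * q ^ j)) (fun j => baileyQuot p q N a lam (f * q ^ j))
    simp only [baileyFactor_eq]
    rw [this]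
    exact Finset.prod_congr rfl fun j _ => by ring
  have key := Matrix.det_mul_row
    (fun l : Fin n => baileyFactor p q N a (e * q ^ (l : ℕ)) (f * q ^ (n - 1 - l)) g lam)
    (Matrix.of fun k l : Fin n => ∑ x ∈ Finset.range (N + 1),
      ellWeight p q N lam (lam * b / a * q ^ (k : ℕ)) (lam * c / a * q ^ (n - 1 - k)) (lam * d / a)
        (e * q ^ (l : ℕ)) (f * q ^ (n - 1 - l)) g x)
  rw [hprod, ← key]
  congr 1
  ext k l
  simp only [Matrix.of_apply]
  have hpow : ∀ k : Fin n, q ^ (k : ℕ) * q ^ (n - 1 - (k : ℕ)) * q = q ^ n := fun k => by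
    rw [← pow_add, ← pow_succ]
    congr 1
    omega
  have hs : ∀ y : ℂ, ∀ k : ℕ, lam * (y * q ^ k) / a = lam * y / a * q ^ k := fun y k => by ring
  have := bailey_transformation hp hq (a := a) (b := b * q ^ (k : ℕ)) (c := c * q ^ (n - 1 - k))
    (d := d) (e := e * q ^ (l : ℕ)) (f := f * q ^ (n - 1 - l)) (g := g) (lam := lam) ha
    (by positivity) (by positivity) hd (by positivity) (by positivity) hg hl (N := N)
    (mul_right_cancel₀ hq (by linear_combination hbal + e * f * g * hpow l))
    (mul_right_cancel₀ hq (by linear_combination hlam + lam * b * c * d * hpow k)) hnq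
    G.gen_a G.gen_lam (G.a_div_b.div_mul_pow hq _) (G.a_div_c.div_mul_pow hq _) G.a_div_d
    (G.a_div_e.div_mul_pow hq _) (G.a_div_f.div_mul_pow hq _) G.a_div_g
    (G.lam_div_e.div_mul_pow hq _) (G.lam_div_f.div_mul_pow hq _) G.lam_div_g
  rw [this, hs, hs]

theorem eq_of_det_relations {K : Type*} [Field K] {S S' C C' A A' P k Q r R D : K} (hC : C ≠ 0)
    (hA : A' ≠ 0) (h1 : S * C = A * (P * k * Q * D)) (h2 : S' * C' = A' * D)
    (h3 : A * Q * C' = r * R * C * A') : S = P * r * k * R * S' :=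
  mul_right_cancel₀ (mul_ne_zero hC hA) (by
    linear_combination A' * h1 - A * P * k * Q * h2 + P * k * S' * h3)

theorem ellSelbergSum_transformation_of_generic (hp : ‖p‖ < 1) (hq : q ≠ 0)
    {a b c d e f g lam : ℂ} (ha : a ≠ 0) (hb : b ≠ 0) (hc : c ≠ 0) (hd : d ≠ 0) (he : e ≠ 0)
    (hf : f ≠ 0) (hg : g ≠ 0) (hl : lam ≠ 0) (G : SelbergGeneric p q a b c d e f g lam)
    {n N : ℕ} (hn : n ≤ N + 1) (hnq : ellFac p q q N ≠ 0)
    (hbal : e * f * g * q ^ n = a * lam * q ^ (N + 2))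
    (hlam : lam * b * c * d * q ^ n = a ^ 2 * q ^ 2) :
    ellSelbergSum p q n N a b c d e f g =
      (a / lam) ^ (((N : ℤ) + 1 - (n : ℤ)) * (n : ℤ)) *
        (ellFac p q (a * q) N ^ n / ellFac p q (lam * q) N ^ n) *
        (∏ j ∈ Finset.range n, selbergRatio p q N a b c d e f g lam j) *
        ellSelbergSum p q n N lam (lam * b / a) (lam * c / a) (lam * d / a) e f g := by
  have hlb : ∀ y : ℂ, lam / (lam * y / a) = a / y := fun y => by field_simp
  have T1 := ellSelbergSum_eq_det hp hq ha hb hc he hf G.a_div_b G.a_div_c G.a_div_e G.a_div_f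
    (ellBracket_node_ne_zero hq ha hb G.b_sq hn hnq)
    (ellBracket_node_ne_zero hq ha he G.e_sq hn hnq) N d g
  have T2 := ellSelbergSum_eq_det hp hq (a := lam) (b := lam * b / a) (c := lam * c / a) (e := e)
    (f := f) hl (by positivity) (by positivity) he hf (by rw [hlb]; exact G.a_div_b)
    (by rw [hlb]; exact G.a_div_c) G.lam_div_e G.lam_div_f
    (ellBracket_node_ne_zero hq hl (by positivity)
      (by rw [show (lam * b / a) ^ 2 / lam = lam * b ^ 2 / a ^ 2 by field_simp]; exact G.b_sq')
      hn hnq)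
    (ellBracket_node_ne_zero hq hl he G.e_sq' hn hnq) N (lam * d / a) g
  rw [det_bailey hp hq ha hb hc hd he hf hg hl G hnq hbal hlam] at T1
  rw [← Finset.prod_mul_distrib, ← Finset.prod_mul_distrib] at T1 T2
  have hC : ∏ j ∈ Finset.range n, (bracketProd p q a c (b / a * q ^ (n - 1 - j)) j *
      bracketProd p q a f (e / a * q ^ (n - 1 - j)) j) ≠ 0 :=
    Finset.prod_ne_zero_iff.2 fun j _ => mul_ne_zero
      (bracketProd_ne_zero hq ha hb hc G.b_mul_c G.c_div_b _ _)
      (bracketProd_ne_zero hq ha he hf G.e_mul_f G.f_div_e _ _)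
  have hK : ∏ j ∈ Finset.range n, (absorbConst p q lam (lam * b / a) j *
      absorbConst p q lam (lam * c / a) j *
        (absorbConst p q lam e j * absorbConst p q lam f j)) ≠ 0 :=
    Finset.prod_ne_zero_iff.2 fun j _ => mul_ne_zero (mul_ne_zero
      (absorbConst_ne_zero hq G.lam_mul_b (by rw [hlb]; exact G.a_div_b) _)
      (absorbConst_ne_zero hq G.lam_mul_c (by rw [hlb]; exact G.a_div_c) _))
      (mul_ne_zero (absorbConst_ne_zero hq G.gen_e G.lam_div_e _)
        (absorbConst_ne_zero hq G.gen_f G.lam_div_f _))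
  have hR := Finset.prod_congr rfl fun j (hj : j ∈ Finset.range n) =>
    selberg_factor_transform hp hq ha hb hc he hf hg hl G (Finset.mem_range.1 hj) hn hbal hlam
  have hz := prod_div_pow_eq_zpow ha hl n N
  have hk : ∏ j ∈ Finset.range n, (ellFac p q (a * q) N / ellFac p q (lam * q) N) =
      ellFac p q (a * q) N ^ n / ellFac p q (lam * q) N ^ n := by
    rw [Finset.prod_const, Finset.card_range, div_pow]
  simp only [Finset.prod_mul_distrib] at hR T1 T2 hC hK hz
  rw [← hz, ← hk]
  exact eq_of_det_relations hC hK T1 T2 hR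

end GenericTheorem

/-! ### Removal of genericity by perturbation and continuity. -/

section Perturbation

variable {p q : ℂ}

/-- For k ≠ 0 the map s ↦ z e^{ks} q^m is injective on ℝ and θ has countably many zeros, so each of
the countably many m excludes countably many s. -/
theorem eventually_ellGeneric_mul_exp (hp : ‖p‖ < 1) (hq : q ≠ 0) {z : ℂ} (hz : z ≠ 0) {k : ℤ}
    (hk : k ≠ 0) : ∀ᶠ s : ℝ in cocountable, EllGeneric p q (z * (Real.exp s : ℂ) ^ k) := by
  rw [Filter.Eventually, mem_cocountable]
  have hsub : {s : ℝ | EllGeneric p q (z * (Real.exp s : ℂ) ^ k)}ᶜ ⊆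
      ⋃ m : ℤ, (fun s : ℝ => z * (Real.exp s : ℂ) ^ k * q ^ m) ⁻¹' {w | ellTheta p w = 0} := by
    intro s hs
    simpa [EllGeneric] using hs
  refine (Set.countable_iUnion fun m => (ellTheta_zeros_countable hp).preimage_of_injOn ?_).mono
    hsub
  intro s _ t _ h
  have h1 : (Real.exp s : ℂ) ^ k = (Real.exp t : ℂ) ^ k :=
    mul_left_cancel₀ hz (mul_right_cancel₀ (zpow_ne_zero m hq) h)
  rw [← Complex.ofReal_zpow, ← Complex.ofReal_zpow, Complex.ofReal_inj, ← Real.rpow_intCast,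
    ← Real.rpow_intCast, ← Real.exp_mul, ← Real.exp_mul, Real.exp_eq_exp] at h1
  exact mul_right_cancel₀ (Int.cast_ne_zero.2 hk) h1

/-- The weights 10, 1, 2, 4, 3, 6, 14, 13 of a, b, c, d, e, f, g, λ satisfy 13 + 1 + 2 + 4 = 2·10
and 3 + 6 + 14 = 10 + 13, so both balancing relations survive the perturbation, while each monomial
in `SelbergGeneric` has non-zero weight. -/
theorem eventually_selbergGeneric (hp : ‖p‖ < 1) (hq : q ≠ 0) {a b c d e f g lam : ℂ} (ha : a ≠ 0)
    (hb : b ≠ 0) (hc : c ≠ 0) (hd : d ≠ 0) (he : e ≠ 0) (hf : f ≠ 0) (hg : g ≠ 0)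
    (hl : lam ≠ 0) : ∀ᶠ s : ℝ in cocountable, SelbergGeneric p q
      (a * (Real.exp s : ℂ) ^ 10) (b * (Real.exp s : ℂ)) (c * (Real.exp s : ℂ) ^ 2)
      (d * (Real.exp s : ℂ) ^ 4) (e * (Real.exp s : ℂ) ^ 3) (f * (Real.exp s : ℂ) ^ 6)
      (g * (Real.exp s : ℂ) ^ 14) (lam * (Real.exp s : ℂ) ^ 13) := by
  have H : ∀ {z : ℂ} (k : ℤ), z ≠ 0 → k ≠ 0 → ∀ᶠ s : ℝ in cocountable,
      EllGeneric p q (z * (Real.exp s : ℂ) ^ k) :=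
    fun k hz hk => eventually_ellGeneric_mul_exp hp hq hz hk
  filter_upwards [H (z := a) (10) (by positivity) (by decide),
    H (z := lam) (13) (by positivity) (by decide),
    H (z := a / b) (9) (by positivity) (by decide),
    H (z := a / c) (8) (by positivity) (by decide),
    H (z := a / d) (6) (by positivity) (by decide),
    H (z := a / e) (7) (by positivity) (by decide),
    H (z := a / f) (4) (by positivity) (by decide),
    H (z := a / g) (-4) (by positivity) (by decide),
    H (z := lam / e) (10) (by positivity) (by decide),
    H (z := lam / f) (7) (by positivity) (by decide),
    H (z := lam / g) (-1) (by positivity) (by decide),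
    H (z := lam * b / a) (4) (by positivity) (by decide),
    H (z := lam * c / a) (5) (by positivity) (by decide),
    H (z := lam * d / a) (7) (by positivity) (by decide),
    H (z := e) (3) (by positivity) (by decide),
    H (z := f) (6) (by positivity) (by decide),
    H (z := b ^ 2 / a) (-8) (by positivity) (by decide),
    H (z := lam * b ^ 2 / a ^ 2) (-5) (by positivity) (by decide),
    H (z := e ^ 2 / a) (-4) (by positivity) (by decide),
    H (z := e ^ 2 / lam) (-7) (by positivity) (by decide),
    H (z := b * c / a) (-7) (by positivity) (by decide),
    H (z := c / b) (1) (by positivity) (by decide),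
    H (z := e * f / a) (-1) (by positivity) (by decide),
    H (z := f / e) (3) (by positivity) (by decide)] with s
    ha hlam hab hac had hae haf hag hle hlf hlg hlb hlc hld
    he hf hb2 hb2l he2 he2l hbc hcb hef hfe
  have ht : (Real.exp s : ℂ) ≠ 0 := Complex.ofReal_ne_zero.2 (Real.exp_pos s).ne'
  generalize (Real.exp s : ℂ) = t at *
  have C : ∀ {z w : ℂ}, EllGeneric p q z → z = w → EllGeneric p q w := fun h hzw => hzw ▸ h
  exact ⟨C ha (by field_simp), C hlam (by field_simp), C hab (by field_simp), C hac (by field_simp), C had (by field_simp), C hae (by field_simp), C haf (by field_simp), C hag (by field_simp), C hle (by field_simp), C hlf (by field_simp), C hlg (by field_simp), C hlb (by field_simp), C hlc (by field_simp), C hld (by field_simp), C he (by field_simp), C hf (by field_simp), C hb2 (by field_simp), C hb2l (by field_simp), C he2 (by field_simp), C he2l (by field_simp), C hbc (by field_simp), C hcb (by field_simp), C hef (by field_simp), C hfe (by field_simp)⟩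

theorem continuousAt_ellFac {X : Type*} [TopologicalSpace X] (hp : ‖p‖ < 1) (hq : q ≠ 0)
    {z : X → ℂ} {s : X} (hz : ContinuousAt z s) (h : z s ≠ 0) (k : ℕ) :
    ContinuousAt (fun t => ellFac p q (z t) k) s := by
  unfold ellFac
  refine tendsto_finsetProd _ fun j _ => ?_
  exact ContinuousAt.comp (f := fun t => z t * q ^ j)
    (ellTheta_continuousAt hp (mul_ne_zero h (pow_ne_zero j hq))) (hz.mul continuousAt_const)

theorem continuousAt_ellWeight {X : Type*} [TopologicalSpace X] (hp : ‖p‖ < 1) (hq : q ≠ 0)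
    {a b c d e f g : X → ℂ} {s : X} (ca : ContinuousAt a s) (cb : ContinuousAt b s)
    (cc : ContinuousAt c s) (cd : ContinuousAt d s) (ce : ContinuousAt e s)
    (cf : ContinuousAt f s) (cg : ContinuousAt g s) (ha : a s ≠ 0) (hb : b s ≠ 0) (hc : c s ≠ 0)
    (hd : d s ≠ 0) (he : e s ≠ 0) (hf : f s ≠ 0) (hg : g s ≠ 0) (hθ : ellTheta p (a s) ≠ 0)
    {N : ℕ} (hden : ellFacs p q [q, a s * q / b s, a s * q / c s, a s * q / d s, a s * q / e s,
      a s * q / f s, a s * q / g s, a s * q ^ (N + 1)] N ≠ 0) {x : ℕ} (hx : x ≤ N) :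
    ContinuousAt (fun t => ellWeight p q N (a t) (b t) (c t) (d t) (e t) (f t) (g t) x) s := by
  have hT : ∀ {z : X → ℂ}, ContinuousAt z s → z s ≠ 0 → ContinuousAt (fun t => ellTheta p (z t)) s :=
    fun hz h => ContinuousAt.comp (ellTheta_continuousAt hp h) hz
  have hF : ∀ {z : X → ℂ}, ContinuousAt z s → z s ≠ 0 →
      ContinuousAt (fun t => ellFac p q (z t) x) s := fun hz h => continuousAt_ellFac hp hq hz h x
  have hq1 : ContinuousAt (fun _ : X => q) s := continuousAt_const
  have hD : ∀ {y : X → ℂ}, ContinuousAt y s → y s ≠ 0 →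
      ContinuousAt (fun t => ellFac p q (a t * q / y t) x) s :=
    fun hy h => hF ((ca.mul hq1).div hy h) (by positivity)
  unfold ellWeight
  simp only [ellFacs, List.map_cons, List.map_nil, List.prod_cons, List.prod_nil, mul_one,
    mul_ne_zero_iff] at hden ⊢
  obtain ⟨h0, h1, h2, h3, h4, h5, h6, h7⟩ := hden
  refine (((hT (ca.mul continuousAt_const) (mul_ne_zero ha (pow_ne_zero _ hq))).div (hT ca ha) hθ).mul
    (ContinuousAt.div ?_ ?_ ?_)).mul continuousAt_const
  · exact (hF ca ha).mul ((hF cb hb).mul ((hF cc hc).mul ((hF cd hd).mul ((hF ce he).mul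
      ((hF cf hf).mul ((hF cg hg).mul continuousAt_const))))))
  · exact continuousAt_const.mul ((hD cb hb).mul ((hD cc hc).mul ((hD cd hd).mul ((hD ce he).mul
      ((hD cf hf).mul ((hD cg hg).mul (hF (ca.mul continuousAt_const) (by positivity))))))))
  · simp only [mul_ne_zero_iff]
    exact ⟨ellFac_ne_zero_of_le h0 hx, ellFac_ne_zero_of_le h1 hx, ellFac_ne_zero_of_le h2 hx,
      ellFac_ne_zero_of_le h3 hx, ellFac_ne_zero_of_le h4 hx, ellFac_ne_zero_of_le h5 hx,
      ellFac_ne_zero_of_le h6 hx, ellFac_ne_zero_of_le h7 hx⟩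

theorem continuousAt_ellSelbergSum {X : Type*} [TopologicalSpace X] (hp : ‖p‖ < 1) (hq : q ≠ 0)
    {a b c d e f g : X → ℂ} {s : X} (ca : ContinuousAt a s) (cb : ContinuousAt b s)
    (cc : ContinuousAt c s) (cd : ContinuousAt d s) (ce : ContinuousAt e s)
    (cf : ContinuousAt f s) (cg : ContinuousAt g s) (ha : a s ≠ 0) (hb : b s ≠ 0) (hc : c s ≠ 0)
    (hd : d s ≠ 0) (he : e s ≠ 0) (hf : f s ≠ 0) (hg : g s ≠ 0) (hθ : ellTheta p (a s) ≠ 0)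
    {N : ℕ} (hden : ellFacs p q [q, a s * q / b s, a s * q / c s, a s * q / d s, a s * q / e s,
      a s * q / f s, a s * q / g s, a s * q ^ (N + 1)] N ≠ 0) (n : ℕ) :
    ContinuousAt (fun t => ellSelbergSum p q n N (a t) (b t) (c t) (d t) (e t) (f t) (g t)) s := by
  unfold ellSelbergSum
  refine tendsto_finsetSum _ fun x _ => ContinuousAt.mul ?_ ?_
  · refine tendsto_finsetProd _ fun j _ => tendsto_finsetProd _ fun k _ =>
      ContinuousAt.pow (continuousAt_const.mul ?_) 2
    exact ContinuousAt.comp (f := fun t => a t * q ^ ((x j : ℕ) + (x k : ℕ)))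
      (ellTheta_continuousAt hp (by positivity)) (ca.mul continuousAt_const)
  · exact tendsto_finsetProd _ fun j _ => continuousAt_ellWeight hp hq ca cb cc cd ce cf cg ha hb hc
      hd he hf hg hθ hden (Nat.lt_succ_iff.1 (x j).2)

theorem continuousAt_selbergRatio {X : Type*} [TopologicalSpace X] (hp : ‖p‖ < 1) (hq : q ≠ 0)
    {a b c d e f g lam : X → ℂ} {s : X} (ca : ContinuousAt a s) (cb : ContinuousAt b s)
    (cc : ContinuousAt c s) (cd : ContinuousAt d s) (ce : ContinuousAt e s)
    (cf : ContinuousAt f s) (cg : ContinuousAt g s) (cl : ContinuousAt lam s) (ha : a s ≠ 0)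
    (hb : b s ≠ 0) (hc : c s ≠ 0) (hd : d s ≠ 0) (he : e s ≠ 0) (hf : f s ≠ 0) (hg : g s ≠ 0)
    (hl : lam s ≠ 0) {N j : ℕ}
    (h1 : ellFacs p q [lam s * b s / a s, lam s * c s / a s, lam s * d s / a s] j ≠ 0)
    (h2 : ellFacs p q [a s * q / e s, a s * q / f s, a s * q / g s] (N - j) ≠ 0) :
    ContinuousAt (fun t => selbergRatio p q N (a t) (b t) (c t) (d t) (e t) (f t) (g t) (lam t) j)
      s := by
  have hq1 : ContinuousAt (fun _ : X => q) s := continuousAt_const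
  have hF : ∀ {z : X → ℂ} (k : ℕ), ContinuousAt z s → z s ≠ 0 →
      ContinuousAt (fun t => ellFac p q (z t) k) s := fun k hz h => continuousAt_ellFac hp hq hz h k
  have hD : ∀ {y z : X → ℂ}, ContinuousAt z s → z s ≠ 0 → ContinuousAt y s → y s ≠ 0 →
      ContinuousAt (fun t => ellFac p q (z t * q / y t) (N - j)) s :=
    fun hz hz0 hy h => hF _ ((hz.mul hq1).div hy h) (by positivity)
  have hE : ∀ {y : X → ℂ}, ContinuousAt y s → y s ≠ 0 →
      ContinuousAt (fun t => ellFac p q (lam t * y t / a t) j) s :=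
    fun hy h => hF _ ((cl.mul hy).div ca ha) (by positivity)
  unfold selbergRatio
  refine ContinuousAt.div ?_ ?_ (mul_ne_zero h1 h2)
  all_goals simp only [ellFacs, List.map_cons, List.map_nil, List.prod_cons, List.prod_nil, mul_one]
  · exact ((hF j cb hb).mul ((hF j cc hc).mul (hF j cd hd))).mul
      ((hD cl hl ce he).mul ((hD cl hl cf hf).mul (hD cl hl cg hg)))
  · exact ((hE cb hb).mul ((hE cc hc).mul (hE cd hd))).mul
      ((hD ca ha ce he).mul ((hD ca ha cf hf).mul (hD ca ha cg hg)))

theorem ellSelbergSum_eq_zero_of_lt {n N : ℕ} (h : N + 1 < n) (a b c d e f g : ℂ) :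
    ellSelbergSum p q n N a b c d e f g = 0 := by
  unfold ellSelbergSum
  rw [Finset.sum_eq_zero]
  intro x hx
  have := Fintype.card_le_of_injective x (Finset.mem_filter.1 hx).2.injective
  simp only [Fintype.card_fin] at this
  omega

end Perturbation

/-- In the product over `j`, the index is shifted to start at `0`, so that `j - 1` and `N + 1 - j`
become `j` and `N - j`. The natural-number subtraction `N - j` is exact whenever `n ≤ N + 1`;
for `n > N + 1` both sums are empty and both sides vanish. -/
theorem mainTheorem2 (p q : ℂ) (hp : ‖p‖ < 1) (hq0 : q ≠ 0) (hq : ‖q‖ < 1) (n N : ℕ)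
    (a b c d e f g lam : ℂ) (ha : a ≠ 0)
    (hbal : b * c * d * e * f * g = q ^ (4 + (N : ℤ) - 2 * (n : ℤ)) * a ^ 3)
    (hlam : lam = a ^ 2 * q ^ (2 - (n : ℤ)) / (b * c * d))
    -- the denominators in the two sums and in the prefactor do not vanish
    (hθa : ellTheta p a ≠ 0) (hθlam : ellTheta p lam ≠ 0)
    (hden : ellFacs p q [q, a * q / b, a * q / c, a * q / d, a * q / e, a * q / f, a * q / g,
      a * q ^ (N + 1)] N ≠ 0)
    (hden' : ellFacs p q [lam * q / e, lam * q / f, lam * q / g, lam * q ^ (N + 1)] N ≠ 0)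
    (hlamq : ellFac p q (lam * q) N ≠ 0)
    (hpre : ellFacs p q [lam * b / a, lam * c / a, lam * d / a] (n - 1) ≠ 0) :
    ellSelbergSum p q n N a b c d e f g =
      (a / lam) ^ (((N : ℤ) + 1 - (n : ℤ)) * (n : ℤ)) *
        (ellFac p q (a * q) N ^ n / ellFac p q (lam * q) N ^ n) *
        (∏ j ∈ Finset.range n,
          (ellFacs p q [b, c, d] j *
              ellFacs p q [lam * q / e, lam * q / f, lam * q / g] (N - j)) /
            (ellFacs p q [lam * b / a, lam * c / a, lam * d / a] j *
              ellFacs p q [a * q / e, a * q / f, a * q / g] (N - j))) *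
        ellSelbergSum p q n N lam (lam * b / a) (lam * c / a) (lam * d / a) e f g := by
  rcases lt_or_ge (N + 1) n with hn | hn
  · rw [ellSelbergSum_eq_zero_of_lt hn, ellSelbergSum_eq_zero_of_lt hn, mul_zero]
  -- Non-vanishing of b, …, g is a consequence of the balancing condition.
  have hprod : b * c * d * e * f * g ≠ 0 := by rw [hbal]; positivity
  simp only [mul_ne_zero_iff] at hprod
  obtain ⟨⟨⟨⟨⟨hb, hc⟩, hd⟩, he⟩, hf⟩, hg⟩ := hprod
  have hl : lam ≠ 0 := by rw [hlam]; positivity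
  have hlam1 : lam * b * c * d * q ^ n = a ^ 2 * q ^ 2 := by
    rw [hlam, zpow_sub₀ hq0, zpow_natCast, zpow_ofNat]
    field_simp
  have hbal1 : e * f * g * q ^ n = a * lam * q ^ (N + 2) := by
    have h1 : b * c * d * e * f * g * (q ^ n) ^ 2 = q ^ (N + 4) * a ^ 3 := by
      rw [hbal, mul_right_comm, ← zpow_natCast q n, ← zpow_natCast, ← zpow_mul, ← zpow_add₀ hq0,
        ← zpow_natCast q (N + 4)]
      congr 2
      push_cast
      ring
    refine mul_left_cancel₀ (a := b * c * d * q ^ n) (by positivity) ?_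
    linear_combination h1 - a * q ^ (N + 2) * hlam1
  have hden1 := hden
  simp only [ellFacs, List.map_cons, List.map_nil, List.prod_cons, List.prod_nil, mul_one,
    mul_ne_zero_iff] at hden1 hden' hpre
  obtain ⟨hnq, hab, hac, had, hae, haf, hag, -⟩ := hden1
  have cE : ∀ (z : ℂ) (k : ℕ), ContinuousAt (fun s : ℝ => z * (Real.exp s : ℂ) ^ k) 0 :=
    fun z k => by fun_prop
  have cE1 : ContinuousAt (fun s : ℝ => b * (Real.exp s : ℂ)) 0 := by fun_prop
  -- In the λ-sum the denominators attached to λb/a, λc/a, λd/a are again those at aq/b, aq/c, aq/d,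
  -- so their non-vanishing is already in `hden`.
  have hlb : ∀ y : ℂ, lam * q / (lam * y / a) = a * q / y := fun y => by field_simp
  have cL := continuousAt_ellSelbergSum (n := n) (N := N) (s := (0 : ℝ)) hp hq0 (cE a 10) cE1
    (cE c 2) (cE d 4) (cE e 3) (cE f 6) (cE g 14) (by simpa using ha) (by simpa using hb)
    (by simpa using hc) (by simpa using hd) (by simpa using he) (by simpa using hf)
    (by simpa using hg) (by simpa using hθa) (by simpa using hden)
  have cR := continuousAt_ellSelbergSum (n := n) (N := N) (s := (0 : ℝ)) hp hq0 (cE lam 13)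
    (((cE lam 13).mul cE1).div (cE a 10) (by simpa using ha))
    (((cE lam 13).mul (cE c 2)).div (cE a 10) (by simpa using ha))
    (((cE lam 13).mul (cE d 4)).div (cE a 10) (by simpa using ha)) (cE e 3) (cE f 6) (cE g 14)
    (by simpa using hl) (by simp [hl, hb, ha]) (by simp [hl, hc, ha]) (by simp [hl, hd, ha])
    (by simpa using he) (by simpa using hf) (by simpa using hg) (by simpa using hθlam)
    (by simp [ellFacs, hlb, hnq, hab, hac, had, hden'])
  have cP : ContinuousAt (fun s : ℝ => ∏ j ∈ Finset.range n, selbergRatio p q N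
      (a * (Real.exp s : ℂ) ^ 10) (b * (Real.exp s : ℂ)) (c * (Real.exp s : ℂ) ^ 2)
      (d * (Real.exp s : ℂ) ^ 4) (e * (Real.exp s : ℂ) ^ 3) (f * (Real.exp s : ℂ) ^ 6)
      (g * (Real.exp s : ℂ) ^ 14) (lam * (Real.exp s : ℂ) ^ 13) j) 0 := by
    refine tendsto_finsetProd _ fun j hj => continuousAt_selbergRatio hp hq0 (cE a 10) cE1 (cE c 2)
      (cE d 4) (cE e 3) (cE f 6) (cE g 14) (cE lam 13) (by simpa using ha) (by simpa using hb)
      (by simpa using hc) (by simpa using hd) (by simpa using he) (by simpa using hf)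
      (by simpa using hg) (by simpa using hl) ?_ ?_
    · have hj' : j ≤ n - 1 := Nat.le_sub_one_of_lt (Finset.mem_range.1 hj)
      simp [ellFacs, ellFac_ne_zero_of_le hpre.1 hj', ellFac_ne_zero_of_le hpre.2.1 hj',
        ellFac_ne_zero_of_le hpre.2.2 hj']
    · have hj' : N - j ≤ N := Nat.sub_le _ _
      simp [ellFacs, ellFac_ne_zero_of_le hae hj', ellFac_ne_zero_of_le haf hj',
        ellFac_ne_zero_of_le hag hj']
  have cZ : ContinuousAt (fun s : ℝ => ((a * (Real.exp s : ℂ) ^ 10) /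
      (lam * (Real.exp s : ℂ) ^ 13)) ^ (((N : ℤ) + 1 - (n : ℤ)) * (n : ℤ))) 0 :=
    ((cE a 10).div (cE lam 13) (by simpa using hl)).zpow₀ _ (Or.inl (by simp [ha, hl]))
  have cQ : ContinuousAt (fun s : ℝ => ellFac p q (a * (Real.exp s : ℂ) ^ 10 * q) N ^ n /
      ellFac p q (lam * (Real.exp s : ℂ) ^ 13 * q) N ^ n) 0 :=
    ((continuousAt_ellFac hp hq0 ((cE a 10).mul continuousAt_const) (by simp [ha, hq0]) N).pow
      n).div ((continuousAt_ellFac hp hq0 ((cE lam 13).mul continuousAt_const)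
        (by simp [hl, hq0]) N).pow n) (by simpa using pow_ne_zero n hlamq)
  -- The perturbed relations are the original ones multiplied by e^{23s} and e^{20s}.
  have hgen := (eventually_selbergGeneric hp hq0 ha hb hc hd he hf hg hl).mono fun s G =>
    have ht : (Real.exp s : ℂ) ≠ 0 := Complex.ofReal_ne_zero.2 (Real.exp_pos s).ne'
    ellSelbergSum_transformation_of_generic hp hq0 (by positivity) (by positivity) (by positivity)
      (by positivity) (by positivity) (by positivity) (by positivity) (by positivity) G hn hnq
      (by linear_combination (Real.exp s : ℂ) ^ 23 * hbal1)
      (by linear_combination (Real.exp s : ℂ) ^ 20 * hlam1)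
  -- A co-countable subset of ℝ is dense, so the identity holds at parameters s arbitrarily near 0,
  -- where both sides are continuous.
  have hdense := (mem_cocountable.1 hgen).dense_compl ℝ
  rw [compl_compl] at hdense
  have hlim := tendsto_nhds_unique_of_frequently_eq cL.tendsto
    (((cZ.mul cQ).mul cP).mul cR).tendsto (mem_closure_iff_frequently.1 (hdense 0))
  simpa [selbergRatio] using hlim
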